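/- Let $\mathbb D$ be the open unit disc in $\mathbb C$, let $p,q\in(0,\infty)$ and $n\in\{0,1,2,\dots\}$, and let $\phi$ be a normal function: a positive continuous function on $[0,1)$ for which there are $b>a>0$ such that, as $r\to1^-$, $\phi(r)/(1-r)^a$ is non-increasing with limit $0$ and $\phi(r)/(1-r)^b$ is non-decreasing with limit $\infty$. Let $H(p,q,\phi)$ be the space of analytic functions $f$ on $\mathbb D$ with $$\|f\|_{p,q,\phi}^p=\int_0^1 M_q(f,r)^p\,\frac{\phi(r)^p}{1-r}\,dr<\infty,\qquad M_q(f,r)=\Big(\frac1{2\pi}\int_0^{2\pi}|f(re^{i\theta})|^q\,d\theta\Big)^{1/q}.$$ For a weight $\mu$ (a positive continuous function on $\mathbb D$), let $\mathcal Z_\mu$ be the space of analytic functions $f$ on $\mathbb D$ with $\sup_{z\in\mathbb D}\mu(|z|)|f''(z)|<\infty$, with norm $\|f\|_{\mathcal Z_\mu}=|f(0)|+|f'(0)|+\sup_{z\in\mathbb D}\mu(|z|)|f''(z)|$. For an analytic self-map $\varphi$ of $\mathbb D$ and an analytic function $g$ on $\mathbb D$ put $$(C^n_{\varphi,g}f)(z)=\int_0^z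 f^{(n)}(\varphi(\xi))\,g(\xi)\,d\xi .$$ For a bounded linear operator $T:H(p,q,\phi)\to\mathcal Z_\mu$ let $\|T\|_e=\inf_S\sup_{\|f\|_{p,q,\phi}\le1}\|(T-S)f\|_{\mathcal Z_\mu}$, where $S$ runs over the compact linear operators from $H(p,q,\phi)$ to $\mathcal Z_\mu$. Then there are constants $c,C>0$, depending only on $p,q,\phi,n$, such that for every analytic self-map $\varphi$ of $\mathbb D$, every analytic $g$ on $\mathbb D$ and every weight $\mu$ for which $C^n_{\varphi,g}$ is bounded from $H(p,q,\phi)$ into $\mathcal Z_\mu$, $$c\,\max\{A,B\}\le\|C^n_{\varphi,g}\|_e\le C\,\max\{A,B\},$$ where $$A=\limsup_{|\varphi(z)|\to1}\frac{\mu(|z|)\,|\varphi'(z)g(z)|}{\phi(|\varphi(z)|)(1-|\varphi(z)|^2)^{1/q+n+1}},\qquad B=\limsup_{|\varphi(z)|\to1}\frac{\mu(|z|)\,|g'(z)|}{\phi(|\varphi(z)|)(1-|\varphi(z)|^2)^{1/q+n}},$$ and both limits superior are understood to be $0$ when $\sup_{z\in\mathbb D}|\varphi(z)|<1$. -/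

import Mathlib

open MeasureTheory Filter Topology Set
open scoped ENNReal NNReal

noncomputable section

/-- The open unit disc `𝔻` of the complex plane. -/
def disc : Set ℂ := Metric.ball (0 : ℂ) 1

/-- A positive continuous function `φ` on `[0,1)` is normal if for some `b > a > 0` the quotient
`φ(r)/(1-r)^a` decreases to `0` and `φ(r)/(1-r)^b` increases to `∞` as `r → 1⁻`. Values of `φ`
outside `[0,1)` play no role. -/
def IsNormal (φ : ℝ → ℝ) : Prop :=
  ContinuousOn φ (Ico 0 1) ∧ (∀ r ∈ Ico (0 : ℝ) 1, 0 < φ r) ∧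
  ∃ a b : ℝ, 0 < a ∧ a < b ∧
    AntitoneOn (fun r => φ r / (1 - r) ^ a) (Ico 0 1) ∧
    Tendsto (fun r => φ r / (1 - r) ^ a) (𝓝[<] 1) (𝓝 0) ∧
    MonotoneOn (fun r => φ r / (1 - r) ^ b) (Ico 0 1) ∧
    Tendsto (fun r => φ r / (1 - r) ^ b) (𝓝[<] 1) atTop

/-- A weight: a positive continuous function on the disc. -/
def IsWeight (μ : ℂ → ℝ) : Prop :=
  ContinuousOn μ disc ∧ ∀ z ∈ disc, 0 < μ z

/-- The space `H(𝔻)` of analytic functions on the disc. A function on the disc is represented by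
its extension by zero to `ℂ`, so that two elements are equal iff they agree on the disc. -/
def HolDisc : Submodule ℂ (ℂ → ℂ) where
  carrier := {f | DifferentiableOn ℂ f disc ∧ ∀ z, z ∉ disc → f z = 0}
  add_mem' := by
    rintro f g ⟨hf, hf0⟩ ⟨hg, hg0⟩
    exact ⟨hf.add hg, fun z hz => by simp [hf0 z hz, hg0 z hz]⟩
  zero_mem' := ⟨differentiableOn_const 0, fun _ _ => rfl⟩
  smul_mem' := by
    rintro c f ⟨hf, hf0⟩
    exact ⟨hf.const_smul c, fun z hz => by simp [hf0 z hz]⟩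

/-- The integral mean `M_q(f,r) = ((1/2π) ∫_0^{2π} |f(r e^{iθ})|^q dθ)^{1/q}`. -/
def integralMean (q : ℝ) (f : ℂ → ℂ) (r : ℝ) : ℝ≥0∞ :=
  (ENNReal.ofReal (1 / (2 * Real.pi)) *
    ∫⁻ θ in Ioc 0 (2 * Real.pi), ‖f (circleMap 0 r θ)‖ₑ ^ q) ^ (1 / q)

/-- The mixed (quasi-)norm `(∫_0^1 M_q(f,r)^p φ(r)^p / (1-r) dr)^{1/p}`, with values in
`[0,∞]`. -/
def mixedNorm (p q : ℝ) (φ : ℝ → ℝ) (f : ℂ → ℂ) : ℝ≥0∞ :=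
  (∫⁻ r in Ioo (0 : ℝ) 1, integralMean q f r ^ p * ENNReal.ofReal (φ r ^ p / (1 - r))) ^ (1 / p)

/-- The Zygmund norm `|f(0)| + |f'(0)| + sup_{z ∈ 𝔻} μ(|z|) |f''(z)|`, with values in `[0,∞]`. -/
def zygmundNorm (μ : ℂ → ℝ) (f : ℂ → ℂ) : ℝ≥0∞ :=
  ‖f 0‖ₑ + ‖deriv f 0‖ₑ +
    ⨆ z ∈ disc, ENNReal.ofReal (μ ((‖z‖ : ℝ) : ℂ)) * ‖deriv (deriv f) z‖ₑ

theorem isOpen_disc : IsOpen disc := Metric.isOpen_ball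

theorem HolDisc.measurable (f : HolDisc) : Measurable (f : ℂ → ℂ) := by
  classical
  have h : (f : ℂ → ℂ) = disc.piecewise (f : ℂ → ℂ) (fun _ => 0) := by
    funext z
    by_cases hz : z ∈ disc
    · simp [hz]
    · simp [hz, f.2.2 z hz]
  rw [h]
  exact f.2.1.continuousOn.measurable_piecewise continuousOn_const isOpen_disc.measurableSet

theorem measurable_enorm_circle (q : ℝ) (f : HolDisc) :
    Measurable (fun x : ℝ × ℝ => ‖(f : ℂ → ℂ) (circleMap 0 x.1 x.2)‖ₑ ^ q) := by
  have hc : Measurable (fun x : ℝ × ℝ => circleMap 0 x.1 x.2) := by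
    unfold circleMap
    exact Continuous.measurable (by fun_prop)
  exact (((HolDisc.measurable f).comp hc).enorm).pow_const q

theorem measurable_integralMean (q : ℝ) (f : HolDisc) :
    Measurable (integralMean q (f : ℂ → ℂ)) := by
  unfold integralMean
  exact ((measurable_enorm_circle q f).lintegral_prod_right'.const_mul _).pow_const _

theorem ennreal_add_rpow_le {s : ℝ} (hs : 0 < s) (a b : ℝ≥0∞) :
    (a + b) ^ s ≤ 2 ^ s * (a ^ s + b ^ s) := by
  have key : ∀ a b : ℝ≥0∞, a ≤ b → (a + b) ^ s ≤ 2 ^ s * (a ^ s + b ^ s) := by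
    intro a b h
    calc (a + b) ^ s ≤ (2 * b) ^ s := by
          apply ENNReal.rpow_le_rpow _ hs.le
          rw [two_mul]
          gcongr
      _ = 2 ^ s * b ^ s := ENNReal.mul_rpow_of_nonneg _ _ hs.le
      _ ≤ 2 ^ s * (a ^ s + b ^ s) := by
          gcongr
          exact le_add_self
  rcases le_total a b with h | h
  · exact key a b h
  · rw [add_comm a b, add_comm (a ^ s)]
    exact key b a h

theorem ennreal_mean_add_le {q : ℝ} (hq : 0 < q) (c A B D : ℝ≥0∞) (h : D ≤ 2 ^ q * (A + B)) :
    (c * D) ^ (1 / q) ≤ 2 * (2 ^ (1 / q) * ((c * A) ^ (1 / q) + (c * B) ^ (1 / q))) := by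
  have hq' : 0 < 1 / q := by positivity
  have h1 : c * D ≤ 2 ^ q * (c * A + c * B) := by
    calc c * D ≤ c * (2 ^ q * (A + B)) := mul_le_mul_right h c
      _ = 2 ^ q * (c * A + c * B) := by rw [mul_left_comm, mul_add c]
  calc (c * D) ^ (1 / q) ≤ (2 ^ q * (c * A + c * B)) ^ (1 / q) :=
        ENNReal.rpow_le_rpow h1 hq'.le
    _ = 2 * (c * A + c * B) ^ (1 / q) := by
        rw [ENNReal.mul_rpow_of_nonneg _ _ hq'.le, ← ENNReal.rpow_mul,
          mul_one_div_cancel hq.ne', ENNReal.rpow_one]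
    _ ≤ _ := mul_le_mul_right (ennreal_add_rpow_le hq' _ _) 2

theorem integralMean_add_le {q : ℝ} (hq : 0 < q) (f g : HolDisc) (r : ℝ) :
    integralMean q ((f : ℂ → ℂ) + (g : ℂ → ℂ)) r ≤
      2 * (2 ^ (1 / q) * (integralMean q f r + integralMean q g r)) := by
  have hm : Measurable (fun θ : ℝ => ‖(f : ℂ → ℂ) (circleMap 0 r θ)‖ₑ ^ q) :=
    Measurable.comp (g := fun x : ℝ × ℝ => ‖(f : ℂ → ℂ) (circleMap 0 x.1 x.2)‖ₑ ^ q)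
      (f := fun θ : ℝ => (r, θ)) (measurable_enorm_circle q f) measurable_prodMk_left
  have h2 : (2 ^ q : ℝ≥0∞) ≠ ∞ := ENNReal.rpow_ne_top_of_nonneg hq.le ENNReal.ofNat_ne_top
  apply ennreal_mean_add_le hq
  rw [← lintegral_add_left hm, ← lintegral_const_mul' _ _ h2]
  apply lintegral_mono
  intro θ
  exact (ENNReal.rpow_le_rpow (enorm_add_le _ _) hq.le).trans (ennreal_add_rpow_le hq _ _)

theorem integralMean_smul {q : ℝ} (hq : 0 < q) (c : ℂ) (f : ℂ → ℂ) (r : ℝ) :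
    integralMean q (c • f) r = ‖c‖ₑ * integralMean q f r := by
  have hq' : 0 < 1 / q := by positivity
  unfold integralMean
  simp only [Pi.smul_apply, smul_eq_mul, enorm_mul, ENNReal.mul_rpow_of_nonneg _ _ hq.le]
  rw [lintegral_const_mul' _ _ (by finiteness), mul_left_comm,
    ENNReal.mul_rpow_of_nonneg _ _ hq'.le, ← ENNReal.rpow_mul,
    mul_one_div_cancel hq.ne', ENNReal.rpow_one]

/-- The mixed-norm space `H(p,q,φ)`: all analytic functions on the disc with finite mixed norm. -/
def mixedNormSpace (p q : ℝ) (hp : 0 < p) (hq : 0 < q) (φ : ℝ → ℝ) (hφ : IsNormal φ) :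
    Submodule ℂ HolDisc where
  carrier := {f | mixedNorm p q φ f < ∞}
  add_mem' := by
    intro f g hf hg
    have hp' : 0 < 1 / p := by positivity
    simp only [mem_ofPred_eq, mixedNorm, ENNReal.rpow_lt_top_iff_of_pos hp'] at hf hg ⊢
    set w : ℝ → ℝ≥0∞ := fun r => ENNReal.ofReal (φ r ^ p / (1 - r)) with hw
    have hwm : AEMeasurable w (volume.restrict (Ioo (0 : ℝ) 1)) := by
      have hc : ContinuousOn (fun r => φ r ^ p / (1 - r)) (Ioo (0 : ℝ) 1) := by
        apply ContinuousOn.div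
        · exact (hφ.1.mono Ioo_subset_Ico_self).rpow_const (fun _ _ => Or.inr hp.le)
        · fun_prop
        · intro r hr
          have := hr.2
          linarith
      exact (hc.aemeasurable measurableSet_Ioo).ennreal_ofReal
    have hm : AEMeasurable (fun r => integralMean q (f : ℂ → ℂ) r ^ p * w r)
        (volume.restrict (Ioo (0 : ℝ) 1)) :=
      ((measurable_integralMean q f).pow_const p).aemeasurable.mul hwm
    have hle : ∀ r, integralMean q ((f : ℂ → ℂ) + (g : ℂ → ℂ)) r ^ p * w r ≤
        ((2 * 2 ^ (1 / q)) ^ p * 2 ^ p) *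
          (integralMean q (f : ℂ → ℂ) r ^ p * w r + integralMean q (g : ℂ → ℂ) r ^ p * w r) := by
      intro r
      calc _ ≤ ((2 * 2 ^ (1 / q)) * (integralMean q f r + integralMean q g r)) ^ p * w r := by
            gcongr
            rw [mul_assoc]
            exact integralMean_add_le hq f g r
        _ ≤ ((2 * 2 ^ (1 / q)) ^ p *
              (2 ^ p * (integralMean q f r ^ p + integralMean q g r ^ p))) * w r := by
            rw [ENNReal.mul_rpow_of_nonneg _ _ hp.le]
            gcongr
            exact ennreal_add_rpow_le hp _ _
        _ = _ := by ring
    have hK : ((2 * 2 ^ (1 / q)) ^ p * 2 ^ p : ℝ≥0∞) ≠ ∞ := by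
      have : 0 ≤ 1 / q := by positivity
      finiteness
    refine (lintegral_mono hle).trans_lt ?_
    rw [lintegral_const_mul' _ _ hK, lintegral_add_left' hm]
    exact ENNReal.mul_lt_top hK.lt_top (ENNReal.add_lt_top.2 ⟨hf, hg⟩)
  zero_mem' := by
    have hp' : 0 < 1 / p := by positivity
    have hq' : 0 < 1 / q := by positivity
    have h0 : ∀ r, integralMean q (0 : ℂ → ℂ) r = 0 := by
      intro r
      simp [integralMean, hq, ENNReal.zero_rpow_of_pos]
    simp [mixedNorm, h0, hp, ENNReal.zero_rpow_of_pos]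
  smul_mem' := by
    intro c f hf
    have hp' : 0 < 1 / p := by positivity
    simp only [mem_ofPred_eq, mixedNorm, ENNReal.rpow_lt_top_iff_of_pos hp'] at hf ⊢
    have h : ∀ r, integralMean q ((c • f : HolDisc) : ℂ → ℂ) r =
        ‖c‖ₑ * integralMean q (f : ℂ → ℂ) r := fun r => integralMean_smul hq c f r
    simp only [h, ENNReal.mul_rpow_of_nonneg _ _ hp.le, mul_assoc]
    rw [lintegral_const_mul' _ _ (by finiteness)]
    exact ENNReal.mul_lt_top (by finiteness) hf

theorem HolDisc.differentiableAt (f : HolDisc) {z : ℂ} (hz : z ∈ disc) :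
    DifferentiableAt ℂ (f : ℂ → ℂ) z := f.2.1.differentiableAt (isOpen_disc.mem_nhds hz)

theorem HolDisc.analyticAt (f : HolDisc) {z : ℂ} (hz : z ∈ disc) :
    AnalyticAt ℂ (f : ℂ → ℂ) z := f.2.1.analyticAt (isOpen_disc.mem_nhds hz)

theorem HolDisc.iteratedDeriv_add (n : ℕ) (f g : HolDisc) {z : ℂ} (hz : z ∈ disc) :
    iteratedDeriv n ((f : ℂ → ℂ) + (g : ℂ → ℂ)) z =
      iteratedDeriv n (f : ℂ → ℂ) z + iteratedDeriv n (g : ℂ → ℂ) z :=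
  _root_.iteratedDeriv_add (HolDisc.analyticAt f hz).contDiffAt (HolDisc.analyticAt g hz).contDiffAt

theorem HolDisc.iteratedDeriv_smul (n : ℕ) (c : ℂ) (f : HolDisc) {z : ℂ} (hz : z ∈ disc) :
    iteratedDeriv n (c • (f : ℂ → ℂ)) z = c * iteratedDeriv n (f : ℂ → ℂ) z := by
  rw [iteratedDeriv_const_smul (c := c) (HolDisc.analyticAt f hz).contDiffAt]
  rfl

theorem deriv_deriv_eq (f : ℂ → ℂ) : deriv (deriv f) = iteratedDeriv 2 f := by
  rw [iteratedDeriv_succ, iteratedDeriv_one]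

theorem zero_mem_disc : (0 : ℂ) ∈ disc := by simp [disc]

/-- The weighted Zygmund space `Z_μ`: all analytic `f` on the disc with
`sup_{z ∈ 𝔻} μ(|z|) |f''(z)| < ∞`. -/
def zygmundSpace (μ : ℂ → ℝ) : Submodule ℂ HolDisc where
  carrier := {f | ⨆ z ∈ disc,
    ENNReal.ofReal (μ ((‖z‖ : ℝ) : ℂ)) * ‖deriv (deriv (f : ℂ → ℂ)) z‖ₑ < ∞}
  add_mem' := by
    intro f g hf hg
    refine lt_of_le_of_lt ?_ (ENNReal.add_lt_top.2 ⟨hf, hg⟩)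
    refine iSup₂_le fun z hz => ?_
    have h : deriv (deriv ((f + g : HolDisc) : ℂ → ℂ)) z =
        deriv (deriv (f : ℂ → ℂ)) z + deriv (deriv (g : ℂ → ℂ)) z := by
      simp only [deriv_deriv_eq]
      exact HolDisc.iteratedDeriv_add 2 f g hz
    rw [h]
    calc _ ≤ ENNReal.ofReal (μ ((‖z‖ : ℝ) : ℂ)) *
          (‖deriv (deriv (f : ℂ → ℂ)) z‖ₑ + ‖deriv (deriv (g : ℂ → ℂ)) z‖ₑ) := by
          gcongr
          exact enorm_add_le _ _
      _ ≤ _ := by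
          rw [mul_add]
          exact add_le_add
            (le_iSup₂ (f := fun z (_ : z ∈ disc) =>
              ENNReal.ofReal (μ ((‖z‖ : ℝ) : ℂ)) * ‖deriv (deriv (f : ℂ → ℂ)) z‖ₑ) z hz)
            (le_iSup₂ (f := fun z (_ : z ∈ disc) =>
              ENNReal.ofReal (μ ((‖z‖ : ℝ) : ℂ)) * ‖deriv (deriv (g : ℂ → ℂ)) z‖ₑ) z hz)
  zero_mem' := by
    have h : deriv (deriv ((0 : HolDisc) : ℂ → ℂ)) = 0 := by
      funext z
      simp
    simp
  smul_mem' := by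
    intro c f hf
    refine lt_of_le_of_lt ?_ (ENNReal.mul_lt_top (enorm_lt_top (x := c)) hf)
    refine iSup₂_le fun z hz => ?_
    have h : deriv (deriv ((c • f : HolDisc) : ℂ → ℂ)) z = c * deriv (deriv (f : ℂ → ℂ)) z := by
      simp only [deriv_deriv_eq]
      exact HolDisc.iteratedDeriv_smul 2 c f hz
    rw [h, enorm_mul, mul_left_comm]
    gcongr
    exact le_iSup₂ (f := fun z (_ : z ∈ disc) =>
      ENNReal.ofReal (μ ((‖z‖ : ℝ) : ℂ)) * ‖deriv (deriv (f : ℂ → ℂ)) z‖ₑ) z hz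

/-- `∫_0^z h(ξ) dξ` along the segment from `0` to `z`, as a function of `z ∈ 𝔻` extended by
zero. -/
def discPrimitive (h : ℂ → ℂ) : ℂ → ℂ :=
  disc.indicator fun z => ∫ t in (0 : ℝ)..1, z * h (t * z)

theorem ofReal_mul_mem_disc {z : ℂ} (hz : z ∈ disc) {t : ℝ} (ht : t ∈ Icc (0 : ℝ) 1) :
    (t : ℂ) * z ∈ disc := by
  simp only [disc, mem_ball_zero_iff] at hz ⊢
  rw [norm_mul, Complex.norm_real, Real.norm_of_nonneg ht.1]
  nlinarith [norm_nonneg z, ht.2, ht.1]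

theorem discPrimitive_intervalIntegrable {h : ℂ → ℂ} (hh : ContinuousOn h disc) {z : ℂ}
    (hz : z ∈ disc) :
    IntervalIntegrable (fun t : ℝ => z * h (t * z)) volume 0 1 := by
  apply ContinuousOn.intervalIntegrable
  rw [uIcc_of_le zero_le_one]
  exact continuousOn_const.mul
    (hh.comp (by fun_prop) (fun t ht => ofReal_mul_mem_disc hz ht))

theorem discPrimitive_mem {h : ℂ → ℂ} (hh : DifferentiableOn ℂ h disc) :
    discPrimitive h ∈ HolDisc := by
  refine ⟨?_, fun z hz => by simp [discPrimitive, hz]⟩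
  obtain ⟨H, hH⟩ := hh.isExactOn_ball
  have heq : EqOn (discPrimitive h) (fun z => H z - H 0) disc := by
    intro z hz
    simp only [discPrimitive, indicator_of_mem hz]
    have := intervalIntegral.integral_eq_sub_of_hasDerivAt (a := (0 : ℝ)) (b := 1)
      (f := fun t : ℝ => H (t * z)) (f' := fun t : ℝ => z * h (t * z)) ?_
      (discPrimitive_intervalIntegrable hh.continuousOn hz)
    · simpa using this
    · intro t ht
      rw [uIcc_of_le zero_le_one] at ht
      have h1 := hH _ (ofReal_mul_mem_disc hz ht)
      have h2 : HasDerivAt (fun t : ℝ => (t : ℂ) * z) z t := by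
        simpa using (Complex.ofRealCLM.hasDerivAt (x := t)).mul_const z
      simpa [mul_comm, Function.comp_def] using h1.comp t h2
  have hd : DifferentiableOn ℂ (fun z => H z - H 0) disc :=
    fun z hz => ((hH z hz).differentiableAt.sub_const _).differentiableWithinAt
  exact hd.congr heq

theorem differentiableOn_symbol (n : ℕ) {ϕ g : ℂ → ℂ} (hϕ : DifferentiableOn ℂ ϕ disc)
    (hmap : MapsTo ϕ disc disc) (hg : DifferentiableOn ℂ g disc) (f : HolDisc) :
    DifferentiableOn ℂ (fun ξ => iteratedDeriv n (f : ℂ → ℂ) (ϕ ξ) * g ξ) disc := by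
  have hd : DifferentiableOn ℂ (iteratedDeriv n (f : ℂ → ℂ)) disc := fun z hz => by
    have h := (HolDisc.analyticAt f hz).iterated_deriv n
    rw [← iteratedDeriv_eq_iterate] at h
    exact h.differentiableAt.differentiableWithinAt
  exact (hd.comp hϕ hmap).mul hg

/-- The generalized integration operator `(C f)(z) = ∫_0^z f^{(n)}(ϕ(ξ)) g(ξ) dξ` on `H(𝔻)`,
for an analytic self-map `ϕ` of the disc and an analytic `g` on the disc. -/
def genIntOp (n : ℕ) (ϕ g : ℂ → ℂ) (hϕ : DifferentiableOn ℂ ϕ disc) (hmap : MapsTo ϕ disc disc)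
    (hg : DifferentiableOn ℂ g disc) : HolDisc →ₗ[ℂ] HolDisc where
  toFun f := ⟨discPrimitive fun ξ => iteratedDeriv n (f : ℂ → ℂ) (ϕ ξ) * g ξ,
    discPrimitive_mem (differentiableOn_symbol n hϕ hmap hg f)⟩
  map_add' := by
    intro f₁ f₂
    apply Subtype.ext
    funext z
    by_cases hz : z ∈ disc
    · simp only [discPrimitive, Submodule.coe_add, Pi.add_apply, indicator_of_mem hz]
      rw [← intervalIntegral.integral_add
        (discPrimitive_intervalIntegrable
          (differentiableOn_symbol n hϕ hmap hg f₁).continuousOn hz)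
        (discPrimitive_intervalIntegrable
          (differentiableOn_symbol n hϕ hmap hg f₂).continuousOn hz)]
      apply intervalIntegral.integral_congr
      intro t ht
      rw [uIcc_of_le zero_le_one] at ht
      simp only
      rw [HolDisc.iteratedDeriv_add n f₁ f₂ (hmap (ofReal_mul_mem_disc hz ht))]
      ring
    · simp [discPrimitive, hz]
  map_smul' := by
    intro c f
    apply Subtype.ext
    funext z
    by_cases hz : z ∈ disc
    · simp only [discPrimitive, Submodule.coe_smul, Pi.smul_apply, indicator_of_mem hz,
        RingHom.id_apply, smul_eq_mul]
      rw [← intervalIntegral.integral_const_mul]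
      apply intervalIntegral.integral_congr
      intro t ht
      rw [uIcc_of_le zero_le_one] at ht
      simp only
      rw [HolDisc.iteratedDeriv_smul n c f (hmap (ofReal_mul_mem_disc hz ht))]
      ring
    · simp [discPrimitive, hz]

section Operators

variable {X Y : Type} [AddCommGroup X] [Module ℂ X] [AddCommGroup Y] [Module ℂ Y]

/-- Boundedness of a linear map with respect to the (quasi-)norms `NX`, `NY`. -/
def IsBoundedOp (NX : X → ℝ≥0∞) (NY : Y → ℝ≥0∞) (T : X →ₗ[ℂ] Y) : Prop :=
  ∃ K : ℝ≥0, ∀ x, NY (T x) ≤ K * NX x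

/-- The operator norm `sup_{NX x ≤ 1} NY (T x)`. -/
def opNormOf (NX : X → ℝ≥0∞) (NY : Y → ℝ≥0∞) (T : X →ₗ[ℂ] Y) : ℝ≥0∞ :=
  ⨆ (x : X) (_ : NX x ≤ 1), NY (T x)

/-- Compactness of a linear map: the image of every bounded sequence has a subsequence that
converges in the target space. -/
def IsCompactOp (NX : X → ℝ≥0∞) (NY : Y → ℝ≥0∞) (T : X →ₗ[ℂ] Y) : Prop :=
  ∀ x : ℕ → X, (∃ M : ℝ≥0, ∀ k, NX (x k) ≤ M) →
    ∃ (y : Y) (σ : ℕ → ℕ), StrictMono σ ∧ Tendsto (fun k => NY (T (x (σ k)) - y)) atTop (𝓝 0)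

/-- The essential norm: the infimum of `‖T - S‖` over all compact operators `S : X → Y`. -/
def essNormOf (NX : X → ℝ≥0∞) (NY : Y → ℝ≥0∞) (T : X →ₗ[ℂ] Y) : ℝ≥0∞ :=
  ⨅ (S : X →ₗ[ℂ] Y) (_ : IsCompactOp NX NY S), opNormOf NX NY (T - S)

end Operators

/-- `limsup_{|ϕ(z)| → 1} F(z)` over `z ∈ 𝔻`; it is `0` when `sup_{z ∈ 𝔻} |ϕ(z)| < 1`. -/
def limsupToBoundary (ϕ : ℂ → ℂ) (F : ℂ → ℝ) : ℝ≥0∞ :=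
  limsup (fun z => ENNReal.ofReal (F z)) (comap (fun z => ‖ϕ z‖) (𝓝[<] 1) ⊓ 𝓟 disc)

/-- The mixed (quasi-)norm on the space `H(p,q,φ)`. -/
def mixedNormOn {p q : ℝ} {hp : 0 < p} {hq : 0 < q} {φ : ℝ → ℝ} {hφ : IsNormal φ}
    (f : mixedNormSpace p q hp hq φ hφ) : ℝ≥0∞ :=
  mixedNorm p q φ f

/-- The Zygmund norm on the space `Z_μ`. -/
def zygmundNormOn {μ : ℂ → ℝ} (h : zygmundSpace μ) : ℝ≥0∞ :=
  zygmundNorm μ h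

/-- The larger of the limits superior, as `|ϕ(z)| → 1`, of
`μ(|z|) |ϕ'(z) g(z)| / (φ(|ϕ(z)|) (1-|ϕ(z)|²)^{1/q+n+1})` and
`μ(|z|) |g'(z)| / (φ(|ϕ(z)|) (1-|ϕ(z)|²)^{1/q+n})`. -/
def boundaryMax (q : ℝ) (φ : ℝ → ℝ) (n : ℕ) (ϕ g : ℂ → ℂ) (μ : ℂ → ℝ) : ℝ≥0∞ :=
  max
    (limsupToBoundary ϕ fun z => μ ((‖z‖ : ℝ) : ℂ) * ‖deriv ϕ z * g z‖ /
      (φ ‖ϕ z‖ * (1 - ‖ϕ z‖ ^ 2) ^ (1 / q + n + 1)))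
    (limsupToBoundary ϕ fun z => μ ((‖z‖ : ℝ) : ℂ) * ‖deriv g z‖ /
      (φ ‖ϕ z‖ * (1 - ‖ϕ z‖ ^ 2) ^ (1 / q + n)))

end

/-! Everything rests on the identity `(C f)'' = f^{(n+1)}(ϕ) ϕ' g + f^{(n)}(ϕ) g'`, in which the
first term accounts for `A` and the second for `B`, and on the sharp growth bound `|f^{(m)}(w)| ≤ C
‖f‖ / (φ(|w|) (1-|w|)^{1/q+m})` on `H(p,q,φ)`.

Growth bound. By Jensen's formula `|f|^s` is subharmonic for every `s > 0`. With `s = min p q`, its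
mean over a logarithmic square of side comparable to `1-|w|` around `w` is controlled by the mixed
norm through the power mean inequality in each variable, because a normal `φ` is comparable to a
constant on such a square (`exists_norm_le`). Cauchy's estimates then give the derivatives
(`exists_norm_iteratedDeriv_le`).

Lower estimate. Two Cauchy kernels `(1 - w̄z)^{-N}` and `(1 - w̄z)^{-N-1}` combine into a bounded
family `F w` whose derivative of one of the orders `n`, `n+1` vanishes at `w`, while the other is as
large as the growth bound allows up to constants (`exists_test_functions`). Along points `z_k` with
`|ϕ(z_k)| → 1` nearly attaining the limit superior, with `w_k = ϕ(z_k)`, the number `μ(|z_k|) |(C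
F_{w_k})''(z_k)|` stays large, whereas `(C F_{w_l})''(z_k) → 0` as `l → ∞`. A compact `S` makes `S
F_{w_k}` convergent along a subsequence, so `C - S` must be large on the differences `F_{w_k} -
F_{w_l}` (`le_essNormOf`). Working with differences avoids duality and weak convergence, and hence
works in the quasi-normed range of `p` and `q` as well.

Upper estimate. The dilations `f ↦ f(r·)`, `r < 1`, are compact (`isCompactOp_dilation`), so the
essential norm is at most the norm of `C` applied to `f - f(r·)`. Where `|ϕ(z)|` is near `1` the
growth bound produces `A` and `B` with constants independent of `r`; elsewhere `f - f(r·)` and its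
derivatives are `O(1-r)`, uniformly on the unit ball, and `r → 1` removes that contribution
(`exists_zygmundNorm_sub_dilation_le`, `exists_essNorm_le`). -/

noncomputable section

/-! ### Subharmonicity of `|f|^s`. -/

/-- Jensen's inequality `log ‖f c‖ ≤ ⨍ log ‖f‖` for an analytic function. -/
theorem log_norm_le_circleAverage {c : ℂ} {R : ℝ} {f : ℂ → ℂ} (hR : 0 < R)
    (hf : AnalyticOnNhd ℂ f (Metric.closedBall c R)) (hc : f c ≠ 0) :
    Real.log ‖f c‖ ≤ Real.circleAverage (fun z => Real.log ‖f z‖) c R := by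
  have habs : |R| = R := abs_of_pos hR
  have hf' : AnalyticOnNhd ℂ f (Metric.closedBall c |R|) := by rwa [habs]
  rw [hf'.circleAverage_log_norm hR.ne' hc]
  -- Jensen's formula leaves a sum over zeros `u` of multiplicity times `log (R / ‖c - u‖)`, each
  -- term nonnegative because `u` lies in the ball. The term `u = c` is zero by the convention `log
  -- 0 = 0`.
  refine le_add_of_nonneg_left (finsum_nonneg fun u => ?_)
  by_cases hu : u ∈ Metric.closedBall c |R|
  · have hd : (0 : ℤ) ≤ MeromorphicOn.divisor f (Metric.closedBall c |R|) u := by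
      have := MeromorphicOn.AnalyticOnNhd.divisor_nonneg hf'
      exact this u
    have hd' : (0 : ℝ) ≤ MeromorphicOn.divisor f (Metric.closedBall c |R|) u := by exact_mod_cast hd
    by_cases huc : u = c
    · subst huc
      simp
    · refine mul_nonneg hd' (Real.log_nonneg ?_)
      have h0 : 0 < ‖c - u‖ := norm_pos_iff.2 (sub_ne_zero.2 (Ne.symm huc))
      rw [← div_eq_mul_inv, le_div_iff₀ h0, one_mul, ← dist_eq_norm, dist_comm]
      rwa [habs] at hu
  · simp [hu]

/-- The graph of `y ↦ exp (s y)` lies above its tangent at `l`; put `y = log x`. The condition `1 /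
s ≤ l` serves only `x = 0`, where `Real.log 0 = 0` and the left side must be nonpositive. -/
theorem rpow_ge_one_add_log {x l s : ℝ} (hx : 0 ≤ x) (hs : 0 < s) (hl : 1 / s ≤ l) :
    Real.exp (s * l) * (1 + s * (Real.log x - l)) ≤ x ^ s := by
  rcases hx.eq_or_lt with rfl | hx
  · rw [Real.zero_rpow hs.ne', Real.log_zero]
    have : 1 ≤ s * l := by rwa [div_le_iff₀' hs] at hl
    exact mul_nonpos_of_nonneg_of_nonpos (Real.exp_pos _).le (by linarith)
  · have h1 := Real.add_one_le_exp (s * (Real.log x - l))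
    calc _ ≤ Real.exp (s * l) * Real.exp (s * (Real.log x - l)) := by gcongr; linarith
      _ = x ^ s := by
        rw [← Real.exp_add, Real.rpow_def_of_pos hx]
        congr 1
        ring

/-- The sub-mean value property of `‖f‖ ^ s` for analytic `f` and `s > 0`. -/
theorem norm_rpow_le_circleAverage {c : ℂ} {R s : ℝ} {f : ℂ → ℂ} (hR : 0 < R) (hs : 0 < s)
    (hf : AnalyticOnNhd ℂ f (Metric.closedBall c R)) :
    ‖f c‖ ^ s ≤ Real.circleAverage (fun z => ‖f z‖ ^ s) c R := by
  by_cases hc : f c = 0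
  · rw [hc, norm_zero, Real.zero_rpow hs.ne']
    exact Real.circleAverage_nonneg_of_nonneg fun z _ => by positivity
  have hc0 : 0 < ‖f c‖ := norm_pos_iff.2 hc
  have hsph : Metric.sphere c |R| ⊆ Metric.closedBall c R := by
    rw [abs_of_pos hR]; exact Metric.sphere_subset_closedBall
  -- Rescaling makes `log ‖K f(c)‖` equal to `1 / s`, the threshold at which the tangent inequality
  -- also covers zeros of `f`. Both sides of the claim are homogeneous, so `K ^ s` cancels at the
  -- end.
  set K : ℝ := Real.exp (1 / s) / ‖f c‖ with hK
  have hK0 : 0 < K := by positivity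
  have hg : AnalyticOnNhd ℂ (fun z => (K : ℂ) * f z) (Metric.closedBall c R) :=
    fun z hz => analyticAt_const.mul (hf z hz)
  have hgn : ∀ z, ‖(K : ℂ) * f z‖ = K * ‖f z‖ := fun z => by
    rw [norm_mul, Complex.norm_real, Real.norm_of_nonneg hK0.le]
  have hgc : (K : ℂ) * f c ≠ 0 := mul_ne_zero (by exact_mod_cast hK0.ne') hc
  set l := Real.log ‖(K : ℂ) * f c‖ with hl
  have hl' : l = 1 / s := by
    rw [hl, hgn, hK, div_mul_cancel₀ _ hc0.ne', Real.log_exp]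
  have hint : CircleIntegrable (fun z => Real.log ‖(K : ℂ) * f z‖) c R :=
    MeromorphicOn.circleIntegrable_log_norm (f := fun z => (K : ℂ) * f z)
      (fun z hz => (hg z (hsph hz)).meromorphicAt)
  have hint3 : CircleIntegrable (fun z => s * (Real.log ‖(K : ℂ) * f z‖ - l)) c R :=
    IntervalIntegrable.const_mul (hint.sub (circleIntegrable_const l c R)) s
  have hint4 : CircleIntegrable (fun z => 1 + s * (Real.log ‖(K : ℂ) * f z‖ - l)) c R :=
    (circleIntegrable_const (1 : ℝ) c R).add hint3
  have hcont : ContinuousOn (fun z => ‖f z‖ ^ s) (Metric.sphere c |R|) :=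
    ((hf.continuousOn.mono hsph).norm).rpow_const fun _ _ => Or.inr hs.le
  have hint2 : CircleIntegrable (fun z => ‖f z‖ ^ s) c R := hcont.circleIntegrable'
  have key := log_norm_le_circleAverage hR hg hgc
  have hE : Real.exp (s * l) = K ^ s * ‖f c‖ ^ s := by
    rw [← Real.mul_rpow hK0.le hc0.le, ← hgn c, Real.rpow_def_of_pos (norm_pos_iff.2 hgc), mul_comm]
  have h2 : Real.circleAverage (fun z => Real.exp (s * l) *
      (1 + s * (Real.log ‖(K : ℂ) * f z‖ - l))) c R ≤
      Real.circleAverage (fun z => K ^ s * ‖f z‖ ^ s) c R := by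
    apply Real.circleAverage_mono
    · exact IntervalIntegrable.const_mul hint4 (Real.exp (s * l))
    · exact IntervalIntegrable.const_mul hint2 _
    · intro z _
      have := rpow_ge_one_add_log (x := ‖(K : ℂ) * f z‖) (norm_nonneg _) hs hl'.ge
      rw [← Real.mul_rpow hK0.le (norm_nonneg _), ← hgn z]
      exact this
  have h3 : Real.circleAverage (fun z => Real.exp (s * l) *
      (1 + s * (Real.log ‖(K : ℂ) * f z‖ - l))) c R =
      Real.exp (s * l) * (1 + s *
        (Real.circleAverage (fun z => Real.log ‖(K : ℂ) * f z‖) c R - l)) := by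
    have e1 := Real.circleAverage_fun_sub hint (circleIntegrable_const l c R)
    have e2 := Real.circleAverage_fun_smul (a := s) (c := c) (R := R)
      (f := fun z => Real.log ‖(K : ℂ) * f z‖ - l)
    have e3 := Real.circleAverage_fun_add (circleIntegrable_const (1 : ℝ) c R) hint3
    have e4 := Real.circleAverage_fun_smul (a := Real.exp (s * l)) (c := c) (R := R)
      (f := fun z => 1 + s * (Real.log ‖(K : ℂ) * f z‖ - l))
    simp only [smul_eq_mul] at e2 e3 e4
    rw [e4, e3, e2, e1, Real.circleAverage_const, Real.circleAverage_const]
  have h4 : Real.circleAverage (fun z => K ^ s * ‖f z‖ ^ s) c R =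
      K ^ s * Real.circleAverage (fun z => ‖f z‖ ^ s) c R :=
    Real.circleAverage_fun_smul (a := K ^ s) (f := fun z => ‖f z‖ ^ s)
  have h5 : K ^ s * ‖f c‖ ^ s ≤ K ^ s * Real.circleAverage (fun z => ‖f z‖ ^ s) c R := by
    rw [← h4, ← hE]
    refine le_trans ?_ h2
    rw [h3]
    have : 0 ≤ s * (Real.circleAverage (fun z => Real.log ‖(K : ℂ) * f z‖) c R - l) :=
      mul_nonneg hs.le (sub_nonneg.2 key)
    nlinarith [Real.exp_pos (s * l)]
  exact le_of_mul_le_mul_left h5 (by positivity)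

theorem setLIntegral_Ioc_of_periodic {h : ℝ → ℝ≥0∞} {T : ℝ} (hT : 0 < T)
    (hh : Function.Periodic h T) (a b : ℝ) :
    ∫⁻ x in Ioc a (a + T), h x = ∫⁻ x in Ioc b (b + T), h x := by
  have : Fact (0 < T) := ⟨hT⟩
  refine (isAddFundamentalDomain_Ioc hT a volume).setLIntegral_eq
    (isAddFundamentalDomain_Ioc hT b volume) h fun g x => ?_
  obtain ⟨n, hn⟩ := g.2
  have : (g +ᵥ x : ℝ) = x + n • T := by
    rw [AddSubmonoid.vadd_def]
    simp only [vadd_eq_add]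
    rw [← hn, add_comm]
  rw [this]
  exact hh.zsmul n x

/-- The starting angle `a` is free because circle averages run over `(0, 2π]` while polar
coordinates run over `(-π, π)`. -/
theorem enorm_rpow_le_lintegral_circle {d s : ℝ} {F : ℂ → ℂ} (hd : 0 < d) (hs : 0 < s)
    (hF : AnalyticOnNhd ℂ F (Metric.closedBall 0 d)) (a : ℝ) :
    ENNReal.ofReal (2 * Real.pi) * ‖F 0‖ₑ ^ s ≤
      ∫⁻ θ in Ioc a (a + 2 * Real.pi), ‖F (circleMap 0 d θ)‖ₑ ^ s := by
  have hper : Function.Periodic (fun θ => ‖F (circleMap 0 d θ)‖ₑ ^ s) (2 * Real.pi) := fun θ => by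
    simp only [periodic_circleMap 0 d θ]
  rw [setLIntegral_Ioc_of_periodic Real.two_pi_pos hper a 0, zero_add]
  have h1 := norm_rpow_le_circleAverage hd hs hF
  rw [Real.circleAverage_def, smul_eq_mul, ← div_eq_inv_mul,
    le_div_iff₀ Real.two_pi_pos, mul_comm] at h1
  have h2 : ∀ z, ‖F z‖ₑ ^ s = ENNReal.ofReal (‖F z‖ ^ s) := fun z => by
    rw [← ofReal_norm, ENNReal.ofReal_rpow_of_nonneg (norm_nonneg _) hs.le]
  simp only [h2]
  rw [← ENNReal.ofReal_mul Real.two_pi_pos.le]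
  refine (ENNReal.ofReal_le_ofReal h1).trans ?_
  rw [intervalIntegral.integral_of_le Real.two_pi_pos.le,
    ofReal_integral_eq_lintegral_ofReal]
  · have hsph : Metric.sphere (0 : ℂ) |d| ⊆ Metric.closedBall 0 d := by
      rw [abs_of_pos hd]; exact Metric.sphere_subset_closedBall
    have hcont : ContinuousOn (fun z => ‖F z‖ ^ s) (Metric.sphere 0 |d|) :=
      ((hF.continuousOn.mono hsph).norm).rpow_const fun _ _ => Or.inr hs.le
    have := hcont.circleIntegrable'
    unfold CircleIntegrable at this
    rwa [intervalIntegrable_iff_integrableOn_Ioc_of_le Real.two_pi_pos.le] at this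
  · exact ae_of_all _ fun θ => by positivity

theorem lintegral_ofReal_Ioo {d : ℝ} (hd : 0 < d) :
    ∫⁻ r in Ioo 0 d, ENNReal.ofReal r = ENNReal.ofReal (d ^ 2 / 2) := by
  rw [← ofReal_integral_eq_lintegral_ofReal]
  · rw [← integral_Ioc_eq_integral_Ioo, ← intervalIntegral.integral_of_le hd.le, integral_id]
    simp
  · exact (continuous_id.integrableOn_Icc (a := 0) (b := d)).mono_set Ioo_subset_Icc_self
  · exact (ae_restrict_iff' measurableSet_Ioo).2 (ae_of_all _ fun r hr => hr.1.le)

/-- The sub-mean value property of `‖F‖ ^ s` over discs. -/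
theorem enorm_rpow_le_lintegral_ball {d s : ℝ} {F : ℂ → ℂ} (hd : 0 < d) (hs : 0 < s)
    (hm : Measurable F) (hF : DifferentiableOn ℂ F (Metric.ball 0 d)) :
    ENNReal.ofReal (Real.pi * d ^ 2) * ‖F 0‖ₑ ^ s ≤
      ∫⁻ z in Metric.ball 0 d, ‖F z‖ₑ ^ s := by
  set G : ℂ → ℝ≥0∞ := (Metric.ball 0 d).indicator fun z => ‖F z‖ₑ ^ s with hG
  have hGm : Measurable G := (hm.enorm.pow_const s).indicator measurableSet_ball
  rw [← lintegral_indicator measurableSet_ball, ← Complex.lintegral_comp_polarCoord_symm]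
  have hsymm : ∀ p : ℝ × ℝ, Complex.polarCoord.symm p = circleMap 0 p.1 p.2 := fun p => by
    rw [Complex.polarCoord_symm_apply, circleMap_zero, Complex.exp_mul_I]
    push_cast
    rfl
  simp only [hsymm, smul_eq_mul]
  have hcm : Measurable fun p : ℝ × ℝ => circleMap 0 p.1 p.2 := by
    unfold circleMap
    exact Continuous.measurable (by fun_prop)
  have ht : polarCoord.target = Ioi (0 : ℝ) ×ˢ Ioo (-Real.pi) Real.pi := rfl
  have hm' : Measurable fun p : ℝ × ℝ => ENNReal.ofReal p.1 * G (circleMap 0 p.1 p.2) :=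
    (ENNReal.measurable_ofReal.comp measurable_fst).mul (hGm.comp hcm)
  rw [ht, Measure.volume_eq_prod, ← Measure.prod_restrict, lintegral_prod _ hm'.aemeasurable]
  -- The circle inequality is integrated against `r dr` over `(0, d)`, and `2π · d² / 2 = π d²`.
  calc ENNReal.ofReal (Real.pi * d ^ 2) * ‖F 0‖ₑ ^ s
      = ∫⁻ r in Ioo 0 d, ENNReal.ofReal r * (ENNReal.ofReal (2 * Real.pi) * ‖F 0‖ₑ ^ s) := by
        rw [lintegral_mul_const _ ENNReal.measurable_ofReal, lintegral_ofReal_Ioo hd, ← mul_assoc,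
          ← ENNReal.ofReal_mul (by positivity)]
        congr 2
        ring
    _ ≤ ∫⁻ r in Ioo 0 d, ∫⁻ θ in Ioo (-Real.pi) Real.pi,
          ENNReal.ofReal r * G (circleMap 0 r θ) := by
        refine setLIntegral_mono' measurableSet_Ioo fun r hr => ?_
        rw [lintegral_const_mul' _ _ ENNReal.ofReal_ne_top]
        gcongr
        have hA : AnalyticOnNhd ℂ F (Metric.closedBall 0 r) := fun z hz =>
          hF.analyticAt (Metric.isOpen_ball.mem_nhds (Metric.closedBall_subset_ball hr.2 hz))
        refine (enorm_rpow_le_lintegral_circle hr.1 hs hA (-Real.pi)).trans ?_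
        rw [show -Real.pi + 2 * Real.pi = Real.pi by ring,
          setLIntegral_congr Ioo_ae_eq_Ioc.symm]
        refine lintegral_mono fun θ => ?_
        rw [hG, indicator_of_mem]
        simp [abs_of_pos hr.1, hr.2]
    _ ≤ _ := lintegral_mono_set Ioo_subset_Ioi_self

/-- The disc sits inside the square. A product domain is what lets the radial and angular
integrations be separated after passing to logarithmic coordinates. -/
theorem enorm_rpow_le_lintegral_square {d s : ℝ} {F : ℂ → ℂ} (hd : 0 < d) (hs : 0 < s)
    (hm : Measurable F) (hF : DifferentiableOn ℂ F (Metric.ball 0 d)) :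
    ENNReal.ofReal (Real.pi * d ^ 2) * ‖F 0‖ₑ ^ s ≤
      ∫⁻ x in Ioo (-d) d, ∫⁻ y in Ioo (-d) d, ‖F (x + y * Complex.I)‖ₑ ^ s := by
  refine (enorm_rpow_le_lintegral_ball hd hs hm hF).trans ?_
  rw [← (Complex.volume_preserving_equiv_real_prod.symm).setLIntegral_comp_preimage_emb
    Complex.measurableEquivRealProd.symm.measurableEmbedding]
  have hsub : Complex.measurableEquivRealProd.symm ⁻¹' Metric.ball 0 d ⊆
      Ioo (-d) d ×ˢ Ioo (-d) d := by
    intro p hp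
    simp only [mem_preimage, mem_ball_zero_iff] at hp
    have h1 := (Complex.abs_re_le_norm _).trans_lt hp
    have h2 := (Complex.abs_im_le_norm _).trans_lt hp
    exact ⟨abs_lt.1 h1, abs_lt.1 h2⟩
  refine (lintegral_mono_set hsub).trans ?_
  have heq : ∀ p : ℝ × ℝ, Complex.measurableEquivRealProd.symm p = p.1 + p.2 * Complex.I :=
    fun p => Complex.mk_eq_add_mul_I _ _
  simp only [heq]
  have hcm : Measurable fun p : ℝ × ℝ => (p.1 + p.2 * Complex.I : ℂ) :=
    Continuous.measurable (by fun_prop)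
  have hm' : Measurable fun p : ℝ × ℝ => ‖F (p.1 + p.2 * Complex.I)‖ₑ ^ s :=
    (hm.comp hcm).enorm.pow_const s
  rw [Measure.volume_eq_prod, ← Measure.prod_restrict, lintegral_prod _ hm'.aemeasurable]

/-! ### Growth estimates in the mixed norm space. -/

/-- Monotonicity of power means, for `ℝ≥0∞`-valued functions. -/
theorem lintegral_rpow_le_rpow_mul {α : Type*} [MeasurableSpace α] (ν : Measure α) {s q : ℝ}
    (hs : 0 < s) (hsq : s ≤ q) {h : α → ℝ≥0∞} (hm : Measurable h) :
    (∫⁻ x, h x ^ s ∂ν) ^ (1 / s) ≤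
      (∫⁻ x, h x ^ q ∂ν) ^ (1 / q) * ν univ ^ (1 / s - 1 / q) := by
  have := eLpNorm'_le_eLpNorm'_mul_rpow_measure_univ hs hsq (μ := ν) (f := h)
    hm.aestronglyMeasurable
  simpa [eLpNorm'] using this

/-- `φ` is the product of the nonincreasing positive functions `φ / (1 - r) ^ a` and `(1 - r) ^ a`.
-/
theorem IsNormal.antitoneOn {φ : ℝ → ℝ} (hφ : IsNormal φ) : AntitoneOn φ (Ico 0 1) := by
  obtain ⟨-, hpos, a, b, ha, -, hanti, -⟩ := hφ
  intro r hr t ht hrt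
  have h := hanti hr ht hrt
  have hr1 : 0 < 1 - r := by linarith [hr.2]
  have ht1 : 0 < 1 - t := by linarith [ht.2]
  simp only at h
  rw [div_le_div_iff₀ (by positivity) (by positivity)] at h
  have h2 : (1 - t) ^ a ≤ (1 - r) ^ a := Real.rpow_le_rpow ht1.le (by linarith) ha.le
  have h3 : 0 < (1 - r) ^ a := by positivity
  have := hpos r hr
  have := hpos t ht
  by_contra! hlt
  nlinarith [mul_lt_mul_of_pos_right hlt h3, mul_le_mul_of_nonneg_left h2 (hpos r hr).le]

/-- A normal function is comparable at points whose distances to the boundary are comparable. -/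
theorem IsNormal.exists_doubling {φ : ℝ → ℝ} (hφ : IsNormal φ) :
    ∃ b : ℝ, 0 < b ∧ ∀ r₀ ∈ Ico (0 : ℝ) 1, ∀ r ∈ Ico (0 : ℝ) 1, (1 - r₀) / 2 ≤ 1 - r →
      φ r₀ ≤ 2 ^ b * φ r := by
  have hanti := hφ.antitoneOn
  obtain ⟨-, hpos, a, b, ha, hab, -, -, hmono, -⟩ := hφ
  have hb : 0 < b := ha.trans hab
  refine ⟨b, hb, fun r₀ h0 r hr h => ?_⟩
  rcases le_total r r₀ with hle | hle
  · have h1 : (1 : ℝ) ≤ 2 ^ b := Real.one_le_rpow one_le_two hb.le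
    exact (hanti hr h0 hle).trans (le_mul_of_one_le_left (hpos r hr).le h1)
  -- Closer to the boundary than `r₀`, monotonicity of `φ / (1 - r) ^ b` limits the decay of `φ`:
  -- halving the distance costs at most `2 ^ b`.
  · have hr1 : 0 < 1 - r := by linarith [hr.2]
    have h01 : 0 < 1 - r₀ := by linarith [h0.2]
    have hm := hmono h0 hr hle
    simp only at hm
    rw [div_le_div_iff₀ (by positivity) (by positivity)] at hm
    have h2 : (1 - r₀) ^ b ≤ 2 ^ b * (1 - r) ^ b := by
      rw [← Real.mul_rpow zero_le_two hr1.le]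
      exact Real.rpow_le_rpow h01.le (by linarith) hb.le
    have h3 : 0 < (1 - r) ^ b := by positivity
    have := mul_le_mul_of_nonneg_left h2 (hpos r hr).le
    refine le_of_mul_le_mul_right ?_ h3
    calc _ ≤ _ := hm
      _ ≤ _ := this
      _ = _ := by ring

theorem lintegral_circleMap_eq {q : ℝ} (hq : 0 < q) (f : ℂ → ℂ) (r : ℝ) :
    (∫⁻ θ in Ioc 0 (2 * Real.pi), ‖f (circleMap 0 r θ)‖ₑ ^ q) ^ (1 / q) =
      ENNReal.ofReal ((2 * Real.pi) ^ (1 / q)) * integralMean q f r := by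
  have hq' : 0 ≤ 1 / q := by positivity
  unfold integralMean
  rw [← ENNReal.ofReal_rpow_of_nonneg Real.two_pi_pos.le hq', ← ENNReal.mul_rpow_of_nonneg _ _ hq',
    ← mul_assoc, ← ENNReal.ofReal_mul Real.two_pi_pos.le, mul_one_div_cancel Real.two_pi_pos.ne',
    ENNReal.ofReal_one, one_mul]

/-- The integral of `‖f‖ ^ s` over an arc of length `2 d` is controlled by the `q`-mean. -/
theorem lintegral_arc_le {s q d : ℝ} (hs : 0 < s) (hsq : s ≤ q) (hd : 0 < d)
    (hd' : d ≤ Real.pi) (f : HolDisc) (r t : ℝ) :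
    ∫⁻ y in Ioo (-d) d, ‖(f : ℂ → ℂ) (circleMap 0 r (t + y))‖ₑ ^ s ≤
      (ENNReal.ofReal ((2 * Real.pi) ^ (1 / q) * (2 * d) ^ (1 / s - 1 / q)) *
        integralMean q f r) ^ s := by
  have hq : 0 < q := hs.trans_le hsq
  have hexp : 0 ≤ 1 / s - 1 / q := sub_nonneg.2 (one_div_le_one_div_of_le hs hsq)
  have hm : Measurable fun y : ℝ => ‖(f : ℂ → ℂ) (circleMap 0 r (t + y))‖ₑ := by
    have hc : Measurable fun y : ℝ => circleMap 0 r (t + y) := by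
      unfold circleMap
      exact Continuous.measurable (by fun_prop)
    exact ((HolDisc.measurable f).comp hc).enorm
  have hper : Function.Periodic (fun y => ‖(f : ℂ → ℂ) (circleMap 0 r y)‖ₑ ^ q)
      (2 * Real.pi) := fun θ => by
    simp only [periodic_circleMap 0 r θ]
  have h1 := lintegral_rpow_le_rpow_mul (volume.restrict (Ioo (-d) d)) hs hsq hm
  have h2 : ∫⁻ y in Ioo (-d) d, ‖(f : ℂ → ℂ) (circleMap 0 r (t + y))‖ₑ ^ q ≤
      ∫⁻ y in Ioc 0 (2 * Real.pi), ‖(f : ℂ → ℂ) (circleMap 0 r y)‖ₑ ^ q := by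
    have hsub : Ioo (-d) d ⊆ Ioc (-Real.pi) (-Real.pi + 2 * Real.pi) := fun y hy =>
      ⟨by linarith [hy.1], by linarith [hy.2]⟩
    refine (lintegral_mono_set hsub).trans (le_of_eq ?_)
    have hper' : Function.Periodic (fun y => ‖(f : ℂ → ℂ) (circleMap 0 r (t + y))‖ₑ ^ q)
        (2 * Real.pi) := fun θ => by
      simp only [← add_assoc, periodic_circleMap 0 r (t + θ)]
    rw [setLIntegral_Ioc_of_periodic Real.two_pi_pos hper' _ (-t)]
    have h3 := (measurePreserving_add_left volume t).setLIntegral_comp_preimage_emb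
      (MeasurableEquiv.addLeft t).measurableEmbedding
      (fun y => ‖(f : ℂ → ℂ) (circleMap 0 r y)‖ₑ ^ q) (Ioc 0 (2 * Real.pi))
    rw [← h3]
    congr 2
    ext y
    simp only [mem_Ioc, mem_preimage]
    constructor <;> rintro ⟨h, h'⟩ <;> constructor <;> linarith
  have hvol : (volume.restrict (Ioo (-d) d)) univ = ENNReal.ofReal (2 * d) := by
    rw [Measure.restrict_apply_univ, Real.volume_Ioo]
    congr 1
    ring
  rw [hvol] at h1
  have h4 : (∫⁻ y in Ioo (-d) d, ‖(f : ℂ → ℂ) (circleMap 0 r (t + y))‖ₑ ^ s) ^ (1 / s) ≤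
      ENNReal.ofReal ((2 * Real.pi) ^ (1 / q) * (2 * d) ^ (1 / s - 1 / q)) *
        integralMean q f r := by
    refine h1.trans ?_
    calc _ ≤ (∫⁻ y in Ioc 0 (2 * Real.pi), ‖(f : ℂ → ℂ) (circleMap 0 r y)‖ₑ ^ q) ^ (1 / q) *
          ENNReal.ofReal (2 * d) ^ (1 / s - 1 / q) := by gcongr
      _ = _ := by
        rw [lintegral_circleMap_eq hq, ENNReal.ofReal_rpow_of_nonneg (by positivity) hexp,
          ENNReal.ofReal_mul (by positivity)]
        ring
  calc _ = ((∫⁻ y in Ioo (-d) d, ‖(f : ℂ → ℂ) (circleMap 0 r (t + y))‖ₑ ^ s) ^ (1 / s)) ^ s := by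
        rw [← ENNReal.rpow_mul, one_div_mul_cancel hs.ne', ENNReal.rpow_one]
    _ ≤ _ := ENNReal.rpow_le_rpow h4 hs.le

theorem mixedNorm_rpow {p : ℝ} (hp : 0 < p) (q : ℝ) (φ : ℝ → ℝ) (f : ℂ → ℂ) :
    mixedNorm p q φ f ^ p =
      ∫⁻ r in Ioo (0 : ℝ) 1, integralMean q f r ^ p * ENNReal.ofReal (φ r ^ p / (1 - r)) := by
  rw [mixedNorm, ← ENNReal.rpow_mul, one_div_mul_cancel hp.ne', ENNReal.rpow_one]

theorem mul_exp_bounds {r₀ x : ℝ} (h0 : 1 / 2 ≤ r₀) (h1 : r₀ < 1)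
    (hx : x ∈ Ioo (-((1 - r₀) / 2)) ((1 - r₀) / 2)) :
    3 / 8 ≤ r₀ * Real.exp x ∧ (1 - r₀) / 2 ≤ 1 - r₀ * Real.exp x ∧
      1 - r₀ * Real.exp x ≤ 3 * ((1 - r₀) / 2) := by
  obtain ⟨hx1, hx2⟩ := hx
  have e1 := Real.add_one_le_exp x
  have e2 := Real.add_one_le_exp (-x)
  have e3 : Real.exp x * Real.exp (-x) = 1 := by rw [← Real.exp_add]; simp
  have e4 := Real.exp_pos x
  have e5 : Real.exp x * (1 - x) ≤ 1 := by nlinarith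
  refine ⟨by nlinarith, ?_, by nlinarith⟩
  have e6 : Real.exp x * (1 - (1 - r₀) / 2) ≤ 1 := by nlinarith
  nlinarith

/-- Substitute `r = r₀ eˣ` with `|x| < d = (1 - r₀) / 2`. The Jacobian `r` is at least `3 / 8` (this
uses `1 / 2 ≤ r₀`), `1 - r` lies in `[d, 3d]`, and doubling compares `φ r` with `φ r₀`; so the
weight `φ ^ p / (1 - r)` may be inserted at the cost of `8 / 3 · 3d · (2 ^ b / φ r₀) ^ p`. -/
theorem lintegral_integralMean_exp_le {p q : ℝ} (hp : 0 < p) {φ : ℝ → ℝ}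
    (hpos : ∀ r ∈ Ico (0 : ℝ) 1, 0 < φ r) {b : ℝ}
    (hb : ∀ r₀ ∈ Ico (0 : ℝ) 1, ∀ r ∈ Ico (0 : ℝ) 1, (1 - r₀) / 2 ≤ 1 - r →
      φ r₀ ≤ 2 ^ b * φ r) (f : ℂ → ℂ) {r₀ : ℝ} (h0 : 1 / 2 ≤ r₀) (h1 : r₀ < 1) :
    ∫⁻ x in Ioo (-((1 - r₀) / 2)) ((1 - r₀) / 2), integralMean q f (r₀ * Real.exp x) ^ p ≤
      ENNReal.ofReal (8 * ((1 - r₀) / 2) * (2 ^ b / φ r₀) ^ p) * mixedNorm p q φ f ^ p := by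
  set d := (1 - r₀) / 2 with hd
  have hd0 : 0 < d := by rw [hd]; linarith
  have hr0 : r₀ ∈ Ico (0 : ℝ) 1 := ⟨by linarith, h1⟩
  have hφ0 := hpos r₀ hr0
  have hbd : ∀ x ∈ Ioo (-d) d, _ := fun x hx => mul_exp_bounds h0 h1 hx
  set g : ℝ → ℝ≥0∞ := fun r => integralMean q f r ^ p with hg
  have himg : (fun x => r₀ * Real.exp x) '' Ioo (-d) d ⊆ Ioo 0 1 := by
    rintro _ ⟨x, hx, rfl⟩
    obtain ⟨h2, h3, h4⟩ := hbd x hx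
    exact ⟨by linarith, by linarith⟩
  have hder : ∀ x ∈ Ioo (-d) d, HasDerivWithinAt (fun x => r₀ * Real.exp x) (r₀ * Real.exp x)
      (Ioo (-d) d) x := fun x _ => ((Real.hasDerivAt_exp x).const_mul r₀).hasDerivWithinAt
  have hinj : InjOn (fun x => r₀ * Real.exp x) (Ioo (-d) d) := by
    intro x _ y _ hxy
    exact Real.exp_injective (mul_left_cancel₀ (by linarith : r₀ ≠ 0) hxy)
  have hcv := lintegral_image_eq_lintegral_abs_deriv_mul measurableSet_Ioo hder hinj g
  have hmeas : MeasurableSet ((fun x => r₀ * Real.exp x) '' Ioo (-d) d) :=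
    measurableSet_Ioo.image_of_continuousOn_injOn (by fun_prop) hinj
  calc ∫⁻ x in Ioo (-d) d, g (r₀ * Real.exp x)
      ≤ ∫⁻ x in Ioo (-d) d, ENNReal.ofReal (8 / 3) *
          (ENNReal.ofReal |r₀ * Real.exp x| * g (r₀ * Real.exp x)) := by
        refine setLIntegral_mono' measurableSet_Ioo fun x hx => ?_
        obtain ⟨h2, h3, h4⟩ := hbd x hx
        rw [← mul_assoc, ← ENNReal.ofReal_mul (by norm_num), abs_of_pos (by linarith)]
        refine le_mul_of_one_le_left' ?_
        rw [← ENNReal.ofReal_one]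
        exact ENNReal.ofReal_le_ofReal (by linarith)
    _ = ENNReal.ofReal (8 / 3) * ∫⁻ r in (fun x => r₀ * Real.exp x) '' Ioo (-d) d, g r := by
        rw [lintegral_const_mul' _ _ ENNReal.ofReal_ne_top, hcv]
    _ ≤ ENNReal.ofReal (8 / 3) * ∫⁻ r in (fun x => r₀ * Real.exp x) '' Ioo (-d) d,
          ENNReal.ofReal (3 * d * (2 ^ b / φ r₀) ^ p) *
            (g r * ENNReal.ofReal (φ r ^ p / (1 - r))) := by
        refine mul_le_mul_right (setLIntegral_mono' hmeas ?_) _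
        rintro _ ⟨x, hx, rfl⟩
        obtain ⟨h2, h3, h4⟩ := hbd x hx
        simp only
        set r := r₀ * Real.exp x
        have hr : r ∈ Ico (0 : ℝ) 1 := ⟨by linarith, by linarith⟩
        have hφr := hpos r hr
        have h5 := hb r₀ hr0 r hr h3
        rw [mul_left_comm, ← ENNReal.ofReal_mul (by positivity)]
        refine le_mul_of_one_le_right' ?_
        rw [← ENNReal.ofReal_one]
        refine ENNReal.ofReal_le_ofReal ?_
        have h6 : 1 ≤ (2 ^ b / φ r₀) ^ p * φ r ^ p := by
          rw [← Real.mul_rpow (by positivity) hφr.le]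
          refine Real.one_le_rpow ?_ hp.le
          rw [div_mul_eq_mul_div, le_div_iff₀ hφ0]
          linarith
        have h7 : 0 < 1 - r := by linarith
        have h8 : 1 ≤ 3 * d / (1 - r) := by rwa [le_div_iff₀ h7, one_mul]
        calc (1 : ℝ) = 1 * 1 := by ring
          _ ≤ 3 * d / (1 - r) * ((2 ^ b / φ r₀) ^ p * φ r ^ p) := by gcongr
          _ = _ := by ring
    _ = ENNReal.ofReal (8 * d * (2 ^ b / φ r₀) ^ p) *
          ∫⁻ r in (fun x => r₀ * Real.exp x) '' Ioo (-d) d,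
            g r * ENNReal.ofReal (φ r ^ p / (1 - r)) := by
        rw [lintegral_const_mul' _ _ ENNReal.ofReal_ne_top, ← mul_assoc,
          ← ENNReal.ofReal_mul (by norm_num)]
        congr 2
        ring
    _ ≤ _ := by
        rw [mixedNorm_rpow hp]
        gcongr

/-- The growth estimate away from the origin. -/
theorem exists_norm_le_of_half_le {p q : ℝ} (hp : 0 < p) (hq : 0 < q) {φ : ℝ → ℝ}
    (hφ : IsNormal φ) :
    ∃ C : ℝ, 0 < C ∧ ∀ (f : HolDisc) (M : ℝ), 0 ≤ M → mixedNorm p q φ f ≤ ENNReal.ofReal M →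
      ∀ w : ℂ, 1 / 2 ≤ ‖w‖ → ‖w‖ < 1 →
        ‖(f : ℂ → ℂ) w‖ ≤ C * (M / (φ ‖w‖ * (1 - ‖w‖) ^ (1 / q))) := by
  obtain ⟨b, hb0, hb⟩ := hφ.exists_doubling
  have hpos := hφ.2.1
  -- An exponent below both `p` and `q` allows the power mean inequality in the angle and in the
  -- radius, with no case distinction on whether `p` or `q` is at least `1`.
  set s := min p q with hs
  have hs0 : 0 < s := lt_min hp hq
  have hsp : s ≤ p := min_le_left _ _
  have hsq : s ≤ q := min_le_right _ _
  have hep : 0 ≤ 1 / s - 1 / p := sub_nonneg.2 (one_div_le_one_div_of_le hs0 hsp)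
  have heq : 0 ≤ 1 / s - 1 / q := sub_nonneg.2 (one_div_le_one_div_of_le hs0 hsq)
  set C₁ : ℝ := (2 * Real.pi) ^ (1 / q) * 2 ^ (1 / s - 1 / q) with hC₁
  set C₂ : ℝ := 8 ^ (1 / p) * 2 ^ b * 2 ^ (1 / s - 1 / p) with hC₂
  set C : ℝ := C₁ * C₂ / Real.pi ^ (1 / s) * 2 ^ (1 / q) with hC
  refine ⟨C, by positivity, fun f M hM hf w hw hw1 => ?_⟩
  set r₀ := ‖w‖ with hr₀
  set d := (1 - r₀) / 2 with hd
  have hd0 : 0 < d := by rw [hd]; linarith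
  have hd1 : d ≤ 1 := by rw [hd]; linarith
  have hφ0 : 0 < φ r₀ := hpos r₀ ⟨by linarith, hw1⟩
  -- The chart `ζ ↦ w exp ζ` is holomorphic, so `F` keeps the sub-mean value property, while
  -- vertical segments become arcs about the origin and horizontal ones radial segments.
  set F : ℂ → ℂ := fun ζ => (f : ℂ → ℂ) (w * Complex.exp ζ) with hF
  have hFm : Measurable F := (HolDisc.measurable f).comp (by fun_prop)
  have hnorm : ∀ ζ : ℂ, ‖w * Complex.exp ζ‖ = r₀ * Real.exp ζ.re := fun ζ => by
    rw [norm_mul, Complex.norm_exp]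
  have hFd : DifferentiableOn ℂ F (Metric.ball 0 d) := by
    refine f.2.1.comp (by fun_prop) fun ζ hζ => ?_
    have h1 := (Complex.abs_re_le_norm ζ).trans_lt (mem_ball_zero_iff.1 hζ)
    have h2 := (mul_exp_bounds hw hw1 (abs_lt.1 h1)).2.1
    rw [disc, mem_ball_zero_iff, hnorm]
    linarith
  have hsub := enorm_rpow_le_lintegral_square hd0 hs0 hFm hFd
  have hF0 : F 0 = (f : ℂ → ℂ) w := by simp [hF]
  have hFc : ∀ x y : ℝ, F (x + y * Complex.I) =
      (f : ℂ → ℂ) (circleMap 0 (r₀ * Real.exp x) (Complex.arg w + y)) := fun x y => by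
    refine congrArg (f : ℂ → ℂ) ?_
    rw [Complex.exp_add, circleMap_zero]
    push_cast
    rw [add_mul, Complex.exp_add, hr₀]
    nth_rw 1 [← Complex.norm_mul_exp_arg_mul_I w]
    ring
  simp only [hF0, hFc] at hsub
  have harc : ∀ x : ℝ, ∫⁻ y in Ioo (-d) d,
      ‖(f : ℂ → ℂ) (circleMap 0 (r₀ * Real.exp x) (Complex.arg w + y))‖ₑ ^ s ≤
      (ENNReal.ofReal (C₁ * d ^ (1 / s - 1 / q)) *
        integralMean q f (r₀ * Real.exp x)) ^ s := fun x => by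
    have := lintegral_arc_le hs0 hsq hd0 (by linarith [Real.pi_gt_three]) f (r₀ * Real.exp x)
      (Complex.arg w)
    rwa [Real.mul_rpow zero_le_two hd0.le, ← mul_assoc] at this
  have hmm : Measurable fun x : ℝ => integralMean q f (r₀ * Real.exp x) :=
    (measurable_integralMean q f).comp (by fun_prop)
  have hvol : (volume.restrict (Ioo (-d) d)) univ = ENNReal.ofReal (2 * d) := by
    rw [Measure.restrict_apply_univ, Real.volume_Ioo]
    congr 1
    ring
  have hrad := lintegral_rpow_le_rpow_mul (volume.restrict (Ioo (-d) d)) hs0 hsp hmm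
  rw [hvol] at hrad
  have hrad2 : (∫⁻ x in Ioo (-d) d, integralMean q f (r₀ * Real.exp x) ^ s) ^ (1 / s) ≤
      ENNReal.ofReal (C₂ * d ^ (1 / s) * (M / φ r₀)) := by
    refine hrad.trans ?_
    have h3 := lintegral_integralMean_exp_le (q := q) hp hpos hb f hw hw1
    rw [← hd] at h3
    have h4 : (∫⁻ x in Ioo (-d) d, integralMean q f (r₀ * Real.exp x) ^ p) ^ (1 / p) ≤
        ENNReal.ofReal ((8 * d) ^ (1 / p) * (2 ^ b / φ r₀) * M) := by
      have hp' : 0 ≤ 1 / p := by positivity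
      calc _ ≤ (ENNReal.ofReal (8 * d * (2 ^ b / φ r₀) ^ p) * ENNReal.ofReal M ^ p) ^ (1 / p) := by
            gcongr
            exact h3.trans (by gcongr)
        _ = _ := by
            rw [ENNReal.mul_rpow_of_nonneg _ _ hp', ← ENNReal.rpow_mul, mul_one_div_cancel hp.ne',
              ENNReal.rpow_one, ENNReal.ofReal_rpow_of_nonneg (by positivity) hp',
              Real.mul_rpow (by positivity) (by positivity), ← Real.rpow_mul (by positivity),
              mul_one_div_cancel hp.ne', Real.rpow_one, ← ENNReal.ofReal_mul (by positivity)]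
    refine (mul_le_mul_left h4 _).trans (le_of_eq ?_)
    rw [ENNReal.ofReal_rpow_of_nonneg (by positivity) hep, ← ENNReal.ofReal_mul (by positivity)]
    congr 1
    rw [Real.mul_rpow (by norm_num) hd0.le, Real.mul_rpow (by norm_num) hd0.le, hC₂,
      show d ^ (1 / s) = d ^ (1 / p) * d ^ (1 / s - 1 / p) by
        rw [← Real.rpow_add hd0]; congr 1; ring]
    ring
  have hfin : ENNReal.ofReal (Real.pi * d ^ 2) * ‖(f : ℂ → ℂ) w‖ₑ ^ s ≤
      ENNReal.ofReal ((C₁ * d ^ (1 / s - 1 / q)) * (C₂ * d ^ (1 / s) * (M / φ r₀))) ^ s := by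
    refine hsub.trans ((lintegral_mono harc).trans ?_)
    simp only [ENNReal.mul_rpow_of_nonneg _ _ hs0.le]
    rw [lintegral_const_mul' _ _ (by finiteness),
      ENNReal.ofReal_mul (p := C₁ * d ^ (1 / s - 1 / q)) (by positivity),
      ENNReal.mul_rpow_of_nonneg _ _ hs0.le]
    refine mul_le_mul_right ?_ _
    calc _ = ((∫⁻ x in Ioo (-d) d, integralMean q f (r₀ * Real.exp x) ^ s) ^ (1 / s)) ^ s := by
          rw [← ENNReal.rpow_mul, one_div_mul_cancel hs0.ne', ENNReal.rpow_one]
      _ ≤ _ := by gcongr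
  rw [← ofReal_norm, ENNReal.ofReal_rpow_of_nonneg (norm_nonneg _) hs0.le,
    ENNReal.ofReal_rpow_of_nonneg (by positivity) hs0.le, ← ENNReal.ofReal_mul (by positivity),
    ENNReal.ofReal_le_ofReal_iff (by positivity)] at hfin
  have h5 := Real.rpow_le_rpow (by positivity) hfin (one_div_nonneg.2 hs0.le)
  rw [← Real.rpow_mul (by positivity), mul_one_div_cancel hs0.ne', Real.rpow_one,
    Real.mul_rpow (by positivity) (by positivity), ← Real.rpow_mul (norm_nonneg _),
    mul_one_div_cancel hs0.ne', Real.rpow_one, Real.mul_rpow (by positivity) (by positivity),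
    ← Real.rpow_natCast d 2, ← Real.rpow_mul hd0.le] at h5
  -- Balance of powers of `d`: arcs give `1/s - 1/q`, radii give `1/s`, the area takes away `2/s`.
  -- What remains is `d ^ (-1/q)`, the exponent in the claim.
  have h6 : d ^ (1 / s - 1 / q) * d ^ (1 / s) = d ^ (((2 : ℕ) : ℝ) * (1 / s)) / d ^ (1 / q) := by
    rw [← Real.rpow_add hd0, ← Real.rpow_sub hd0]
    congr 1
    push_cast
    ring
  have h7 : (1 - r₀) ^ (1 / q) = 2 ^ (1 / q) * d ^ (1 / q) := by
    rw [← Real.mul_rpow zero_le_two hd0.le]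
    congr 1
    rw [hd]; ring
  rw [h7]
  have hX : 0 < Real.pi ^ (1 / s) * d ^ (((2 : ℕ) : ℝ) * (1 / s)) := by positivity
  refine le_of_mul_le_mul_left (h5.trans (le_of_eq ?_)) hX
  calc _ = C₁ * C₂ * (M / φ r₀) * (d ^ (1 / s - 1 / q) * d ^ (1 / s)) := by ring
    _ = _ := by
      rw [h6, hC]
      field_simp

/-- The growth estimate for functions in the mixed norm space. -/
theorem exists_norm_le {p q : ℝ} (hp : 0 < p) (hq : 0 < q) {φ : ℝ → ℝ}
    (hφ : IsNormal φ) :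
    ∃ C : ℝ, 0 < C ∧ ∀ (f : HolDisc) (M : ℝ), 0 ≤ M → mixedNorm p q φ f ≤ ENNReal.ofReal M →
      ∀ w ∈ disc, ‖(f : ℂ → ℂ) w‖ ≤ C * (M / (φ ‖w‖ * (1 - ‖w‖) ^ (1 / q))) := by
  obtain ⟨C, hC, h⟩ := exists_norm_le_of_half_le hp hq hφ
  have hanti := hφ.antitoneOn
  have hpos := hφ.2.1
  have hhalf : (1 / 2 : ℝ) ∈ Ico (0 : ℝ) 1 := by constructor <;> norm_num
  have h0 : (0 : ℝ) ∈ Ico (0 : ℝ) 1 := by constructor <;> norm_num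
  have hφh := hpos _ hhalf
  set K : ℝ := φ 0 / (φ (1 / 2) * (1 / 2) ^ (1 / q)) with hK
  have hφ0 := hpos _ h0
  have hK1 : 1 ≤ K := by
    rw [hK, one_le_div (by positivity)]
    have h1 : ((1 : ℝ) / 2) ^ (1 / q) ≤ 1 :=
      Real.rpow_le_one (by norm_num) (by norm_num) (by positivity)
    have h2 := hanti h0 hhalf (by norm_num)
    nlinarith
  refine ⟨C * K, by positivity, fun f M hM hf w hw => ?_⟩
  have hw1 : ‖w‖ < 1 := mem_ball_zero_iff.1 hw
  have hφw := hpos ‖w‖ ⟨norm_nonneg _, hw1⟩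
  have hw2 : 0 < 1 - ‖w‖ := by linarith
  rcases le_total (1 / 2) ‖w‖ with hle | hle
  · refine (h f M hM hf w hle hw1).trans ?_
    rw [mul_assoc]
    gcongr
    exact le_mul_of_one_le_left (by positivity) hK1
  -- Near the origin the maximum principle transfers the bound from the circle of radius `1 / 2`;
  -- `K` compares the denominator there with the one at `w`, which is at most `φ 0`.
  · have hd : DiffContOnCl ℂ (f : ℂ → ℂ) (Metric.ball 0 (1 / 2)) := by
      refine (f.2.1.mono ?_).diffContOnCl
      rw [closure_ball _ (by norm_num)]
      exact Metric.closedBall_subset_ball (by norm_num)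
    have hbd : ‖(f : ℂ → ℂ) w‖ ≤ C * (M / (φ (1 / 2) * (1 - 1 / 2) ^ (1 / q))) := by
      refine Complex.norm_le_of_forall_mem_frontier_norm_le Metric.isBounded_ball hd ?_ ?_
      · intro z hz
        rw [frontier_ball _ (by norm_num), mem_sphere_zero_iff_norm] at hz
        have := h f M hM hf z hz.ge (by rw [hz]; norm_num)
        rwa [hz] at this
      · rw [closure_ball _ (by norm_num), mem_closedBall_zero_iff]
        exact hle
    refine hbd.trans ?_
    rw [mul_assoc]
    gcongr
    rw [hK, show (1 - 1 / 2 : ℝ) = 1 / 2 by norm_num, div_mul_div_comm,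
      div_le_div_iff₀ (by positivity) (by positivity)]
    have h1 : (1 - ‖w‖) ^ (1 / q) ≤ 1 :=
      Real.rpow_le_one hw2.le (by linarith [norm_nonneg w]) (by positivity)
    have h2 := hanti h0 ⟨norm_nonneg _, hw1⟩ (norm_nonneg w)
    have h3 : φ ‖w‖ * (1 - ‖w‖) ^ (1 / q) ≤ φ 0 := by nlinarith
    have h4 : 0 ≤ M * (φ (1 / 2) * (1 / 2) ^ (1 / q)) := by positivity
    nlinarith

/-- The growth estimate for derivatives of functions in the mixed norm space. -/
theorem exists_norm_iteratedDeriv_le {p q : ℝ} (hp : 0 < p) (hq : 0 < q) {φ : ℝ → ℝ}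
    (hφ : IsNormal φ) (m : ℕ) :
    ∃ C : ℝ, 0 < C ∧ ∀ (f : HolDisc) (M : ℝ), 0 ≤ M → mixedNorm p q φ f ≤ ENNReal.ofReal M →
      ∀ w ∈ disc, ‖iteratedDeriv m (f : ℂ → ℂ) w‖ ≤
        C * (M / (φ ‖w‖ * (1 - ‖w‖) ^ (1 / q + m))) := by
  obtain ⟨C, hC, h⟩ := exists_norm_le hp hq hφ
  obtain ⟨b, hb0, hb⟩ := hφ.exists_doubling
  have hpos := hφ.2.1
  refine ⟨m.factorial * 2 ^ m * C * 2 ^ b * 2 ^ (1 / q), by positivity, fun f M hM hf w hw => ?_⟩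
  have hw1 : ‖w‖ < 1 := mem_ball_zero_iff.1 hw
  have hw2 : 0 < 1 - ‖w‖ := by linarith
  have hφw := hpos ‖w‖ ⟨norm_nonneg _, hw1⟩
  -- Cauchy's estimate on a disc of half the distance to the boundary: on it `1 - ‖z‖ ≥ R`, so
  -- doubling makes the growth bound comparable to its value at `w`, and `R ^ (-m)` supplies the
  -- extra power.
  set R := (1 - ‖w‖) / 2 with hR
  have hR0 : 0 < R := by positivity
  have hz : ∀ z ∈ Metric.closedBall w R, ‖z‖ < 1 ∧ R ≤ 1 - ‖z‖ := fun z hz => by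
    have h1 : ‖z‖ ≤ ‖z - w‖ + ‖w‖ := by simpa using norm_add_le (z - w) w
    have h2 : ‖z - w‖ ≤ R := by simpa [dist_eq_norm] using hz
    constructor <;> linarith
  have hd : DiffContOnCl ℂ (f : ℂ → ℂ) (Metric.ball w R) := by
    refine (f.2.1.mono ?_).diffContOnCl
    rw [closure_ball _ hR0.ne']
    exact fun z hz' => mem_ball_zero_iff.2 (hz z hz').1
  have hbd := Complex.norm_iteratedDeriv_le_of_forall_mem_sphere_norm_le (n := m)
    (C := C * 2 ^ b * 2 ^ (1 / q) * (M / (φ ‖w‖ * (1 - ‖w‖) ^ (1 / q)))) hR0 hd fun z hzs => by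
      obtain ⟨hz1, hz2⟩ := hz z (Metric.sphere_subset_closedBall hzs)
      have hz3 : 0 < 1 - ‖z‖ := by linarith
      have hφz := hpos ‖z‖ ⟨norm_nonneg _, hz1⟩
      refine (h f M hM hf z (mem_ball_zero_iff.2 hz1)).trans ?_
      have h1 := hb ‖w‖ ⟨norm_nonneg _, hw1⟩ ‖z‖ ⟨norm_nonneg _, hz1⟩ hz2
      have h2 : (1 - ‖w‖) ^ (1 / q) ≤ 2 ^ (1 / q) * (1 - ‖z‖) ^ (1 / q) := by
        rw [← Real.mul_rpow zero_le_two hz3.le]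
        exact Real.rpow_le_rpow hw2.le (by linarith) (by positivity)
      rw [mul_assoc, mul_assoc]
      gcongr
      rw [← mul_assoc, ← mul_div_assoc, div_le_div_iff₀ (by positivity) (by positivity)]
      have h3 : φ ‖w‖ * (1 - ‖w‖) ^ (1 / q) ≤
          2 ^ b * φ ‖z‖ * (2 ^ (1 / q) * (1 - ‖z‖) ^ (1 / q)) := by gcongr
      calc _ ≤ M * _ := mul_le_mul_of_nonneg_left h3 hM
        _ = _ := by ring
  refine hbd.trans (le_of_eq ?_)
  rw [Real.rpow_add hw2, Real.rpow_natCast, hR, div_pow]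
  field_simp

/-! ### The mixed quasi-norm: radial integrals, quasi-triangle inequality, bounded functions. -/

theorem lintegral_rpow_sub_one {c t : ℝ} (hc : 0 < c) (ht : 0 < t) :
    ∫⁻ x in Ioo 0 c, ENNReal.ofReal (x ^ (t - 1)) = ENNReal.ofReal (c ^ t / t) := by
  have hint : IntervalIntegrable (fun x : ℝ => x ^ (t - 1)) volume 0 c :=
    intervalIntegral.intervalIntegrable_rpow' (by linarith)
  rw [intervalIntegrable_iff_integrableOn_Ioo_of_le hc.le] at hint
  rw [← ofReal_integral_eq_lintegral_ofReal hint
    ((ae_restrict_iff' measurableSet_Ioo).2 (ae_of_all _ fun r hr => Real.rpow_nonneg hr.1.le _)),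
    ← integral_Ioc_eq_integral_Ioo, ← intervalIntegral.integral_of_le hc.le,
    integral_rpow (Or.inl (by linarith)), sub_add_cancel, Real.zero_rpow ht.ne', sub_zero]

theorem lintegral_rpow_neg_sub_one_le {c d t : ℝ} (hc : 0 < c) (ht : 0 < t) :
    ∫⁻ x in Ioo c d, ENNReal.ofReal (x ^ (-t - 1)) ≤ ENNReal.ofReal (c ^ (-t) / t) := by
  rcases le_total d c with hcd | hcd
  · simp [Ioo_eq_empty_of_le hcd]
  have h0 : (0 : ℝ) ∉ uIcc c d := by
    rw [uIcc_of_le hcd]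
    exact fun h => absurd h.1 (not_le.2 hc)
  have hint : IntervalIntegrable (fun x : ℝ => x ^ (-t - 1)) volume c d :=
    intervalIntegral.intervalIntegrable_rpow (Or.inr h0)
  rw [intervalIntegrable_iff_integrableOn_Ioo_of_le hcd] at hint
  rw [← ofReal_integral_eq_lintegral_ofReal hint
    ((ae_restrict_iff' measurableSet_Ioo).2
      (ae_of_all _ fun r hr => Real.rpow_nonneg (hc.le.trans hr.1.le) _)),
    ← integral_Ioc_eq_integral_Ioo, ← intervalIntegral.integral_of_le hcd,
    integral_rpow (Or.inr ⟨by linarith, h0⟩), sub_add_cancel]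
  refine ENNReal.ofReal_le_ofReal ?_
  rw [div_neg, ← neg_div, neg_sub]
  gcongr
  linarith [Real.rpow_nonneg (hc.le.trans hcd) (-t)]

theorem setLIntegral_one_sub (h : ℝ → ℝ≥0∞) (a b : ℝ) :
    ∫⁻ r in Ioo a b, h (1 - r) = ∫⁻ x in Ioo (1 - b) (1 - a), h x := by
  have hmp : MeasurePreserving (fun x : ℝ => 1 - x) := volume.measurePreserving_sub_left 1
  rw [← hmp.setLIntegral_comp_preimage_emb
    (Homeomorph.subLeft (1 : ℝ)).measurableEmbedding h]
  congr 2
  ext r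
  simp only [mem_preimage, mem_Ioo]
  constructor <;> rintro ⟨h, h'⟩ <;> constructor <;> linarith

/-- Growth bounds for a normal function, with both exponents. -/
theorem IsNormal.exists_exponents {φ : ℝ → ℝ} (hφ : IsNormal φ) :
    ∃ a b : ℝ, 0 < a ∧ 0 < b ∧
      (∀ ρ ∈ Ico (0 : ℝ) 1, ∀ r ∈ Ico (0 : ℝ) 1, ρ ≤ r →
        φ r ≤ φ ρ * ((1 - r) ^ a / (1 - ρ) ^ a)) ∧
      (∀ ρ ∈ Ico (0 : ℝ) 1, ∀ r ∈ Ico (0 : ℝ) 1, r ≤ ρ →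
        φ r ≤ φ ρ * ((1 - r) ^ b / (1 - ρ) ^ b)) := by
  obtain ⟨-, hpos, a, b, ha, hab, hanti, -, hmono, -⟩ := hφ
  refine ⟨a, b, ha, ha.trans hab, fun ρ hρ r hr h => ?_, fun ρ hρ r hr h => ?_⟩
  · have hr1 : 0 < 1 - r := by linarith [hr.2]
    have h1 := hanti hρ hr h
    simp only at h1
    rw [div_le_iff₀ (by positivity)] at h1
    refine h1.trans (le_of_eq (by ring))
  · have hr1 : 0 < 1 - r := by linarith [hr.2]
    have h1 := hmono hr hρ h
    simp only at h1
    rw [div_le_iff₀ (by positivity)] at h1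
    refine h1.trans (le_of_eq (by ring))

theorem circleMap_mem_disc {r : ℝ} (hr : r ∈ Ioo (0 : ℝ) 1) (θ : ℝ) : circleMap 0 r θ ∈ disc := by
  simp [disc, abs_of_pos hr.1, hr.2]

theorem mixedNorm_mono {p q : ℝ} (hp : 0 < p) (hq : 0 < q) (φ : ℝ → ℝ) {f g : ℂ → ℂ}
    (h : ∀ z ∈ disc, ‖f z‖ ≤ ‖g z‖) : mixedNorm p q φ f ≤ mixedNorm p q φ g := by
  unfold mixedNorm
  have hp' : 0 ≤ 1 / p := by positivity
  have hq' : 0 ≤ 1 / q := by positivity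
  refine ENNReal.rpow_le_rpow (setLIntegral_mono' measurableSet_Ioo fun r hr => ?_) hp'
  unfold integralMean
  gcongr with θ
  exact enorm_le_iff_norm_le.2 (h _ (circleMap_mem_disc hr θ))

theorem mixedNorm_smul {p q : ℝ} (hp : 0 < p) (hq : 0 < q) (φ : ℝ → ℝ) (c : ℂ) (f : ℂ → ℂ) :
    mixedNorm p q φ (c • f) = ‖c‖ₑ * mixedNorm p q φ f := by
  have hp' : 0 ≤ 1 / p := by positivity
  unfold mixedNorm
  simp only [integralMean_smul hq, ENNReal.mul_rpow_of_nonneg _ _ hp.le, mul_assoc]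
  rw [lintegral_const_mul' _ _ (by finiteness), ENNReal.mul_rpow_of_nonneg _ _ hp',
    ← ENNReal.rpow_mul, mul_one_div_cancel hp.ne', ENNReal.rpow_one]

/-- The quasi-triangle inequality for the mixed norm. -/
theorem exists_mixedNorm_add_le {p q : ℝ} (hp : 0 < p) (hq : 0 < q) {φ : ℝ → ℝ}
    (hφ : IsNormal φ) :
    ∃ K : ℝ, 0 < K ∧ ∀ f g : HolDisc, mixedNorm p q φ ((f : ℂ → ℂ) + (g : ℂ → ℂ)) ≤
      ENNReal.ofReal K * (mixedNorm p q φ f + mixedNorm p q φ g) := by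
  have hp' : 0 < 1 / p := by positivity
  have hq' : 0 < 1 / q := by positivity
  set κ : ℝ≥0∞ := 2 * 2 ^ (1 / q) * (2 * 2 ^ (1 / p)) with hκ
  have hκt : κ ≠ ∞ := by finiteness
  refine ⟨κ.toReal + 1, by positivity, fun f g => ?_⟩
  have hκle : κ ≤ ENNReal.ofReal (κ.toReal + 1) := by
    rw [← ENNReal.ofReal_toReal hκt]
    exact ENNReal.ofReal_le_ofReal (by rw [ENNReal.ofReal_toReal hκt]; linarith)
  refine le_trans ?_ (mul_le_mul_left hκle _)
  set w : ℝ → ℝ≥0∞ := fun r => ENNReal.ofReal (φ r ^ p / (1 - r)) with hw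
  have hwm : AEMeasurable w (volume.restrict (Ioo (0 : ℝ) 1)) := by
    have hc : ContinuousOn (fun r => φ r ^ p / (1 - r)) (Ioo (0 : ℝ) 1) := by
      apply ContinuousOn.div
      · exact (hφ.1.mono Ioo_subset_Ico_self).rpow_const (fun _ _ => Or.inr hp.le)
      · fun_prop
      · intro r hr
        have := hr.2
        linarith
    exact (hc.aemeasurable measurableSet_Ioo).ennreal_ofReal
  have hm : AEMeasurable (fun r => integralMean q (f : ℂ → ℂ) r ^ p * w r)
      (volume.restrict (Ioo (0 : ℝ) 1)) :=
    ((measurable_integralMean q f).pow_const p).aemeasurable.mul hwm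
  have hle : ∀ r, integralMean q ((f : ℂ → ℂ) + (g : ℂ → ℂ)) r ^ p * w r ≤
      ((2 * 2 ^ (1 / q)) ^ p * 2 ^ p) *
        (integralMean q (f : ℂ → ℂ) r ^ p * w r + integralMean q (g : ℂ → ℂ) r ^ p * w r) := by
    intro r
    calc _ ≤ ((2 * 2 ^ (1 / q)) * (integralMean q f r + integralMean q g r)) ^ p * w r := by
          gcongr
          rw [mul_assoc]
          exact integralMean_add_le hq f g r
      _ ≤ ((2 * 2 ^ (1 / q)) ^ p *
            (2 ^ p * (integralMean q f r ^ p + integralMean q g r ^ p))) * w r := by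
          rw [ENNReal.mul_rpow_of_nonneg _ _ hp.le]
          gcongr
          exact ennreal_add_rpow_le hp _ _
      _ = _ := by ring
  have hK : ((2 * 2 ^ (1 / q)) ^ p * 2 ^ p : ℝ≥0∞) ≠ ∞ := by finiteness
  unfold mixedNorm
  have h1 : ∀ x : ℝ≥0∞, (x ^ p) ^ (1 / p) = x := fun x => by
    rw [← ENNReal.rpow_mul, mul_one_div_cancel hp.ne', ENNReal.rpow_one]
  calc _ ≤ (((2 * 2 ^ (1 / q)) ^ p * 2 ^ p) *
        ((∫⁻ r in Ioo (0 : ℝ) 1, integralMean q f r ^ p * w r) +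
          ∫⁻ r in Ioo (0 : ℝ) 1, integralMean q g r ^ p * w r)) ^ (1 / p) := by
        refine ENNReal.rpow_le_rpow ((lintegral_mono hle).trans ?_) hp'.le
        rw [lintegral_const_mul' _ _ hK, lintegral_add_left' hm]
    _ ≤ 2 * 2 ^ (1 / q) * 2 * (2 ^ (1 / p) *
        ((∫⁻ r in Ioo (0 : ℝ) 1, integralMean q f r ^ p * w r) ^ (1 / p) +
          (∫⁻ r in Ioo (0 : ℝ) 1, integralMean q g r ^ p * w r) ^ (1 / p))) := by
        rw [ENNReal.mul_rpow_of_nonneg _ _ hp'.le, ENNReal.mul_rpow_of_nonneg _ _ hp'.le, h1, h1]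
        gcongr
        exact ennreal_add_rpow_le hp' _ _
    _ = _ := by rw [hκ]; ring

/-- Since `φ r ≤ φ 0 (1 - r) ^ a`, the integrand is at most a multiple of `(1 - r) ^ (a p - 1)`,
integrable because `a p > 0`. -/
theorem mixedNorm_one_lt_top {p q : ℝ} (hp : 0 < p) {φ : ℝ → ℝ}
    (hφ : IsNormal φ) : mixedNorm p q φ (fun _ => 1) < ∞ := by
  obtain ⟨a, b, ha, hb, h1, h2⟩ := hφ.exists_exponents
  have hpos := hφ.2.1
  have hp' : 0 < 1 / p := by positivity
  have h0 : (0 : ℝ) ∈ Ico (0 : ℝ) 1 := by constructor <;> norm_num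
  have hφ0 := hpos 0 h0
  rw [mixedNorm, ENNReal.rpow_lt_top_iff_of_pos hp']
  have hM : ∀ r, integralMean q (fun _ => 1) r = 1 := fun r => by
    simp only [integralMean]
    rw [enorm_one, ENNReal.one_rpow, setLIntegral_one, Real.volume_Ioc, sub_zero,
      ← ENNReal.ofReal_mul (by positivity), one_div_mul_cancel Real.two_pi_pos.ne',
      ENNReal.ofReal_one, ENNReal.one_rpow]
  simp only [hM, ENNReal.one_rpow, one_mul]
  calc _ ≤ ∫⁻ r in Ioo (0 : ℝ) 1, ENNReal.ofReal (φ 0 ^ p) *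
        ENNReal.ofReal ((1 - r) ^ (a * p - 1)) := by
        refine setLIntegral_mono' measurableSet_Ioo fun r hr => ?_
        have hr' : r ∈ Ico (0 : ℝ) 1 := ⟨hr.1.le, hr.2⟩
        have hr1 : 0 < 1 - r := by linarith [hr.2]
        rw [← ENNReal.ofReal_mul (by positivity)]
        refine ENNReal.ofReal_le_ofReal ?_
        have h3 := h1 0 h0 r hr' hr.1.le
        rw [sub_zero, Real.one_rpow, div_one] at h3
        calc _ ≤ (φ 0 * (1 - r) ^ a) ^ p / (1 - r) := by
              have := hpos r hr'
              gcongr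
          _ = _ := by
              rw [Real.mul_rpow hφ0.le (by positivity), ← Real.rpow_mul hr1.le,
                Real.rpow_sub_one hr1.ne', mul_div_assoc]
    _ < ∞ := by
        rw [lintegral_const_mul' _ _ ENNReal.ofReal_ne_top,
          setLIntegral_one_sub (fun x => ENNReal.ofReal (x ^ (a * p - 1))), sub_self, sub_zero,
          lintegral_rpow_sub_one one_pos (by positivity)]
        finiteness

/-- Bounded analytic functions belong to the mixed norm space, with a norm bound. -/
theorem exists_mixedNorm_le_of_bounded {p q : ℝ} (hp : 0 < p) (hq : 0 < q) {φ : ℝ → ℝ}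
    (hφ : IsNormal φ) :
    ∃ K : ℝ, 0 < K ∧ ∀ (f : ℂ → ℂ) (B : ℝ), 0 ≤ B → (∀ z ∈ disc, ‖f z‖ ≤ B) →
      mixedNorm p q φ f ≤ ENNReal.ofReal (K * B) := by
  have ht := (mixedNorm_one_lt_top (q := q) hp hφ).ne
  set κ := mixedNorm p q φ (fun _ => 1) with hκ
  refine ⟨κ.toReal + 1, by positivity, fun f B hB h => ?_⟩
  have h1 : mixedNorm p q φ f ≤ mixedNorm p q φ ((B : ℂ) • fun _ => 1) :=
    mixedNorm_mono hp hq φ fun z hz => by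
      simpa [abs_of_nonneg hB] using h z hz
  rw [mixedNorm_smul hp hq, ← hκ] at h1
  refine h1.trans ?_
  rw [← ofReal_norm, Complex.norm_real, Real.norm_of_nonneg hB, mul_comm,
    ENNReal.ofReal_mul (by positivity)]
  gcongr
  rw [← ENNReal.ofReal_toReal ht, ENNReal.toReal_ofReal ENNReal.toReal_nonneg]
  exact ENNReal.ofReal_le_ofReal (by linarith)

/-! ### Mixed norms of Cauchy type kernels. -/

theorem setLIntegral_comp_abs_le (h : ℝ → ℝ≥0∞) (a : ℝ) :
    ∫⁻ x in Ioc (-a) a, h |x| ≤ 2 * ∫⁻ x in Ioo 0 a, h x := by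
  have h1 : ∫⁻ x in Ioo (-a) 0, h |x| = ∫⁻ x in Ioo 0 a, h x := by
    rw [← (Measure.measurePreserving_neg (volume : Measure ℝ)).setLIntegral_comp_preimage_emb
      (Homeomorph.neg ℝ).measurableEmbedding h]
    have : Neg.neg ⁻¹' Ioo 0 a = Ioo (-a) 0 := by ext x; simp
    rw [this]
    refine setLIntegral_congr_fun measurableSet_Ioo fun x hx => ?_
    simp only [abs_of_neg hx.2]
  have h2 : ∫⁻ x in Ioo 0 a, h |x| = ∫⁻ x in Ioo 0 a, h x :=
    setLIntegral_congr_fun measurableSet_Ioo fun x hx => by simp only [abs_of_pos hx.1]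
  have hsub : Ioc (-a) a ⊆ Ioc (-a) 0 ∪ Ioc 0 a := fun x hx => by
    rcases le_or_gt x 0 with hx0 | hx0
    exacts [Or.inl ⟨hx.1, hx0⟩, Or.inr ⟨hx0, hx.2⟩]
  calc _ ≤ ∫⁻ x in Ioc (-a) 0 ∪ Ioc 0 a, h |x| := lintegral_mono_set hsub
    _ ≤ (∫⁻ x in Ioc (-a) 0, h |x|) + ∫⁻ x in Ioc 0 a, h |x| := lintegral_union_le _ _ _
    _ = _ := by
      rw [setLIntegral_congr Ioo_ae_eq_Ioc.symm, setLIntegral_congr Ioo_ae_eq_Ioc.symm, h1, h2,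
        two_mul]

/-- The distance dominates `1 - ρ` by the triangle inequality, and `|θ| / π` by Jordan's inequality
`|sin (θ/2)| ≥ |θ| / π` together with `2 |sin (θ/2)| = |e^{iθ} - 1| ≤ 2 |1 - ρ e^{iθ}|`. The bound
averages the two. -/
theorem norm_one_sub_circleMap_ge {ρ θ : ℝ} (h0 : 0 ≤ ρ) (h1 : ρ < 1)
    (hθ : |θ| ≤ Real.pi) :
    ((1 - ρ) + |θ|) / (2 * Real.pi) ≤ ‖1 - circleMap 0 ρ θ‖ := by
  have hc : ‖circleMap 0 ρ θ‖ = ρ := by simp [abs_of_nonneg h0]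
  have ha : 1 - ρ ≤ ‖1 - circleMap 0 ρ θ‖ := by
    have := norm_sub_norm_le (1 : ℂ) (circleMap 0 ρ θ)
    rwa [hc, norm_one] at this
  have hb : |θ| ≤ Real.pi * ‖1 - circleMap 0 ρ θ‖ := by
    have e1 := Real.mul_abs_le_abs_sin (x := θ / 2) (by rw [abs_div, abs_two]; linarith)
    have e2 := Complex.norm_exp_I_mul_ofReal_sub_one θ
    rw [Real.norm_eq_abs, abs_mul, abs_two] at e2
    have e3 : ‖Complex.exp (Complex.I * θ) - 1‖ ≤ ‖1 - circleMap 0 ρ θ‖ + (1 - ρ) := by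
      have : Complex.exp (Complex.I * θ) - 1 =
          -(1 - circleMap 0 ρ θ) + (1 - ρ : ℝ) * Complex.exp (Complex.I * θ) := by
        rw [circleMap_zero, mul_comm (θ : ℂ) Complex.I]
        push_cast
        ring
      rw [this]
      refine (norm_add_le _ _).trans ?_
      rw [norm_neg, norm_mul, Complex.norm_real, Complex.norm_exp_I_mul_ofReal, mul_one,
        Real.norm_of_nonneg (by linarith)]
    rw [abs_div, abs_two] at e1
    have e4 : |θ| / Real.pi ≤ ‖1 - circleMap 0 ρ θ‖ := by
      have : 2 / Real.pi * (|θ| / 2) = |θ| / Real.pi := by ring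
      linarith
    rwa [div_le_iff₀' Real.pi_pos] at e4
  rw [div_le_iff₀ (by positivity)]
  nlinarith [Real.pi_gt_three, norm_nonneg (1 - circleMap 0 ρ θ)]

/-- With `δ = 1 - ρ`, the distance bound reduces matters to `∫ (δ + x) ^ (-t) dx ≤ δ ^ (1 - t) / (t
- 1)`, where `t > 1` is needed. -/
theorem lintegral_one_sub_circleMap_le {t : ℝ} (ht : 1 < t) {ρ : ℝ} (h0 : 0 ≤ ρ) (h1 : ρ < 1) :
    ∫⁻ θ in Ioc (-Real.pi) Real.pi, ENNReal.ofReal (‖1 - circleMap 0 ρ θ‖ ^ (-t)) ≤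
      ENNReal.ofReal (2 * (2 * Real.pi) ^ t / (t - 1) * (1 - ρ) ^ (1 - t)) := by
  set δ := 1 - ρ with hδ
  have hδ0 : 0 < δ := by linarith
  have ht1 : 0 < t - 1 := by linarith
  have hshift : ∫⁻ x in Ioo 0 Real.pi, ENNReal.ofReal ((δ + x) ^ (-t)) ≤
      ENNReal.ofReal (δ ^ (-(t - 1)) / (t - 1)) := by
    have := lintegral_rpow_neg_sub_one_le (d := δ + Real.pi) hδ0 ht1
    refine le_trans (le_of_eq ?_) this
    rw [← (measurePreserving_add_left volume δ).setLIntegral_comp_preimage_emb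
      (Homeomorph.addLeft δ).measurableEmbedding
      (fun x => ENNReal.ofReal (x ^ (-(t - 1) - 1)))]
    have hpre : (fun x => δ + x) ⁻¹' Ioo δ (δ + Real.pi) = Ioo 0 Real.pi := by
      ext x; simp
    rw [hpre, show -(t - 1) - 1 = -t by ring]
  calc _ ≤ ∫⁻ θ in Ioc (-Real.pi) Real.pi, ENNReal.ofReal ((2 * Real.pi) ^ t) *
        ENNReal.ofReal ((δ + |θ|) ^ (-t)) := by
        refine setLIntegral_mono' measurableSet_Ioc fun θ hθ => ?_
        have hge := norm_one_sub_circleMap_ge h0 h1 (abs_le.2 ⟨hθ.1.le, hθ.2⟩)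
        rw [← ENNReal.ofReal_mul (by positivity)]
        refine ENNReal.ofReal_le_ofReal ?_
        have hpos : 0 < (δ + |θ|) / (2 * Real.pi) := by positivity
        refine (Real.rpow_le_rpow_of_nonpos hpos hge (by linarith)).trans (le_of_eq ?_)
        rw [Real.div_rpow (by positivity) (by positivity), Real.rpow_neg (x := 2 * Real.pi)
          (by positivity), div_inv_eq_mul, mul_comm]
    _ = ENNReal.ofReal ((2 * Real.pi) ^ t) *
        ∫⁻ θ in Ioc (-Real.pi) Real.pi, ENNReal.ofReal ((δ + |θ|) ^ (-t)) :=
      lintegral_const_mul' _ _ ENNReal.ofReal_ne_top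
    _ ≤ ENNReal.ofReal ((2 * Real.pi) ^ t) *
        (2 * ENNReal.ofReal (δ ^ (-(t - 1)) / (t - 1))) := by
      gcongr
      exact (setLIntegral_comp_abs_le (fun x => ENNReal.ofReal ((δ + x) ^ (-t))) _).trans
        (mul_le_mul_right hshift 2)
    _ = _ := by
      rw [show (2 : ℝ≥0∞) = ENNReal.ofReal 2 by simp, ← ENNReal.ofReal_mul zero_le_two,
        ← ENNReal.ofReal_mul (by positivity), neg_sub]
      congr 1
      ring

/-- The Cauchy type kernel `(1 - w̄ z)⁻ᴺ`. -/
def cauchyKernel (w : ℂ) (N : ℕ) (z : ℂ) : ℂ := ((1 - starRingEnd ℂ w * z) ^ N)⁻¹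

theorem norm_conj_mul_lt_one {w z : ℂ} (hw : w ∈ disc) (hz : z ∈ disc) :
    ‖starRingEnd ℂ w * z‖ < 1 := by
  rw [disc, mem_ball_zero_iff] at hw hz
  rw [norm_mul, RCLike.norm_conj]
  nlinarith [norm_nonneg w, norm_nonneg z]

theorem one_sub_conj_mul_ne_zero {w z : ℂ} (hw : w ∈ disc) (hz : z ∈ disc) :
    1 - starRingEnd ℂ w * z ≠ 0 := by
  intro h
  have := norm_conj_mul_lt_one hw hz
  rw [← sub_eq_zero.1 h, norm_one] at this
  exact lt_irrefl _ this

/-- Rotating the circle by `arg w` replaces `w̄ z` by `r ‖w‖ e^{iθ}`, so the circle integral above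
applies with `t = N q`; the condition `1 / q < N` says `t > 1`. -/
theorem exists_integralMean_cauchyKernel_le {q : ℝ} (hq : 0 < q) {N : ℕ} (hN : 1 / q < N) :
    ∃ C : ℝ, 0 < C ∧ ∀ w ∈ disc, ∀ r ∈ Ioo (0 : ℝ) 1,
      integralMean q (cauchyKernel w N) r ≤
        ENNReal.ofReal (C * (1 - r * ‖w‖) ^ (-(N - 1 / q))) := by
  have hq' : 0 < 1 / q := by positivity
  set t : ℝ := N * q with ht
  have ht1 : 1 < t := by rwa [div_lt_iff₀ hq] at hN
  set C : ℝ := 1 / (2 * Real.pi) * (2 * (2 * Real.pi) ^ t / (t - 1)) with hC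
  have hC0 : 0 < C := by
    have : 0 < t - 1 := by linarith
    positivity
  refine ⟨C ^ (1 / q), by positivity, fun w hw r hr => ?_⟩
  have hw1 : ‖w‖ < 1 := by rwa [disc, mem_ball_zero_iff] at hw
  have hρ0 : 0 ≤ r * ‖w‖ := mul_nonneg hr.1.le (norm_nonneg w)
  have hρ1 : r * ‖w‖ < 1 := by nlinarith [hr.1, hr.2, norm_nonneg w]
  have hδ : 0 < 1 - r * ‖w‖ := by linarith
  have hmap : ∀ θ : ℝ, starRingEnd ℂ w * circleMap 0 r (Complex.arg w + θ) =
      circleMap 0 (r * ‖w‖) θ := fun θ => by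
    nth_rw 1 [← Complex.norm_mul_exp_arg_mul_I w]
    rw [map_mul, ← Complex.exp_conj, map_mul, Complex.conj_ofReal, Complex.conj_ofReal,
      Complex.conj_I, circleMap_zero, circleMap_zero]
    push_cast
    rw [add_mul, Complex.exp_add]
    have : Complex.exp (w.arg * -Complex.I) * Complex.exp (w.arg * Complex.I) = 1 := by
      rw [← Complex.exp_add]; simp
    linear_combination (r * ‖w‖ * Complex.exp (θ * Complex.I)) * this
  have hval : ∀ θ : ℝ, ‖cauchyKernel w N (circleMap 0 r (Complex.arg w + θ))‖ₑ ^ q =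
      ENNReal.ofReal (‖1 - circleMap 0 (r * ‖w‖) θ‖ ^ (-t)) := fun θ => by
    rw [cauchyKernel, hmap, ← ofReal_norm, ENNReal.ofReal_rpow_of_nonneg (norm_nonneg _) hq.le,
      norm_inv, norm_pow, Real.inv_rpow (by positivity), ← Real.rpow_natCast,
      ← Real.rpow_mul (norm_nonneg _), ← Real.rpow_neg (norm_nonneg _)]
  have hper : Function.Periodic (fun θ => ‖cauchyKernel w N (circleMap 0 r θ)‖ₑ ^ q)
      (2 * Real.pi) := fun θ => by
    simp only [periodic_circleMap 0 r θ]
  have hint : ∫⁻ θ in Ioc 0 (2 * Real.pi), ‖cauchyKernel w N (circleMap 0 r θ)‖ₑ ^ q =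
      ∫⁻ θ in Ioc (-Real.pi) Real.pi, ENNReal.ofReal (‖1 - circleMap 0 (r * ‖w‖) θ‖ ^ (-t)) := by
    have e1 := setLIntegral_Ioc_of_periodic Real.two_pi_pos hper 0 (Complex.arg w - Real.pi)
    rw [zero_add] at e1
    rw [e1, ← (measurePreserving_add_left volume (Complex.arg w)).setLIntegral_comp_preimage_emb
      (Homeomorph.addLeft (Complex.arg w)).measurableEmbedding]
    simp only [hval]
    congr 2
    ext θ
    simp only [mem_preimage, mem_Ioc]
    constructor <;> rintro ⟨h, h'⟩ <;> constructor <;> linarith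
  unfold integralMean
  rw [hint]
  calc _ ≤ (ENNReal.ofReal (1 / (2 * Real.pi)) * ENNReal.ofReal
        (2 * (2 * Real.pi) ^ t / (t - 1) * (1 - r * ‖w‖) ^ (1 - t))) ^ (1 / q) := by
        gcongr
        exact lintegral_one_sub_circleMap_le ht1 hρ0 hρ1
    _ = _ := by
        rw [← ENNReal.ofReal_mul (by positivity), ← mul_assoc, ← hC,
          ENNReal.ofReal_rpow_of_nonneg (by positivity) hq'.le,
          Real.mul_rpow hC0.le (by positivity), ← Real.rpow_mul hδ.le]
        congr 3
        rw [ht]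
        field_simp
        ring

/-- The mixed norm of the Cauchy type kernels. -/
theorem exists_mixedNorm_cauchyKernel_le {p q : ℝ} (hp : 0 < p) (hq : 0 < q) {φ : ℝ → ℝ}
    (hφ : IsNormal φ) :
    ∃ b : ℝ, 0 < b ∧ (∀ r ∈ Ico (0 : ℝ) 1, φ 0 * (1 - r) ^ b ≤ φ r) ∧
      ∀ N : ℕ, 1 / q + b < N → ∃ C : ℝ, 0 < C ∧ ∀ w ∈ disc,
        mixedNorm p q φ (cauchyKernel w N) ≤
          ENNReal.ofReal (C * (φ ‖w‖ * (1 - ‖w‖) ^ (-(N - 1 / q)))) := by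
  obtain ⟨a, b, ha, hb, h1, h2⟩ := hφ.exists_exponents
  have hpos := hφ.2.1
  have hp' : 0 < 1 / p := by positivity
  refine ⟨b, hb, fun r hr => ?_, fun N hN => ?_⟩
  · have h0 : (0 : ℝ) ∈ Ico (0 : ℝ) 1 := by constructor <;> norm_num
    have hr1 : 0 < 1 - r := by linarith [hr.2]
    have := h2 r hr 0 h0 hr.1
    rw [sub_zero, Real.one_rpow, mul_one_div, le_div_iff₀ (by positivity)] at this
    exact this
  obtain ⟨C, hC, hM⟩ := exists_integralMean_cauchyKernel_le hq (N := N) (by linarith)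
  set γ : ℝ := N - 1 / q with hγ
  have hγb : 0 < γ - b := by rw [hγ]; linarith
  have hγ0 : 0 < γ := by linarith
  set D : ℝ := 1 / ((γ - b) * p) + 1 / (a * p) with hD
  have hD0 : 0 < D := by positivity
  refine ⟨C * D ^ (1 / p), by positivity, fun w hw => ?_⟩
  have hw1 : ‖w‖ < 1 := by rwa [disc, mem_ball_zero_iff] at hw
  set ρ := ‖w‖ with hρ
  have hρ' : ρ ∈ Ico (0 : ℝ) 1 := ⟨norm_nonneg _, hw1⟩
  have hφρ := hpos ρ hρ'
  have hδ : 0 < 1 - ρ := by linarith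
  set A : ℝ := C ^ p * φ ρ ^ p * (1 - ρ) ^ (-(γ * p)) with hA
  have hA0 : 0 < A := by positivity
  -- Inside radius `ρ = ‖w‖`, use `1 - r ρ ≥ 1 - r` and the exponent `b`; the integral concentrates
  -- near `r = ρ` because `γ > b`.
  have hpt1 : ∀ r ∈ Ioo (0 : ℝ) ρ,
      integralMean q (cauchyKernel w N) r ^ p * ENNReal.ofReal (φ r ^ p / (1 - r)) ≤
        ENNReal.ofReal (A * (1 - ρ) ^ ((γ - b) * p)) *
          ENNReal.ofReal ((1 - r) ^ (-((γ - b) * p) - 1)) := fun r hr => by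
    have hr1 : r < 1 := hr.2.trans hw1
    have hr' : 0 < 1 - r := by linarith
    have hφr := hpos r ⟨hr.1.le, hr1⟩
    have hrρ : 1 - r ≤ 1 - r * ρ := by nlinarith [hr.1]
    have e1 : integralMean q (cauchyKernel w N) r ≤ ENNReal.ofReal (C * (1 - r) ^ (-γ)) := by
      refine (hM w hw r ⟨hr.1, hr1⟩).trans (ENNReal.ofReal_le_ofReal ?_)
      have := Real.rpow_le_rpow_of_nonpos hr' hrρ (neg_nonpos.2 hγ0.le)
      gcongr
    have e2 := h2 ρ hρ' r ⟨hr.1.le, hr1⟩ hr.2.le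
    calc _ ≤ ENNReal.ofReal (C * (1 - r) ^ (-γ)) ^ p *
          ENNReal.ofReal ((φ ρ * ((1 - r) ^ b / (1 - ρ) ^ b)) ^ p / (1 - r)) := by gcongr
      _ = _ := by
        rw [ENNReal.ofReal_rpow_of_nonneg (by positivity) hp.le, ← ENNReal.ofReal_mul
          (by positivity), ← ENNReal.ofReal_mul (by positivity)]
        congr 1
        rw [Real.mul_rpow hC.le (by positivity), Real.mul_rpow hφρ.le (by positivity),
          Real.div_rpow (by positivity) (by positivity), ← Real.rpow_mul hr'.le,
          ← Real.rpow_mul hr'.le, ← Real.rpow_mul hδ.le, Real.rpow_sub_one hr'.ne', hA,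
          show -((γ - b) * p) = -γ * p + b * p by ring, Real.rpow_add hr',
          show (γ - b) * p = γ * p - b * p by ring, Real.rpow_sub hδ, Real.rpow_neg hδ.le]
        field_simp
  -- Outside radius `ρ`, use `1 - r ρ ≥ 1 - ρ` and the exponent `a`; integrability at `1` comes from
  -- `a > 0`. Both pieces have the same size `A`.
  have hpt2 : ∀ r ∈ Ioo ρ 1,
      integralMean q (cauchyKernel w N) r ^ p * ENNReal.ofReal (φ r ^ p / (1 - r)) ≤
        ENNReal.ofReal (A * (1 - ρ) ^ (-(a * p))) *
          ENNReal.ofReal ((1 - r) ^ (a * p - 1)) := fun r hr => by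
    have hr0 : 0 < r := hρ'.1.trans_lt hr.1
    have hr1 : r < 1 := hr.2
    have hr' : 0 < 1 - r := by linarith
    have hφr := hpos r ⟨hr0.le, hr1⟩
    have hrρ : 1 - ρ ≤ 1 - r * ρ := by nlinarith [hρ'.1]
    have e1 : integralMean q (cauchyKernel w N) r ≤ ENNReal.ofReal (C * (1 - ρ) ^ (-γ)) := by
      refine (hM w hw r ⟨hr0, hr1⟩).trans (ENNReal.ofReal_le_ofReal ?_)
      have := Real.rpow_le_rpow_of_nonpos hδ hrρ (neg_nonpos.2 hγ0.le)
      gcongr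
    have e2 := h1 ρ hρ' r ⟨hr0.le, hr1⟩ hr.1.le
    calc _ ≤ ENNReal.ofReal (C * (1 - ρ) ^ (-γ)) ^ p *
          ENNReal.ofReal ((φ ρ * ((1 - r) ^ a / (1 - ρ) ^ a)) ^ p / (1 - r)) := by gcongr
      _ = _ := by
        rw [ENNReal.ofReal_rpow_of_nonneg (by positivity) hp.le, ← ENNReal.ofReal_mul
          (by positivity), ← ENNReal.ofReal_mul (by positivity)]
        congr 1
        rw [Real.mul_rpow hC.le (by positivity), Real.mul_rpow hφρ.le (by positivity),
          Real.div_rpow (by positivity) (by positivity), ← Real.rpow_mul hr'.le,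
          ← Real.rpow_mul hδ.le, ← Real.rpow_mul hδ.le, Real.rpow_sub_one hr'.ne', hA,
          Real.rpow_neg hδ.le (a * p), neg_mul]
        field_simp
  have hI1 : ∫⁻ r in Ioo (0 : ℝ) ρ,
      integralMean q (cauchyKernel w N) r ^ p * ENNReal.ofReal (φ r ^ p / (1 - r)) ≤
        ENNReal.ofReal (A * (1 / ((γ - b) * p))) := by
    refine (setLIntegral_mono' measurableSet_Ioo hpt1).trans ?_
    rw [lintegral_const_mul' _ _ ENNReal.ofReal_ne_top,
      setLIntegral_one_sub (fun x => ENNReal.ofReal (x ^ (-((γ - b) * p) - 1)))]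
    refine (mul_le_mul_right (lintegral_rpow_neg_sub_one_le hδ (by positivity)) _).trans
      (le_of_eq ?_)
    rw [← ENNReal.ofReal_mul (by positivity)]
    congr 1
    have : (1 - ρ) ^ ((γ - b) * p) * (1 - ρ) ^ (-((γ - b) * p)) = 1 := by
      rw [← Real.rpow_add hδ]; simp
    calc _ = A * ((1 - ρ) ^ ((γ - b) * p) * (1 - ρ) ^ (-((γ - b) * p))) / ((γ - b) * p) := by ring
      _ = _ := by rw [this]; ring
  have hI2 : ∫⁻ r in Ioo ρ 1,
      integralMean q (cauchyKernel w N) r ^ p * ENNReal.ofReal (φ r ^ p / (1 - r)) ≤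
        ENNReal.ofReal (A * (1 / (a * p))) := by
    refine (setLIntegral_mono' measurableSet_Ioo hpt2).trans ?_
    rw [lintegral_const_mul' _ _ ENNReal.ofReal_ne_top,
      setLIntegral_one_sub (fun x => ENNReal.ofReal (x ^ (a * p - 1))), sub_self,
      lintegral_rpow_sub_one hδ (by positivity), ← ENNReal.ofReal_mul (by positivity)]
    refine le_of_eq (congrArg _ ?_)
    have : (1 - ρ) ^ (-(a * p)) * (1 - ρ) ^ (a * p) = 1 := by
      rw [← Real.rpow_add hδ]; simp
    calc _ = A * ((1 - ρ) ^ (-(a * p)) * (1 - ρ) ^ (a * p)) / (a * p) := by ring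
      _ = _ := by rw [this]; ring
  have hsub : Ioo (0 : ℝ) 1 ⊆ Ioc 0 ρ ∪ Ioo ρ 1 := fun r hr => by
    rcases le_or_gt r ρ with h | h
    exacts [Or.inl ⟨hr.1, h⟩, Or.inr ⟨h, hr.2⟩]
  unfold mixedNorm
  calc _ ≤ (ENNReal.ofReal (A * (1 / ((γ - b) * p))) + ENNReal.ofReal (A * (1 / (a * p)))) ^
        (1 / p) := by
        refine ENNReal.rpow_le_rpow ((lintegral_mono_set hsub).trans
          ((lintegral_union_le _ _ _).trans (add_le_add ?_ hI2))) hp'.le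
        rwa [setLIntegral_congr Ioo_ae_eq_Ioc.symm]
    _ = _ := by
        rw [← ENNReal.ofReal_add (by positivity) (by positivity), ← mul_add, ← hD,
          ENNReal.ofReal_rpow_of_nonneg (by positivity) hp'.le, Real.mul_rpow hA0.le hD0.le, hA,
          Real.mul_rpow (by positivity) (by positivity), Real.mul_rpow (by positivity)
          (by positivity), ← Real.rpow_mul hC.le, ← Real.rpow_mul hφρ.le, ← Real.rpow_mul hδ.le,
          mul_one_div_cancel hp.ne', Real.rpow_one, Real.rpow_one,
          show -(γ * p) * (1 / p) = -γ by field_simp]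
        congr 1
        ring

/-! ### Test functions. -/

theorem iteratedDeriv_cauchyKernel {w : ℂ} (hw : w ∈ disc) (N m : ℕ) {z : ℂ} (hz : z ∈ disc) :
    iteratedDeriv m (cauchyKernel w N) z =
      N.ascFactorial m * starRingEnd ℂ w ^ m * cauchyKernel w (N + m) z := by
  induction m generalizing z with
  | zero => simp
  | succ m ih =>
    rw [iteratedDeriv_succ]
    have hev : iteratedDeriv m (cauchyKernel w N) =ᶠ[𝓝 z] fun z =>
        N.ascFactorial m * starRingEnd ℂ w ^ m * cauchyKernel w (N + m) z :=
      eventually_of_mem (isOpen_disc.mem_nhds hz) fun x hx => ih hx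
    rw [hev.deriv_eq]
    have hne := one_sub_conj_mul_ne_zero hw hz
    have h1 : HasDerivAt (fun z => 1 - starRingEnd ℂ w * z) (-starRingEnd ℂ w) z := by
      simpa using ((hasDerivAt_id z).const_mul (starRingEnd ℂ w)).const_sub 1
    have h2 : HasDerivAt (cauchyKernel w (N + m)) _ z :=
      (h1.pow (N + m)).inv (pow_ne_zero _ hne)
    rw [(h2.const_mul _).deriv, Nat.ascFactorial_succ, cauchyKernel, ← add_assoc]
    push_cast
    rcases Nat.eq_zero_or_pos (N + m) with h0 | h0
    · have hN : (N : ℂ) + m = 0 := by exact_mod_cast h0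
      simp [hN]
    · obtain ⟨k, hk⟩ := Nat.exists_eq_succ_of_ne_zero h0.ne'
      rw [hk]
      simp only [Nat.succ_eq_add_one, Nat.add_sub_cancel]
      have hk' : (N : ℂ) + m = k + 1 := by exact_mod_cast hk
      rw [hk']
      simp only [Pi.pow_apply]
      field_simp
      ring

theorem differentiableOn_cauchyKernel {w : ℂ} (hw : w ∈ disc) (N : ℕ) :
    DifferentiableOn ℂ (cauchyKernel w N) disc := by
  intro z hz
  have hne := one_sub_conj_mul_ne_zero hw hz
  have h : DifferentiableAt ℂ (fun z => (1 - starRingEnd ℂ w * z) ^ N) z := by fun_prop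
  exact (h.fun_inv (pow_ne_zero _ hne)).differentiableWithinAt

/-- The restriction to the disc of a function analytic on the disc, as an element of `H(𝔻)`. -/
def HolDisc.mk (f : ℂ → ℂ) (hf : DifferentiableOn ℂ f disc) : HolDisc :=
  ⟨disc.indicator f, hf.congr fun _ hz => indicator_of_mem hz f,
    fun _ hz => indicator_of_notMem hz f⟩

theorem HolDisc.mk_apply {f : ℂ → ℂ} (hf : DifferentiableOn ℂ f disc) {z : ℂ} (hz : z ∈ disc) :
    (HolDisc.mk f hf : ℂ → ℂ) z = f z := indicator_of_mem hz f

theorem HolDisc.iteratedDeriv_mk {f : ℂ → ℂ} (hf : DifferentiableOn ℂ f disc) (m : ℕ) {z : ℂ}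
    (hz : z ∈ disc) : iteratedDeriv m (HolDisc.mk f hf : ℂ → ℂ) z = iteratedDeriv m f z := by
  have hev : (HolDisc.mk f hf : ℂ → ℂ) =ᶠ[𝓝 z] f :=
    eventually_of_mem (isOpen_disc.mem_nhds hz) fun x hx => HolDisc.mk_apply hf hx
  exact hev.iteratedDeriv_eq m

/-- The bound is uniform in `w`, so for fixed `z` the test functions decay as fast as their
normalizing factor. -/
theorem norm_cauchyKernel_le {w z : ℂ} (hw : w ∈ disc) (hz : z ∈ disc) (N : ℕ) :
    ‖cauchyKernel w N z‖ ≤ ((1 - ‖z‖) ^ N)⁻¹ := by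
  rw [disc, mem_ball_zero_iff] at hw hz
  have hz' : 0 < 1 - ‖z‖ := by linarith
  rw [cauchyKernel, norm_inv, norm_pow]
  have h : 1 - ‖z‖ ≤ ‖1 - starRingEnd ℂ w * z‖ := by
    have h1 := norm_sub_norm_le (1 : ℂ) (starRingEnd ℂ w * z)
    rw [norm_one, norm_mul, RCLike.norm_conj] at h1
    nlinarith [norm_nonneg z]
  gcongr

/-- The combination `α (1 - w̄ z)⁻ᴺ + β (1 - |w|²) (1 - w̄ z)⁻ᴺ⁻¹`. -/
def kernelComb (N : ℕ) (α β : ℝ) (w z : ℂ) : ℂ :=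
  (α : ℂ) * cauchyKernel w N z + ((β * (1 - ‖w‖ ^ 2) : ℝ) : ℂ) * cauchyKernel w (N + 1) z

theorem differentiableOn_kernelComb {w : ℂ} (hw : w ∈ disc) (N : ℕ) (α β : ℝ) :
    DifferentiableOn ℂ (kernelComb N α β w) disc :=
  ((differentiableOn_cauchyKernel hw N).const_mul _).add
    ((differentiableOn_cauchyKernel hw (N + 1)).const_mul _)

theorem iteratedDeriv_kernelComb {w : ℂ} (hw : w ∈ disc) (N : ℕ) (α β : ℝ) (m : ℕ) {z : ℂ}
    (hz : z ∈ disc) :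
    iteratedDeriv m (kernelComb N α β w) z =
      starRingEnd ℂ w ^ m * ((α * N.ascFactorial m : ℝ) * cauchyKernel w (N + m) z +
        (β * (N + 1).ascFactorial m * (1 - ‖w‖ ^ 2) : ℝ) * cauchyKernel w (N + 1 + m) z) := by
  have hc : ∀ M, ContDiffAt ℂ m (cauchyKernel w M) z := fun M =>
    ((differentiableOn_cauchyKernel hw M).analyticAt (isOpen_disc.mem_nhds hz)).contDiffAt
  have heq : kernelComb N α β w = (fun z => (α : ℂ) * cauchyKernel w N z) +
      fun z => ((β * (1 - ‖w‖ ^ 2) : ℝ) : ℂ) * cauchyKernel w (N + 1) z := rfl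
  rw [heq, iteratedDeriv_add (contDiffAt_const.mul (hc N)) (contDiffAt_const.mul (hc (N + 1))),
    iteratedDeriv_const_mul_field, iteratedDeriv_const_mul_field,
    iteratedDeriv_cauchyKernel hw N m hz, iteratedDeriv_cauchyKernel hw (N + 1) m hz]
  push_cast
  ring

/-- Since `1 - |w|² ≤ 2 (1 - |w|) ≤ 2 |1 - w̄z|`, the second kernel with its factor is dominated by
the first, so the norm estimate for one kernel suffices. -/
theorem norm_kernelComb_le {w z : ℂ} (hw : w ∈ disc) (hz : z ∈ disc) (N : ℕ) (α β : ℝ) :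
    ‖kernelComb N α β w z‖ ≤ (|α| + 2 * |β|) * ‖cauchyKernel w N z‖ := by
  have hne := norm_pos_iff.2 (one_sub_conj_mul_ne_zero hw hz)
  have hw' : ‖w‖ < 1 := by rwa [disc, mem_ball_zero_iff] at hw
  have hz' : ‖z‖ < 1 := by rwa [disc, mem_ball_zero_iff] at hz
  have hge : 1 - ‖w‖ ≤ ‖1 - starRingEnd ℂ w * z‖ := by
    have h1 := norm_sub_norm_le (1 : ℂ) (starRingEnd ℂ w * z)
    rw [norm_one, norm_mul, RCLike.norm_conj] at h1
    nlinarith [norm_nonneg w]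
  have hk : ‖cauchyKernel w (N + 1) z‖ = ‖cauchyKernel w N z‖ / ‖1 - starRingEnd ℂ w * z‖ := by
    rw [cauchyKernel, cauchyKernel, norm_inv, norm_inv, norm_pow, norm_pow, pow_succ, mul_inv,
      div_eq_mul_inv]
  have hs : 0 ≤ 1 - ‖w‖ ^ 2 := by nlinarith [norm_nonneg w]
  have h2 : (1 - ‖w‖ ^ 2) / ‖1 - starRingEnd ℂ w * z‖ ≤ 2 := by
    rw [div_le_iff₀ hne]
    nlinarith [norm_nonneg w]
  refine (norm_add_le _ _).trans ?_
  rw [norm_mul, norm_mul, Complex.norm_real, Complex.norm_real, Real.norm_eq_abs,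
    Real.norm_eq_abs, abs_mul, abs_of_nonneg hs, hk]
  calc _ = |α| * ‖cauchyKernel w N z‖ + |β| * ‖cauchyKernel w N z‖ *
        ((1 - ‖w‖ ^ 2) / ‖1 - starRingEnd ℂ w * z‖) := by ring
    _ ≤ |α| * ‖cauchyKernel w N z‖ + |β| * ‖cauchyKernel w N z‖ * 2 := by gcongr
    _ = _ := by ring

/-- A bounded family of test functions `F w` in the mixed norm space, tending to `0` with all
derivatives pointwise as `|w| → 1`, whose `j`-th derivative vanishes at `w` and whose `i`-th
derivative at `w` is as large as possible. -/
theorem exists_test_functions {p q : ℝ} (hp : 0 < p) (hq : 0 < q) {φ : ℝ → ℝ}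
    (hφ : IsNormal φ) {i j : ℕ} (hij : i ≠ j) :
    ∃ (C : ℝ) (F : ℂ → HolDisc), 0 < C ∧ ∀ w ∈ disc,
      mixedNorm p q φ (F w) ≤ ENNReal.ofReal C ∧
      iteratedDeriv j (F w : ℂ → ℂ) w = 0 ∧
      ‖iteratedDeriv i (F w : ℂ → ℂ) w‖ =
        ‖w‖ ^ i / (φ ‖w‖ * (1 - ‖w‖ ^ 2) ^ (1 / q + i)) ∧
      ∀ m : ℕ, ∀ z ∈ disc, ∀ (ι : Type) (l : Filter ι) (v : ι → ℂ), (∀ k, v k ∈ disc) →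
        Tendsto (fun k => ‖v k‖) l (𝓝 1) →
        Tendsto (fun k => iteratedDeriv m (F (v k) : ℂ → ℂ) z) l (𝓝 0) := by
  classical
  obtain ⟨b, hb, hφb, hker⟩ := exists_mixedNorm_cauchyKernel_le hp hq hφ
  have hpos := hφ.2.1
  have hφ0 : 0 < φ 0 := hpos 0 ⟨le_rfl, one_pos⟩
  obtain ⟨N, hN⟩ := exists_nat_gt (1 / q + b)
  obtain ⟨C, hC, hCN⟩ := hker N hN
  set γ : ℝ := N - 1 / q with hγ
  have hγb : 0 < γ - b := by rw [hγ]; linarith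
  have hγ0 : 0 < γ := by linarith
  have hN0 : 0 < (N : ℝ) := by
    have : 0 < 1 / q := by positivity
    linarith
  have hNi : (N.ascFactorial i : ℝ) ≠ 0 := by
    have := Nat.ascFactorial_pos (N - 1) i
    rw [Nat.sub_add_cancel (by exact_mod_cast hN0)] at this
    exact_mod_cast this.ne'
  have hji : (j : ℝ) - i ≠ 0 := sub_ne_zero.2 fun h => hij (by exact_mod_cast h.symm)
  have hasc : ∀ k : ℕ, ((N + 1).ascFactorial k : ℝ) = (N + k) * N.ascFactorial k / N := fun k => by
    rw [eq_div_iff hN0.ne', mul_comm]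
    exact_mod_cast Nat.succ_ascFactorial N k
  -- At `z = w` the `m`-th derivative is proportional to `(N)_m (α + β (N + m) / N)`, with `(N)_m`
  -- the rising factorial. The pair `α`, `β` solves the system making this `0` for `m = j` and `1`
  -- for `m = i`, which is possible since `i ≠ j`.
  set α : ℝ := (N + j) / (N.ascFactorial i * (j - i)) with hα
  set β : ℝ := -(N / (N.ascFactorial i * (j - i))) with hβ
  have hvj : α * N.ascFactorial j + β * (N + 1).ascFactorial j = 0 := by
    rw [hasc, hα, hβ]
    field_simp
    ring
  have hvi : α * N.ascFactorial i + β * (N + 1).ascFactorial i = 1 := by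
    rw [hasc, hα, hβ]
    field_simp
    ring
  -- Up to constants, the reciprocal of the bound `φ(|w|) (1 - |w|) ^ (-γ)` for the norm of the
  -- kernel.
  set A : ℂ → ℝ := fun w => (1 - ‖w‖ ^ 2) ^ γ / φ ‖w‖ with hA
  have hfacts : ∀ w ∈ disc, ‖w‖ < 1 ∧ 0 < φ ‖w‖ ∧ 0 < 1 - ‖w‖ ∧ 0 < 1 - ‖w‖ ^ 2 ∧
      1 - ‖w‖ ^ 2 ≤ 2 * (1 - ‖w‖) := fun w hw => by
    have hw' : ‖w‖ < 1 := by rwa [disc, mem_ball_zero_iff] at hw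
    have := norm_nonneg w
    exact ⟨hw', hpos _ ⟨this, hw'⟩, by linarith, by nlinarith, by nlinarith⟩
  have hA0 : ∀ w ∈ disc, 0 < A w := fun w hw => by
    obtain ⟨-, h1, h2, h3, -⟩ := hfacts w hw
    simp only [hA]
    positivity
  set F : ℂ → HolDisc := fun w => if hw : w ∈ disc then
    ((A w : ℝ) : ℂ) • HolDisc.mk _ (differentiableOn_kernelComb hw N α β) else 0 with hF
  have hFd : ∀ w (hw : w ∈ disc), ∀ m, ∀ z ∈ disc, iteratedDeriv m (F w : ℂ → ℂ) z =
      (A w : ℂ) * iteratedDeriv m (kernelComb N α β w) z := fun w hw m z hz => by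
    simp only [hF, dif_pos hw]
    rw [← HolDisc.iteratedDeriv_mk (differentiableOn_kernelComb hw N α β) m hz]
    exact HolDisc.iteratedDeriv_smul m _ _ hz
  have hval : ∀ w ∈ disc, ∀ m, iteratedDeriv m (F w : ℂ → ℂ) w = (A w : ℂ) *
      starRingEnd ℂ w ^ m * ((α * N.ascFactorial m + β * (N + 1).ascFactorial m : ℝ) : ℂ) *
        (((1 - ‖w‖ ^ 2) ^ (N + m) : ℝ) : ℂ)⁻¹ := fun w hw m => by
    obtain ⟨-, h1, h2, h3, -⟩ := hfacts w hw
    have hww : 1 - starRingEnd ℂ w * w = ((1 - ‖w‖ ^ 2 : ℝ) : ℂ) := by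
      rw [← Complex.normSq_eq_conj_mul_self, Complex.normSq_eq_norm_sq]
      push_cast
      ring
    have h3' : ((1 - ‖w‖ ^ 2 : ℝ) : ℂ) ≠ 0 := by exact_mod_cast h3.ne'
    rw [hFd w hw m w hw, iteratedDeriv_kernelComb hw N α β m hw, cauchyKernel, cauchyKernel, hww,
      show N + 1 + m = N + m + 1 by ring]
    simp only [Complex.ofReal_mul, Complex.ofReal_add, Complex.ofReal_pow (1 - ‖w‖ ^ 2)]
    field_simp
    ring
  refine ⟨2 ^ γ * (|α| + 2 * |β| + 1) * C, F, by positivity, fun w hw => ⟨?_, ?_, ?_, ?_⟩⟩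
  · obtain ⟨-, h1, h2, h3, h4⟩ := hfacts w hw
    set B : ℝ := A w * (|α| + 2 * |β| + 1) with hB
    have hAw := hA0 w hw
    have hB0 : 0 < B := by positivity
    have hle : mixedNorm p q φ (F w) ≤ mixedNorm p q φ (((B : ℝ) : ℂ) • cauchyKernel w N) := by
      refine mixedNorm_mono hp hq φ fun z hz => ?_
      have e1 := norm_kernelComb_le hw hz N α β
      have e2 : (F w : ℂ → ℂ) z = (A w : ℂ) * kernelComb N α β w z := by
        have := hFd w hw 0 z hz
        simpa only [iteratedDeriv_zero] using this
      rw [e2, Pi.smul_apply, smul_eq_mul, norm_mul, norm_mul, Complex.norm_real,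
        Complex.norm_real, Real.norm_of_nonneg hAw.le, Real.norm_of_nonneg hB0.le, hB, mul_assoc]
      gcongr
      exact e1.trans (mul_le_mul_of_nonneg_right (by linarith) (norm_nonneg _))
    refine hle.trans ?_
    rw [mixedNorm_smul hp hq, ← ofReal_norm, Complex.norm_real, Real.norm_of_nonneg hB0.le]
    refine (mul_le_mul_right (hCN w hw) _).trans ?_
    rw [← ENNReal.ofReal_mul hB0.le]
    refine ENNReal.ofReal_le_ofReal ?_
    have e3 : (1 - ‖w‖ ^ 2) ^ γ ≤ 2 ^ γ * (1 - ‖w‖) ^ γ := by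
      rw [← Real.mul_rpow zero_le_two h2.le]
      exact Real.rpow_le_rpow h3.le h4 hγ0.le
    have e4 : A w * φ ‖w‖ * (1 - ‖w‖) ^ (-γ) ≤ 2 ^ γ := by
      simp only [hA]
      rw [div_mul_cancel₀ _ h1.ne', Real.rpow_neg h2.le, ← div_eq_mul_inv,
        div_le_iff₀ (by positivity)]
      exact e3
    calc _ = (A w * φ ‖w‖ * (1 - ‖w‖) ^ (-γ)) * (|α| + 2 * |β| + 1) * C := by rw [hB]; ring
      _ ≤ _ := by gcongr
  · rw [hval w hw, hvj]
    simp
  · obtain ⟨-, h1, h2, h3, h4⟩ := hfacts w hw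
    rw [hval w hw, hvi, norm_mul, norm_mul, norm_mul, norm_pow, RCLike.norm_conj, norm_inv,
      Complex.norm_real, Complex.norm_real, Complex.norm_real, norm_one, mul_one,
      Real.norm_of_nonneg (hA0 w hw).le, Real.norm_of_nonneg (by positivity)]
    simp only [hA]
    have e1 : (1 - ‖w‖ ^ 2) ^ (N + i) = (1 - ‖w‖ ^ 2) ^ γ * (1 - ‖w‖ ^ 2) ^ (1 / q + i) := by
      rw [← Real.rpow_add h3, ← Real.rpow_natCast]
      congr 1
      rw [hγ]; push_cast; ring
    rw [e1]
    field_simp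
  · intro m z hz ι l v hv hlim
    have hz' : 0 < 1 - ‖z‖ := by
      have : ‖z‖ < 1 := by rwa [disc, mem_ball_zero_iff] at hz
      linarith
    set K : ℝ := |α * N.ascFactorial m| * ((1 - ‖z‖) ^ (N + m))⁻¹ +
      |β * (N + 1).ascFactorial m| * ((1 - ‖z‖) ^ (N + 1 + m))⁻¹ with hK
    -- The lower bound `φ r ≥ φ 0 (1 - r) ^ b` gives `A w = O((1 - |w|) ^ (γ - b))`, and `N` was
    -- chosen with `γ > b`; the kernels and their derivatives at the fixed `z` are bounded by `K`.
    refine squeeze_zero_norm (a := fun k => 2 ^ γ / φ 0 * (1 - ‖v k‖) ^ (γ - b) * K)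
      (fun k => ?_) ?_
    · obtain ⟨h0, h1, h2, h3, h4⟩ := hfacts _ (hv k)
      have hAk := hA0 _ (hv k)
      rw [hFd _ (hv k) m z hz, norm_mul, Complex.norm_real, Real.norm_of_nonneg hAk.le]
      have e1 : A (v k) ≤ 2 ^ γ / φ 0 * (1 - ‖v k‖) ^ (γ - b) := by
        simp only [hA]
        have e3 : (1 - ‖v k‖ ^ 2) ^ γ ≤ 2 ^ γ * (1 - ‖v k‖) ^ γ := by
          rw [← Real.mul_rpow zero_le_two h2.le]
          exact Real.rpow_le_rpow h3.le h4 hγ0.le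
        have e4 := hφb ‖v k‖ ⟨norm_nonneg _, h0⟩
        calc _ ≤ 2 ^ γ * (1 - ‖v k‖) ^ γ / (φ 0 * (1 - ‖v k‖) ^ b) := by gcongr
          _ = _ := by
            rw [Real.rpow_sub h2 γ b, div_mul_div_comm]
      have e2 : ‖iteratedDeriv m (kernelComb N α β (v k)) z‖ ≤ K := by
        rw [iteratedDeriv_kernelComb (hv k) N α β m hz, norm_mul, norm_pow, RCLike.norm_conj]
        refine (mul_le_of_le_one_left (norm_nonneg _)
          (pow_le_one₀ (norm_nonneg _) h0.le)).trans ((norm_add_le _ _).trans ?_)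
        rw [norm_mul, norm_mul, Complex.norm_real, Complex.norm_real, Real.norm_eq_abs,
          Real.norm_eq_abs, hK]
        have f1 := norm_cauchyKernel_le (hv k) hz (N + m)
        have f2 := norm_cauchyKernel_le (hv k) hz (N + 1 + m)
        have f3 : |β * (N + 1).ascFactorial m * (1 - ‖v k‖ ^ 2)| ≤
            |β * (N + 1).ascFactorial m| := by
          rw [abs_mul _ (1 - ‖v k‖ ^ 2), abs_of_pos h3]
          exact mul_le_of_le_one_right (abs_nonneg _) (by nlinarith [norm_nonneg (v k)])
        gcongr
      gcongr
    · have h5 : Tendsto (fun k => 1 - ‖v k‖) l (𝓝 0) := by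
        simpa using hlim.const_sub 1
      have h6 := h5.rpow_const (p := γ - b) (Or.inr hγb.le)
      rw [Real.zero_rpow hγb.ne'] at h6
      simpa using (h6.const_mul (2 ^ γ / φ 0)).mul_const K

/-! ### Point evaluations, the Zygmund norm and the derivatives of the integral operator. -/

/-- The `m`-th derivative at a point of the disc, as a linear functional on `H(𝔻)`. -/
def HolDisc.derivAt (m : ℕ) {z : ℂ} (hz : z ∈ disc) : HolDisc →ₗ[ℂ] ℂ where
  toFun f := iteratedDeriv m (f : ℂ → ℂ) z
  map_add' f g := HolDisc.iteratedDeriv_add m f g hz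
  map_smul' c f := HolDisc.iteratedDeriv_smul m c f hz

theorem HolDisc.derivAt_apply (m : ℕ) {z : ℂ} (hz : z ∈ disc) (f : HolDisc) :
    HolDisc.derivAt m hz f = iteratedDeriv m (f : ℂ → ℂ) z := rfl

theorem enorm_derivAt_two_le_zygmundNorm (μ : ℂ → ℝ) (f : HolDisc) {z : ℂ} (hz : z ∈ disc) :
    ENNReal.ofReal (μ ((‖z‖ : ℝ) : ℂ)) * ‖HolDisc.derivAt 2 hz f‖ₑ ≤ zygmundNorm μ f := by
  rw [HolDisc.derivAt_apply, ← deriv_deriv_eq]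
  refine le_trans ?_ le_add_self
  exact le_iSup₂ (f := fun z (_ : z ∈ disc) =>
    ENNReal.ofReal (μ ((‖z‖ : ℝ) : ℂ)) * ‖deriv (deriv (f : ℂ → ℂ)) z‖ₑ) z hz

theorem zygmundNorm_smul (μ : ℂ → ℝ) (c : ℂ) (f : HolDisc) :
    zygmundNorm μ ((c • f : HolDisc) : ℂ → ℂ) = ‖c‖ₑ * zygmundNorm μ f := by
  have h2 : ∀ z ∈ disc, deriv (deriv ((c • f : HolDisc) : ℂ → ℂ)) z =
      c * deriv (deriv (f : ℂ → ℂ)) z := fun z hz => by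
    simp only [deriv_deriv_eq]
    exact HolDisc.iteratedDeriv_smul 2 c f hz
  have h1 : deriv ((c • f : HolDisc) : ℂ → ℂ) 0 = c * deriv (f : ℂ → ℂ) 0 := by
    have := HolDisc.iteratedDeriv_smul 1 c f zero_mem_disc
    rwa [iteratedDeriv_one, iteratedDeriv_one] at this
  have h0 : ((c • f : HolDisc) : ℂ → ℂ) 0 = c * (f : ℂ → ℂ) 0 := rfl
  unfold zygmundNorm
  rw [h0, h1, enorm_mul, enorm_mul, mul_add, mul_add, ENNReal.mul_iSup]
  congr 1
  refine iSup_congr fun z => ?_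
  rw [ENNReal.mul_iSup]
  refine iSup_congr fun hz => ?_
  rw [h2 z hz, enorm_mul, mul_left_comm]

theorem hasDerivAt_discPrimitive {h : ℂ → ℂ} (hh : DifferentiableOn ℂ h disc) {z : ℂ}
    (hz : z ∈ disc) : HasDerivAt (discPrimitive h) (h z) z := by
  obtain ⟨H, hH⟩ := hh.isExactOn_ball
  have heq : EqOn (discPrimitive h) (fun z => H z - H 0) disc := by
    intro z hz
    simp only [discPrimitive, indicator_of_mem hz]
    have := intervalIntegral.integral_eq_sub_of_hasDerivAt (a := (0 : ℝ)) (b := 1)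
      (f := fun t : ℝ => H (t * z)) (f' := fun t : ℝ => z * h (t * z)) ?_
      (discPrimitive_intervalIntegrable hh.continuousOn hz)
    · simpa using this
    · intro t ht
      rw [uIcc_of_le zero_le_one] at ht
      have h1 := hH _ (ofReal_mul_mem_disc hz ht)
      have h2 : HasDerivAt (fun t : ℝ => (t : ℂ) * z) z t := by
        simpa using (Complex.ofRealCLM.hasDerivAt (x := t)).mul_const z
      simpa [mul_comm, Function.comp_def] using h1.comp t h2
  exact ((hH z hz).sub_const _).congr_of_eventuallyEq
    (eventually_of_mem (isOpen_disc.mem_nhds hz) heq)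

theorem discPrimitive_zero (h : ℂ → ℂ) : discPrimitive h 0 = 0 := by
  simp [discPrimitive, zero_mem_disc]

section Operator

variable {n : ℕ} {ϕ g : ℂ → ℂ} (hϕ : DifferentiableOn ℂ ϕ disc) (hmap : MapsTo ϕ disc disc)
  (hg : DifferentiableOn ℂ g disc)

theorem genIntOp_apply_zero (f : HolDisc) :
    (genIntOp n ϕ g hϕ hmap hg f : ℂ → ℂ) 0 = 0 :=
  discPrimitive_zero fun ξ => iteratedDeriv n (f : ℂ → ℂ) (ϕ ξ) * g ξ

theorem deriv_genIntOp (f : HolDisc) {z : ℂ} (hz : z ∈ disc) :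
    deriv (genIntOp n ϕ g hϕ hmap hg f : ℂ → ℂ) z = iteratedDeriv n (f : ℂ → ℂ) (ϕ z) * g z :=
  (hasDerivAt_discPrimitive (differentiableOn_symbol n hϕ hmap hg f) hz).deriv

/-- The two terms are the sources of `A` and `B`: a function whose derivative of order `n` or `n +
1` vanishes at `ϕ z` isolates the other term. -/
theorem derivAt_two_genIntOp (f : HolDisc) {z : ℂ} (hz : z ∈ disc) :
    HolDisc.derivAt 2 hz (genIntOp n ϕ g hϕ hmap hg f) =
      iteratedDeriv (n + 1) (f : ℂ → ℂ) (ϕ z) * (deriv ϕ z * g z) +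
        iteratedDeriv n (f : ℂ → ℂ) (ϕ z) * deriv g z := by
  have hev : deriv (genIntOp n ϕ g hϕ hmap hg f : ℂ → ℂ) =ᶠ[𝓝 z] fun z =>
      iteratedDeriv n (f : ℂ → ℂ) (ϕ z) * g z :=
    eventually_of_mem (isOpen_disc.mem_nhds hz) fun x hx => deriv_genIntOp hϕ hmap hg f hx
  rw [HolDisc.derivAt_apply, ← deriv_deriv_eq, hev.deriv_eq]
  have hd : HasDerivAt (iteratedDeriv n (f : ℂ → ℂ)) (iteratedDeriv (n + 1) (f : ℂ → ℂ) (ϕ z))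
      (ϕ z) := by
    have h := (HolDisc.analyticAt f (hmap hz)).iterated_deriv n
    rw [← iteratedDeriv_eq_iterate] at h
    rw [iteratedDeriv_succ]
    exact h.differentiableAt.hasDerivAt
  have hϕd := (hϕ.differentiableAt (isOpen_disc.mem_nhds hz)).hasDerivAt
  have hgd := (hg.differentiableAt (isOpen_disc.mem_nhds hz)).hasDerivAt
  have := (hd.comp z hϕd).mul hgd
  rw [show (fun z => iteratedDeriv n (f : ℂ → ℂ) (ϕ z) * g z) =
    (iteratedDeriv n (f : ℂ → ℂ) ∘ ϕ) * g from rfl, this.deriv]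
  simp only [Function.comp_apply]
  ring

end Operator

/-! ### Abstract bounds for the essential norm. -/

section Operators

variable {X Y : Type} [AddCommGroup X] [Module ℂ X] [AddCommGroup Y] [Module ℂ Y]
  {NX : X → ℝ≥0∞} {NY : Y → ℝ≥0∞}

/-- A linear map is controlled on all balls by its operator norm. -/
theorem le_opNormOf (hNX : ∀ (c : ℂ) x, NX (c • x) = ‖c‖ₑ * NX x)
    (hNY : ∀ (c : ℂ) y, NY (c • y) = ‖c‖ₑ * NY y) (T : X →ₗ[ℂ] Y) {M : ℝ} (hM : 0 < M) {x : X}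
    (hx : NX x ≤ ENNReal.ofReal M) : NY (T x) ≤ ENNReal.ofReal M * opNormOf NX NY T := by
  have hM' : (M : ℂ) ≠ 0 := by exact_mod_cast hM.ne'
  set y : X := ((M⁻¹ : ℝ) : ℂ) • x with hy
  have hxy : x = (M : ℂ) • y := by
    rw [hy, smul_smul, Complex.ofReal_inv, mul_inv_cancel₀ hM', one_smul]
  have hy1 : NX y ≤ 1 := by
    rw [hy, hNX, ← ofReal_norm, Complex.norm_real, Real.norm_of_nonneg (by positivity)]
    refine (mul_le_mul_right hx _).trans (le_of_eq ?_)
    rw [← ENNReal.ofReal_mul (by positivity), inv_mul_cancel₀ hM.ne', ENNReal.ofReal_one]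
  rw [hxy, map_smul, hNY, ← ofReal_norm, Complex.norm_real, Real.norm_of_nonneg hM.le]
  gcongr
  exact le_iSup₂ (f := fun (x : X) (_ : NX x ≤ 1) => NY (T x)) y hy1

/-- A lower bound for the essential norm from a bounded sequence `f` and seminorms `W k` that
detect `T (f k)` but not `T (f l)` for large `l`. -/
theorem le_essNormOf (hNX : ∀ (c : ℂ) x, NX (c • x) = ‖c‖ₑ * NX x)
    (hNY : ∀ (c : ℂ) y, NY (c • y) = ‖c‖ₑ * NY y) {K : ℝ} (hK : 0 < K)
    (hadd : ∀ x y, NX (x + y) ≤ ENNReal.ofReal K * (NX x + NX y)) (T : X →ₗ[ℂ] Y)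
    {W : ℕ → Y → ℝ≥0∞} (hWadd : ∀ k x y, W k (x + y) ≤ W k x + W k y)
    (hWsub : ∀ k x y, W k (x - y) ≤ W k x + W k y)
    (hW : ∀ k y, W k y ≤ NY y) {f : ℕ → X} {C : ℝ} (hC : 0 < C)
    (hf : ∀ k, NX (f k) ≤ ENNReal.ofReal C)
    (hdecay : ∀ k, Tendsto (fun l => W k (T (f l))) atTop (𝓝 0)) {b : ℝ≥0∞}
    (hb : ∀ k, b ≤ W k (T (f k))) :
    ENNReal.ofReal (K * (C + C))⁻¹ * b ≤ essNormOf NX NY T := by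
  set M : ℝ := K * (C + C) with hM
  have hM0 : 0 < M := by positivity
  refine le_iInf₂ fun S hS => ?_
  set E := opNormOf NX NY (T - S) with hE
  suffices h : b ≤ ENNReal.ofReal M * E by
    calc _ ≤ ENNReal.ofReal M⁻¹ * (ENNReal.ofReal M * E) := by gcongr
      _ = E := by
        rw [← mul_assoc, ← ENNReal.ofReal_mul (by positivity), inv_mul_cancel₀ hM0.ne',
          ENNReal.ofReal_one, one_mul]
  obtain ⟨y, σ, hσ, hy⟩ := hS f ⟨C.toNNReal, hf⟩
  have hdiff : ∀ k l, NX (f k - f l) ≤ ENNReal.ofReal M := fun k l => by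
    rw [sub_eq_add_neg, ← neg_one_smul ℂ (f l)]
    refine (hadd _ _).trans ?_
    rw [hNX, enorm_neg, enorm_one, one_mul, hM, ENNReal.ofReal_mul hK.le,
      ENNReal.ofReal_add hC.le hC.le]
    gcongr
    exacts [hf k, hf l]
  have hsplit : ∀ k l, b ≤ ENNReal.ofReal M * E +
      W (σ k) (T (f (σ l))) + NY (S (f (σ k)) - y) + NY (S (f (σ l)) - y) := fun k l => by
    -- Compactness only provides some limit `y` of `S (f (σ k))`, not the limit `0`; in the
    -- difference of two members of the sequence `y` cancels.
    have e1 : T (f (σ k)) = (T - S) (f (σ k) - f (σ l)) + T (f (σ l)) + (S (f (σ k)) - y) -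
        (S (f (σ l)) - y) := by
      simp only [map_sub, LinearMap.sub_apply]
      abel
    refine (hb (σ k)).trans ?_
    rw [e1]
    refine (hWsub _ _ _).trans (add_le_add ((hWadd _ _ _).trans (add_le_add
      ((hWadd _ _ _).trans (add_le_add ?_ le_rfl)) (hW _ _))) (hW _ _))
    exact (hW _ _).trans (le_opNormOf hNX hNY (T - S) hM0 (hdiff _ _))
  -- The limit in `l` comes before the one in `k`, since the decay of `W (σ k) (T (f (σ l)))` is
  -- known only for fixed `k`.
  have hk : ∀ k, b ≤ ENNReal.ofReal M * E + NY (S (f (σ k)) - y) := fun k => by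
    have hlim : Tendsto (fun l => ENNReal.ofReal M * E + W (σ k) (T (f (σ l))) +
        NY (S (f (σ k)) - y) + NY (S (f (σ l)) - y)) atTop
        (𝓝 (ENNReal.ofReal M * E + 0 + NY (S (f (σ k)) - y) + 0)) :=
      ((tendsto_const_nhds.add ((hdecay (σ k)).comp hσ.tendsto_atTop)).add
        tendsto_const_nhds).add hy
    rw [add_zero, add_zero] at hlim
    exact ge_of_tendsto' hlim fun l => hsplit k l
  have hlim2 : Tendsto (fun k => ENNReal.ofReal M * E + NY (S (f (σ k)) - y)) atTop
      (𝓝 (ENNReal.ofReal M * E + 0)) := tendsto_const_nhds.add hy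
  rw [add_zero] at hlim2
  exact ge_of_tendsto' hlim2 hk

/-- If `T` is bounded and `D` is compact, then the essential norm of `T` is at most the norm of
`T - T ∘ D`. -/
theorem essNormOf_le {T : X →ₗ[ℂ] Y} (hT : IsBoundedOp NX NY T) {D : X →ₗ[ℂ] X}
    (hD : IsCompactOp NX NX D) {b : ℝ≥0∞} (hb : ∀ x, NX x ≤ 1 → NY (T (x - D x)) ≤ b) :
    essNormOf NX NY T ≤ b := by
  obtain ⟨K, hK⟩ := hT
  have hc : IsCompactOp NX NY (T ∘ₗ D) := fun x hx => by
    obtain ⟨y, σ, hσ, hy⟩ := hD x hx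
    refine ⟨T y, σ, hσ, ?_⟩
    have h0 : Tendsto (fun k => K * NX (D (x (σ k)) - y)) atTop (𝓝 0) := by
      simpa using ENNReal.Tendsto.const_mul hy (Or.inr ENNReal.coe_ne_top)
    refine tendsto_of_tendsto_of_tendsto_of_le_of_le tendsto_const_nhds h0
      (fun _ => zero_le) fun k => ?_
    simp only [LinearMap.comp_apply, ← map_sub]
    exact hK _
  refine (iInf₂_le (T ∘ₗ D) hc).trans (iSup₂_le fun x hx => ?_)
  rw [LinearMap.sub_apply, LinearMap.comp_apply, ← map_sub]
  exact hb x hx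

end Operators

/-! ### The lower estimate. -/

theorem mixedNormOn_smul {p q : ℝ} {hp : 0 < p} {hq : 0 < q} {φ : ℝ → ℝ} {hφ : IsNormal φ}
    (c : ℂ) (f : mixedNormSpace p q hp hq φ hφ) :
    mixedNormOn (c • f) = ‖c‖ₑ * mixedNormOn f := mixedNorm_smul hp hq φ c (f : HolDisc)

theorem zygmundNormOn_smul {μ : ℂ → ℝ} (c : ℂ) (h : zygmundSpace μ) :
    zygmundNormOn (c • h) = ‖c‖ₑ * zygmundNormOn h := zygmundNorm_smul μ c h

/-- The lower estimate of the essential norm by one of the boundary limits superior. -/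
theorem exists_mul_limsupToBoundary_le {p q : ℝ} (hp : 0 < p) (hq : 0 < q) {φ : ℝ → ℝ}
    (hφ : IsNormal φ) {i j : ℕ} (hij : i ≠ j) :
    ∃ c : ℝ, 0 < c ∧ ∀ (n : ℕ) (ϕ g u : ℂ → ℂ) (hϕ : DifferentiableOn ℂ ϕ disc)
      (hmap : MapsTo ϕ disc disc) (hg : DifferentiableOn ℂ g disc) (μ : ℂ → ℝ)
      (hinto : ∀ f ∈ mixedNormSpace p q hp hq φ hφ,
        genIntOp n ϕ g hϕ hmap hg f ∈ zygmundSpace μ),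
      (∀ (f : HolDisc) (z : ℂ) (hz : z ∈ disc), iteratedDeriv j (f : ℂ → ℂ) (ϕ z) = 0 →
        HolDisc.derivAt 2 hz (genIntOp n ϕ g hϕ hmap hg f) =
          iteratedDeriv i (f : ℂ → ℂ) (ϕ z) * u z) →
      ENNReal.ofReal c * limsupToBoundary ϕ (fun z => μ ((‖z‖ : ℝ) : ℂ) * ‖u z‖ /
        (φ ‖ϕ z‖ * (1 - ‖ϕ z‖ ^ 2) ^ (1 / q + i))) ≤
      essNormOf mixedNormOn zygmundNormOn ((genIntOp n ϕ g hϕ hmap hg).restrict hinto) := by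
  obtain ⟨C, F, hC, hF⟩ := exists_test_functions hp hq hφ hij
  obtain ⟨K, hK, hadd⟩ := exists_mixedNorm_add_le hp hq hφ
  have hpos := hφ.2.1
  -- The first factor is the loss in `le_essNormOf`; the second bounds the factor `‖w‖ ^ i` of the
  -- test functions from below, once `‖w‖ ≥ 1 / 2`.
  refine ⟨(K * (C + C))⁻¹ * (1 / 2) ^ i, by positivity,
    fun n ϕ g u hϕ hmap hg μ hinto hval => ?_⟩
  -- Every `a` below the limit superior is exceeded frequently. If `sup |ϕ| < 1` the filter is
  -- trivial, the limit superior is `0` and there is no such `a`, so that case needs no separate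
  -- argument.
  refine ENNReal.mul_le_of_forall_lt fun a' ha' a ha => ?_
  refine (mul_le_mul_left ha'.le _).trans ?_
  rw [ENNReal.ofReal_mul (by positivity), mul_assoc]
  have hfreq := frequently_lt_of_lt_limsup (by isBoundedDefault) ha
  have hev1 : ∀ᶠ z in comap (fun z => ‖ϕ z‖) (𝓝[<] 1) ⊓ 𝓟 disc, z ∈ disc :=
    mem_inf_of_right (mem_principal_self _)
  have hlimϕ : Tendsto (fun z => ‖ϕ z‖) (comap (fun z => ‖ϕ z‖) (𝓝[<] 1) ⊓ 𝓟 disc) (𝓝 1) :=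
    (tendsto_comap.mono_left inf_le_left).mono_right nhdsWithin_le_nhds
  have hev2 : ∀ᶠ z in comap (fun z => ‖ϕ z‖) (𝓝[<] 1) ⊓ 𝓟 disc, 1 / 2 ≤ ‖ϕ z‖ :=
    hlimϕ.eventually (le_mem_nhds (by norm_num))
  obtain ⟨z, hz, hzp⟩ := exists_seq_forall_of_frequently (hfreq.and_eventually (hev1.and hev2))
  have hzd : ∀ k, z k ∈ disc := fun k => (hzp k).2.1
  have hwd : ∀ k, ϕ (z k) ∈ disc := fun k => hmap (hzd k)
  have hwlim : Tendsto (fun k => ‖ϕ (z k)‖) atTop (𝓝 1) := hlimϕ.comp hz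
  set f : ℕ → mixedNormSpace p q hp hq φ hφ := fun k =>
    ⟨F (ϕ (z k)), (hF _ (hwd k)).1.trans_lt ENNReal.ofReal_lt_top⟩ with hf
  -- `W k` is the weighted second derivative at the single point `z k`, a seminorm dominated by the
  -- Zygmund norm.
  refine le_essNormOf (f := f) (W := fun k (h : zygmundSpace μ) =>
    ENNReal.ofReal (μ ((‖z k‖ : ℝ) : ℂ)) * ‖HolDisc.derivAt 2 (hzd k) (h : HolDisc)‖ₑ)
    ?_ ?_ hK ?_ _ ?_ ?_ ?_ hC ?_ ?_ ?_
  · exact mixedNormOn_smul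
  · exact zygmundNormOn_smul
  · exact fun x y => hadd x y
  · intro k x y
    rw [← mul_add, Submodule.coe_add, map_add]
    gcongr
    exact enorm_add_le _ _
  · intro k x y
    rw [← mul_add, Submodule.coe_sub, map_sub]
    gcongr
    exact enorm_sub_le
  · exact fun k y => enorm_derivAt_two_le_zygmundNorm μ (y : HolDisc) (hzd k)
  · exact fun k => (hF _ (hwd k)).1
  · intro k
    have hd : ∀ m, Tendsto (fun l => iteratedDeriv m (F (ϕ (z l)) : ℂ → ℂ) (ϕ (z k)))
        atTop (𝓝 0) := fun m =>
      (hF _ (hwd k)).2.2.2 m _ (hwd k) ℕ atTop (fun l => ϕ (z l)) (fun l => hwd l) hwlim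
    have h1 : Tendsto (fun l => HolDisc.derivAt 2 (hzd k)
        (genIntOp n ϕ g hϕ hmap hg (F (ϕ (z l))))) atTop (𝓝 0) := by
      simp only [derivAt_two_genIntOp hϕ hmap hg]
      simpa using ((hd (n + 1)).mul_const (deriv ϕ (z k) * g (z k))).add
        ((hd n).mul_const (deriv g (z k)))
    have h2 := h1.enorm
    rw [enorm_zero] at h2
    simpa using ENNReal.Tendsto.const_mul (a := ENNReal.ofReal (μ ((‖z k‖ : ℝ) : ℂ))) h2
      (Or.inr ENNReal.ofReal_ne_top)
  · intro k
    obtain ⟨hlt, -, hhalf⟩ := hzp k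
    obtain ⟨-, e1, e2, -⟩ := hF _ (hwd k)
    have hn1 : ‖ϕ (z k)‖ < 1 := by
      have := hwd k
      rwa [disc, mem_ball_zero_iff] at this
    have hφw := hpos _ ⟨norm_nonneg _, hn1⟩
    have hs : 0 < 1 - ‖ϕ (z k)‖ ^ 2 := by nlinarith [norm_nonneg (ϕ (z k))]
    have hv : HolDisc.derivAt 2 (hzd k)
        (((genIntOp n ϕ g hϕ hmap hg).restrict hinto (f k) : zygmundSpace μ) : HolDisc) =
        iteratedDeriv i (F (ϕ (z k)) : ℂ → ℂ) (ϕ (z k)) * u (z k) := hval _ _ (hzd k) e1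
    simp only [hv]
    rw [← ofReal_norm, norm_mul, e2, ← ENNReal.ofReal_mul' (by positivity)]
    refine (mul_le_mul_right hlt.le _).trans ?_
    rw [← ENNReal.ofReal_mul (by positivity)]
    by_cases hμ : 0 ≤ μ ((‖z k‖ : ℝ) : ℂ)
    · refine ENNReal.ofReal_le_ofReal ?_
      calc _ ≤ ‖ϕ (z k)‖ ^ i * (μ ((‖z k‖ : ℝ) : ℂ) * ‖u (z k)‖ /
            (φ ‖ϕ (z k)‖ * (1 - ‖ϕ (z k)‖ ^ 2) ^ (1 / q + i))) := by gcongr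
        _ = _ := by ring
    · rw [ENNReal.ofReal_of_nonpos]
      · exact zero_le
      · have : μ ((‖z k‖ : ℝ) : ℂ) * ‖u (z k)‖ ≤ 0 :=
          mul_nonpos_of_nonpos_of_nonneg (not_le.1 hμ).le (norm_nonneg _)
        exact mul_nonpos_of_nonneg_of_nonpos (by positivity)
          (div_nonpos_of_nonpos_of_nonneg this (by positivity))

/-! ### Dilations: approximation of the identity and compactness. -/

/-- The dilation `f ↦ f(r ·)` of analytic functions on the disc. -/
def HolDisc.dilation {r : ℝ} (hr : r ∈ Icc (0 : ℝ) 1) : HolDisc →ₗ[ℂ] HolDisc where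
  toFun f := HolDisc.mk (fun z => (f : ℂ → ℂ) (r * z))
    (f.2.1.comp (by fun_prop) fun _ hz => ofReal_mul_mem_disc hz hr)
  map_add' f g := by
    apply Subtype.ext
    funext z
    by_cases hz : z ∈ disc <;> simp [HolDisc.mk, hz]
  map_smul' c f := by
    apply Subtype.ext
    funext z
    by_cases hz : z ∈ disc <;> simp [HolDisc.mk, hz]

theorem HolDisc.dilation_apply {r : ℝ} (hr : r ∈ Icc (0 : ℝ) 1) (f : HolDisc) {z : ℂ}
    (hz : z ∈ disc) : (HolDisc.dilation hr f : ℂ → ℂ) z = (f : ℂ → ℂ) (r * z) :=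
  HolDisc.mk_apply (f := fun z => (f : ℂ → ℂ) (r * z))
    (f.2.1.comp (by fun_prop) fun _ hz => ofReal_mul_mem_disc hz hr) hz

theorem HolDisc.hasDerivAt_iteratedDeriv (f : HolDisc) (m : ℕ) {z : ℂ} (hz : z ∈ disc) :
    HasDerivAt (iteratedDeriv m (f : ℂ → ℂ)) (iteratedDeriv (m + 1) (f : ℂ → ℂ) z) z := by
  have h := (HolDisc.analyticAt f hz).iterated_deriv m
  rw [← iteratedDeriv_eq_iterate] at h
  rw [iteratedDeriv_succ]
  exact h.differentiableAt.hasDerivAt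

theorem HolDisc.iteratedDeriv_dilation {r : ℝ} (hr : r ∈ Icc (0 : ℝ) 1) (f : HolDisc) (m : ℕ)
    {z : ℂ} (hz : z ∈ disc) : iteratedDeriv m (HolDisc.dilation hr f : ℂ → ℂ) z =
      (r : ℂ) ^ m * iteratedDeriv m (f : ℂ → ℂ) (r * z) := by
  induction m generalizing z with
  | zero => simpa using HolDisc.dilation_apply hr f hz
  | succ m ih =>
    have hev : iteratedDeriv m (HolDisc.dilation hr f : ℂ → ℂ) =ᶠ[𝓝 z] fun z =>
        (r : ℂ) ^ m * iteratedDeriv m (f : ℂ → ℂ) (r * z) :=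
      eventually_of_mem (isOpen_disc.mem_nhds hz) fun x hx => ih hx
    rw [iteratedDeriv_succ, hev.deriv_eq]
    have h1 := HolDisc.hasDerivAt_iteratedDeriv f m (ofReal_mul_mem_disc hz hr)
    have h2 : HasDerivAt (fun z : ℂ => (r : ℂ) * z) r z := by
      simpa using (hasDerivAt_id z).const_mul (r : ℂ)
    have h3 := (h1.comp z h2).const_mul ((r : ℂ) ^ m)
    refine h3.deriv.trans ?_
    ring

theorem IsNormal.mul_one_sub_rpow_le {φ : ℝ → ℝ} (hφ : IsNormal φ) {e s t : ℝ} (he : 0 ≤ e)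
    (hs : 0 ≤ s) (hst : s ≤ t) (ht : t < 1) : φ t * (1 - t) ^ e ≤ φ s * (1 - s) ^ e := by
  have h1 := hφ.antitoneOn ⟨hs, hst.trans_lt ht⟩ ⟨hs.trans hst, ht⟩ hst
  have h2 : (1 - t) ^ e ≤ (1 - s) ^ e := Real.rpow_le_rpow (by linarith) (by linarith) he
  exact mul_le_mul h1 h2 (Real.rpow_nonneg (by linarith) _)
    (hφ.2.1 s ⟨hs, hst.trans_lt ht⟩).le

/-- Derivatives of `f(r·)` at `w` are evaluated at `r w`, where the growth bound is no worse than at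
`w`. This makes `C` independent of `r` without estimating the dilation in the mixed norm. -/
theorem exists_norm_iteratedDeriv_sub_dilation_le {p q : ℝ} (hp : 0 < p) (hq : 0 < q) {φ : ℝ → ℝ}
    (hφ : IsNormal φ) (m : ℕ) :
    ∃ C : ℝ, 0 < C ∧ ∀ (r : ℝ) (hr : r ∈ Icc (0 : ℝ) 1) (f : HolDisc), mixedNorm p q φ f ≤ 1 →
      ∀ w ∈ disc, ‖iteratedDeriv m ((f - HolDisc.dilation hr f : HolDisc) : ℂ → ℂ) w‖ ≤
        C / (φ ‖w‖ * (1 - ‖w‖) ^ (1 / q + m)) := by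
  obtain ⟨C, hC, h⟩ := exists_norm_iteratedDeriv_le hp hq hφ m
  refine ⟨2 * C, by positivity, fun r hr f hf w hw => ?_⟩
  have hw1 : ‖w‖ < 1 := mem_ball_zero_iff.1 hw
  have hw2 : 0 < 1 - ‖w‖ := by linarith
  have hφw := hφ.2.1 ‖w‖ ⟨norm_nonneg _, hw1⟩
  have he : 0 ≤ 1 / q + m := by positivity
  have hrw := ofReal_mul_mem_disc hw hr
  have hn : ‖(r : ℂ) * w‖ ≤ ‖w‖ := by
    rw [norm_mul, Complex.norm_real, Real.norm_of_nonneg hr.1]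
    exact mul_le_of_le_one_left (norm_nonneg _) hr.2
  have e0 : iteratedDeriv m ((f - HolDisc.dilation hr f : HolDisc) : ℂ → ℂ) w =
      iteratedDeriv m (f : ℂ → ℂ) w - (r : ℂ) ^ m * iteratedDeriv m (f : ℂ → ℂ) (r * w) := by
    rw [← HolDisc.iteratedDeriv_dilation hr f m hw]
    exact map_sub (HolDisc.derivAt m hw) f (HolDisc.dilation hr f)
  have h1 := h f 1 zero_le_one (by simpa using hf) w hw
  have h2 := h f 1 zero_le_one (by simpa using hf) _ hrw
  have h3 := hφ.mul_one_sub_rpow_le he (norm_nonneg _) hn hw1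
  have h4 : C * (1 / (φ ‖(r : ℂ) * w‖ * (1 - ‖(r : ℂ) * w‖) ^ (1 / q + m))) ≤
      C * (1 / (φ ‖w‖ * (1 - ‖w‖) ^ (1 / q + m))) := by gcongr
  have h5 : ‖(r : ℂ) ^ m * iteratedDeriv m (f : ℂ → ℂ) (r * w)‖ ≤
      ‖iteratedDeriv m (f : ℂ → ℂ) (r * w)‖ := by
    rw [norm_mul, norm_pow, Complex.norm_real, Real.norm_of_nonneg hr.1]
    exact mul_le_of_le_one_left (norm_nonneg _) (pow_le_one₀ hr.1 hr.2)
  rw [e0]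
  calc _ ≤ _ := norm_sub_le _ _
    _ ≤ C * (1 / (φ ‖w‖ * (1 - ‖w‖) ^ (1 / q + m))) +
        C * (1 / (φ ‖w‖ * (1 - ‖w‖) ^ (1 / q + m))) := add_le_add h1 (h5.trans (h2.trans h4))
    _ = _ := by ring

/-- On compact subsets of the disc, the dilations converge to the identity uniformly on the unit
ball of the mixed norm space. -/
theorem exists_norm_iteratedDeriv_sub_dilation_le_mul {p q : ℝ} (hp : 0 < p) (hq : 0 < q)
    {φ : ℝ → ℝ} (hφ : IsNormal φ) (m : ℕ) {δ : ℝ} (hδ0 : 0 ≤ δ) (hδ1 : δ < 1) :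
    ∃ L : ℝ, 0 ≤ L ∧ ∀ (r : ℝ) (hr : r ∈ Icc (0 : ℝ) 1) (f : HolDisc), mixedNorm p q φ f ≤ 1 →
      ∀ w : ℂ, ‖w‖ ≤ δ →
        ‖iteratedDeriv m ((f - HolDisc.dilation hr f : HolDisc) : ℂ → ℂ) w‖ ≤ L * (1 - r) := by
  obtain ⟨C, hC, h⟩ := exists_norm_iteratedDeriv_le hp hq hφ 1
  -- Since `t = δ + R`, the mean value inequality on `‖z‖ ≤ t` gives `|f(z) - f(rz)| = O(1 - r)`,
  -- and Cauchy's estimate on discs of radius `R` passes this to derivatives on `‖w‖ ≤ δ`.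
  set t : ℝ := (1 + δ) / 2 with ht
  have ht0 : 0 ≤ t := by positivity
  have ht1 : t < 1 := by rw [ht]; linarith
  have ht2 : 0 < 1 - t := by linarith
  have hφt := hφ.2.1 t ⟨ht0, ht1⟩
  set R : ℝ := (1 - δ) / 2 with hR
  have hR0 : 0 < R := by rw [hR]; linarith
  set B : ℝ := C * (1 / (φ t * (1 - t) ^ (1 / q + (1 : ℕ)))) with hB
  have hB0 : 0 < B := by positivity
  refine ⟨m.factorial * B / R ^ m, by positivity, fun r hr f hf w hw => ?_⟩
  have hdisc : ∀ z : ℂ, ‖z‖ ≤ t → z ∈ disc := fun z hz => mem_ball_zero_iff.2 (hz.trans_lt ht1)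
  have hr1 : 0 ≤ 1 - r := by linarith [hr.2]
  have hder : ∀ z : ℂ, ‖z‖ ≤ t → ‖deriv (f : ℂ → ℂ) z‖ ≤ B := fun z hz => by
    have h1 := h f 1 zero_le_one (by simpa using hf) z (hdisc z hz)
    have hz1 : ‖z‖ < 1 := hz.trans_lt ht1
    have h3 := hφ.mul_one_sub_rpow_le (e := 1 / q + (1 : ℕ)) (by positivity) (norm_nonneg z) hz ht1
    rw [iteratedDeriv_one] at h1
    refine h1.trans ?_
    rw [hB]
    gcongr
  have hdiff : ∀ z : ℂ, ‖z‖ ≤ t →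
      ‖((f - HolDisc.dilation hr f : HolDisc) : ℂ → ℂ) z‖ ≤ B * (1 - r) := fun z hz => by
    have hrz : ‖(r : ℂ) * z‖ ≤ t := by
      rw [norm_mul, Complex.norm_real, Real.norm_of_nonneg hr.1]
      exact (mul_le_of_le_one_left (norm_nonneg _) hr.2).trans hz
    have e0 : ((f - HolDisc.dilation hr f : HolDisc) : ℂ → ℂ) z =
        (f : ℂ → ℂ) z - (f : ℂ → ℂ) (r * z) := by
      rw [← HolDisc.dilation_apply hr f (hdisc z hz)]
      rfl
    have h1 := (convex_closedBall (0 : ℂ) t).norm_image_sub_le_of_norm_deriv_le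
      (f := (f : ℂ → ℂ)) (C := B) (x := r * z) (y := z)
      (fun x hx => HolDisc.differentiableAt f (hdisc x (mem_closedBall_zero_iff.1 hx)))
      (fun x hx => hder x (mem_closedBall_zero_iff.1 hx))
      (mem_closedBall_zero_iff.2 hrz) (mem_closedBall_zero_iff.2 hz)
    rw [e0]
    refine h1.trans ?_
    gcongr
    rw [show z - r * z = ((1 - r : ℝ) : ℂ) * z by push_cast; ring, norm_mul, Complex.norm_real,
      Real.norm_of_nonneg hr1]
    exact mul_le_of_le_one_right hr1 (hz.trans ht1.le)
  have hball : ∀ z ∈ Metric.closedBall w R, ‖z‖ ≤ t := fun z hz => by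
    have h1 : ‖z‖ ≤ ‖z - w‖ + ‖w‖ := by simpa using norm_add_le (z - w) w
    have h2 : ‖z - w‖ ≤ R := by simpa [dist_eq_norm] using hz
    linarith
  have hd : DiffContOnCl ℂ ((f - HolDisc.dilation hr f : HolDisc) : ℂ → ℂ) (Metric.ball w R) := by
    refine ((f - HolDisc.dilation hr f).2.1.mono ?_).diffContOnCl
    rw [closure_ball _ hR0.ne']
    exact fun z hz' => hdisc z (hball z hz')
  refine (Complex.norm_iteratedDeriv_le_of_forall_mem_sphere_norm_le (n := m)
    (C := B * (1 - r)) hR0 hd fun z hz =>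
      hdiff z (hball z (Metric.sphere_subset_closedBall hz))).trans (le_of_eq ?_)
  ring

theorem norm_ofReal_mul_le {r : ℝ} (hr : r ∈ Ico (0 : ℝ) 1) {z : ℂ} (hz : z ∈ disc) :
    ‖(r : ℂ) * z‖ ≤ r := by
  rw [norm_mul, Complex.norm_real, Real.norm_of_nonneg hr.1]
  exact mul_le_of_le_one_right hr.1 (mem_ball_zero_iff.1 hz).le

/-- By the growth bound on `‖z‖ ≤ r`, the dilated function is bounded, and bounded functions lie in
the space. -/
theorem HolDisc.dilation_mem {p q : ℝ} (hp : 0 < p) (hq : 0 < q) {φ : ℝ → ℝ} (hφ : IsNormal φ)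
    {r : ℝ} (hr : r ∈ Ico (0 : ℝ) 1) :
    ∀ f ∈ mixedNormSpace p q hp hq φ hφ,
      HolDisc.dilation (Ico_subset_Icc_self hr) f ∈ mixedNormSpace p q hp hq φ hφ := by
  intro f hf
  obtain ⟨K, -, hb⟩ := exists_mixedNorm_le_of_bounded hp hq hφ
  obtain ⟨C, hC, h⟩ := exists_norm_le hp hq hφ
  have hr2 : 0 < 1 - r := by linarith [hr.2]
  have hφr := hφ.2.1 r hr
  have hf' : mixedNorm p q φ f < ∞ := hf
  set M := (mixedNorm p q φ f).toReal with hM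
  have hM0 : 0 ≤ M := ENNReal.toReal_nonneg
  refine (hb _ (C * (M / (φ r * (1 - r) ^ (1 / q)))) (by positivity) fun z hz => ?_).trans_lt
    ENNReal.ofReal_lt_top
  rw [HolDisc.dilation_apply _ f hz]
  refine (h f M hM0 (ENNReal.ofReal_toReal hf'.ne).ge _
    (ofReal_mul_mem_disc hz (Ico_subset_Icc_self hr))).trans ?_
  have := hφ.mul_one_sub_rpow_le (e := 1 / q) (by positivity) (norm_nonneg _)
    (norm_ofReal_mul_le hr hz) hr.2
  gcongr

theorem HolDisc.hasSum_dilation {r : ℝ} (hr : r ∈ Icc (0 : ℝ) 1) (f : HolDisc) {z : ℂ}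
    (hz : z ∈ disc) :
    HasSum (fun j : ℕ => iteratedDeriv j (f : ℂ → ℂ) 0 / j.factorial * (r * z) ^ j)
      ((HolDisc.dilation hr f : ℂ → ℂ) z) := by
  rw [HolDisc.dilation_apply hr f hz]
  have h := Complex.hasSum_taylorSeries_on_ball (c := 0) (r := 1) (f := (f : ℂ → ℂ)) f.2.1
    (ofReal_mul_mem_disc hz hr)
  refine Eq.mp (congrArg (HasSum · _) (funext fun j => ?_)) h
  rw [sub_zero, smul_eq_mul, smul_eq_mul]
  ring

/-- Dilations by `r < 1` are compact on the mixed norm space. -/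
theorem isCompactOp_dilation {p q : ℝ} (hp : 0 < p) (hq : 0 < q) {φ : ℝ → ℝ} (hφ : IsNormal φ)
    {r : ℝ} (hr : r ∈ Ico (0 : ℝ) 1) :
    IsCompactOp mixedNormOn mixedNormOn ((HolDisc.dilation (Ico_subset_Icc_self hr)).restrict
      (HolDisc.dilation_mem hp hq hφ hr)) := by
  obtain ⟨K, hK, hb⟩ := exists_mixedNorm_le_of_bounded hp hq hφ
  obtain ⟨C, hC, h⟩ := exists_norm_le hp hq hφ
  rintro x ⟨M, hM⟩
  -- A radius strictly between `r` and `1`: Cauchy's estimates at radius `s` bound the `j`-th Taylor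
  -- coefficient by `B / s ^ j`, and dilation by `r` turns this into the summable `B (r / s) ^ j`.
  set s : ℝ := (1 + r) / 2 with hs
  have hs0 : 0 < s := by linarith [hr.1]
  have hs1 : s < 1 := by linarith [hr.2]
  have hrs : r / s < 1 := by rw [div_lt_one hs0]; linarith [hr.2]
  have hrs0 : 0 ≤ r / s := div_nonneg hr.1 hs0.le
  have hs2 : 0 < 1 - s := by linarith
  have hφs := hφ.2.1 s ⟨hs0.le, hs1⟩
  set B : ℝ := C * (M / (φ s * (1 - s) ^ (1 / q))) with hB
  have hB0 : 0 ≤ B := by positivity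
  set c : ℕ → ℕ → ℂ := fun k j => iteratedDeriv j ((x k : HolDisc) : ℂ → ℂ) 0 / j.factorial with hc
  have hcB : ∀ k j, ‖c k j‖ ≤ B / s ^ j := fun k j => by
    have hd : DiffContOnCl ℂ ((x k : HolDisc) : ℂ → ℂ) (Metric.ball 0 s) := by
      refine ((x k : HolDisc).2.1.mono ?_).diffContOnCl
      rw [closure_ball _ hs0.ne']
      exact Metric.closedBall_subset_ball hs1
    have h1 := Complex.norm_iteratedDeriv_le_of_forall_mem_sphere_norm_le j hs0 hd
      (C := B) fun z hz => by
        rw [mem_sphere_zero_iff_norm] at hz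
        have := h (x k) M M.2 (by simpa [mixedNormOn] using hM k) z
          (mem_ball_zero_iff.2 (hz ▸ hs1))
        rwa [hz] at this
    have hj : (0 : ℝ) < j.factorial := by exact_mod_cast j.factorial_pos
    simp only [hc]
    rw [norm_div, Complex.norm_natCast, div_le_iff₀ hj]
    exact h1.trans (le_of_eq (by ring))
  -- Coefficient sequences lie in a countable product of compact discs, so a subsequence converges
  -- coefficientwise; this replaces Montel's theorem.
  obtain ⟨d, hd, σ, hσ, hlim⟩ := (isCompact_univ_pi fun j : ℕ =>
    isCompact_closedBall (0 : ℂ) (B / s ^ j)).tendsto_subseq (x := c)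
    fun k j _ => mem_closedBall_zero_iff.2 (hcB k j)
  have hdB : ∀ j, ‖d j‖ ≤ B / s ^ j := fun j => mem_closedBall_zero_iff.1 (hd j (mem_univ j))
  have hgeom : Summable fun j : ℕ => B * (r / s) ^ j :=
    (summable_geometric_of_lt_one hrs0 hrs).mul_left B
  have hterm : ∀ (a : ℂ) (j : ℕ) (z : ℂ), z ∈ disc → ‖a * (r * z) ^ j‖ ≤ ‖a‖ * r ^ j :=
    fun a j z hz => by
      rw [norm_mul, norm_pow]
      have := norm_ofReal_mul_le hr hz
      gcongr
  have hterm' : ∀ (a : ℂ) (j : ℕ), ‖a‖ ≤ B / s ^ j → ‖a‖ * r ^ j ≤ B * (r / s) ^ j :=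
    fun a j ha => by
      have := mul_le_mul_of_nonneg_right ha (pow_nonneg hr.1 j)
      refine this.trans (le_of_eq ?_)
      rw [div_pow r s, mul_div_assoc', div_mul_eq_mul_div]
  have hF : ∀ (j : ℕ) (z : ℂ), z ∈ disc → ‖d j * (r * z) ^ j‖ ≤ B * (r / s) ^ j :=
    fun j z hz => (hterm _ j z hz).trans (hterm' _ j (hdB j))
  have hdiff : DifferentiableOn ℂ (fun z : ℂ => ∑' j : ℕ, d j * (r * z) ^ j) disc :=
    Complex.differentiableOn_tsum_of_summable_norm hgeom (fun j => by fun_prop) isOpen_disc hF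
  have hymem : HolDisc.mk _ hdiff ∈ mixedNormSpace p q hp hq φ hφ := by
    refine (hb _ (∑' j : ℕ, B * (r / s) ^ j) (tsum_nonneg fun j => by positivity)
      fun z hz => ?_).trans_lt ENNReal.ofReal_lt_top
    rw [HolDisc.mk_apply hdiff hz]
    exact tsum_of_norm_bounded hgeom.hasSum fun j => hF j z hz
  have hdom : ∀ k j, ‖c k j - d j‖ * r ^ j ≤ 2 * (B * (r / s) ^ j) := fun k j => by
    have h1 := hterm' _ j (hcB k j)
    have h2 := hterm' _ j (hdB j)
    have h3 := mul_le_mul_of_nonneg_right (norm_sub_le (c k j) (d j)) (pow_nonneg hr.1 j)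
    linarith
  -- Dominated convergence for series upgrades coefficientwise convergence to uniform convergence of
  -- the dilated functions on the disc, which controls the mixed norm.
  have hε : Tendsto (fun k => ∑' j : ℕ, ‖c (σ k) j - d j‖ * r ^ j) atTop (𝓝 0) := by
    have := tendsto_tsum_of_dominated_convergence (f := fun k j => ‖c (σ k) j - d j‖ * r ^ j)
      (g := fun _ : ℕ => (0 : ℝ)) (𝓕 := atTop) (hgeom.mul_left 2) (fun j => ?_)
      (Eventually.of_forall fun k j => ?_)
    · simpa using this
    · have h1 : Tendsto (fun k => c (σ k) j) atTop (𝓝 (d j)) := (tendsto_pi_nhds.1 hlim) j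
      have h2 := (h1.sub_const (d j)).norm.mul_const (r ^ j)
      simpa using h2
    · rw [Real.norm_of_nonneg (mul_nonneg (norm_nonneg _) (pow_nonneg hr.1 j))]
      exact hdom _ j
  refine ⟨⟨HolDisc.mk _ hdiff, hymem⟩, σ, hσ, ?_⟩
  have hle : ∀ k, mixedNormOn ((HolDisc.dilation (Ico_subset_Icc_self hr)).restrict
      (HolDisc.dilation_mem hp hq hφ hr) (x (σ k)) - ⟨HolDisc.mk _ hdiff, hymem⟩) ≤
      ENNReal.ofReal (K * ∑' j : ℕ, ‖c (σ k) j - d j‖ * r ^ j) := fun k => by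
    refine hb _ _ (tsum_nonneg fun j => mul_nonneg (norm_nonneg _) (pow_nonneg hr.1 j))
      fun z hz => ?_
    have h1 := HolDisc.hasSum_dilation (Ico_subset_Icc_self hr) (x (σ k) : HolDisc) hz
    have h2 : HasSum (fun j : ℕ => d j * (r * z) ^ j) ((HolDisc.mk _ hdiff : ℂ → ℂ) z) := by
      rw [HolDisc.mk_apply hdiff hz]
      exact (Summable.of_norm_bounded hgeom fun j => hF j z hz).hasSum
    have h3 := h1.sub h2
    have hs : Summable fun j : ℕ => ‖c (σ k) j - d j‖ * r ^ j :=
      Summable.of_nonneg_of_le (fun j => mul_nonneg (norm_nonneg _) (pow_nonneg hr.1 j))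
        (fun j => hdom _ j) (hgeom.mul_left 2)
    change ‖(HolDisc.dilation (Ico_subset_Icc_self hr) (x (σ k) : HolDisc) : ℂ → ℂ) z -
      (HolDisc.mk _ hdiff : ℂ → ℂ) z‖ ≤ _
    rw [← h3.tsum_eq]
    refine tsum_of_norm_bounded hs.hasSum fun j => ?_
    rw [← sub_mul]
    exact hterm _ j z hz
  have hz0 : Tendsto (fun k => ENNReal.ofReal (K * ∑' j : ℕ, ‖c (σ k) j - d j‖ * r ^ j))
      atTop (𝓝 0) := by
    simpa using ENNReal.tendsto_ofReal (hε.const_mul K)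
  exact tendsto_of_tendsto_of_tendsto_of_le_of_le tendsto_const_nhds hz0 (fun _ => zero_le) hle

/-! ### The upper estimate. -/

theorem ofReal_mul_enorm {a : ℝ} (ha : 0 ≤ a) (z : ℂ) :
    ENNReal.ofReal a * ‖z‖ₑ = ENNReal.ofReal (a * ‖z‖) := by
  rw [← ofReal_norm, ENNReal.ofReal_mul ha]

theorem IsWeight.pos_radial {μ : ℂ → ℝ} (hμ : IsWeight μ) {z : ℂ} (hz : z ∈ disc) :
    0 < μ ((‖z‖ : ℝ) : ℂ) := by
  refine hμ.2 _ (mem_ball_zero_iff.2 ?_)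
  rw [Complex.norm_real, norm_norm]
  exact mem_ball_zero_iff.1 hz

/-- If the integral operator maps the mixed norm space into the Zygmund space, testing it on
monomials bounds its symbol. -/
theorem exists_weight_mul_symbol_le {p q : ℝ} {hp : 0 < p} {hq : 0 < q} {φ : ℝ → ℝ}
    {hφ : IsNormal φ} {n : ℕ} {ϕ g : ℂ → ℂ} (hϕ : DifferentiableOn ℂ ϕ disc)
    (hmap : MapsTo ϕ disc disc) (hg : DifferentiableOn ℂ g disc) {μ : ℂ → ℝ} (hμ : IsWeight μ)
    (hinto : ∀ f ∈ mixedNormSpace p q hp hq φ hφ,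
      genIntOp n ϕ g hϕ hmap hg f ∈ zygmundSpace μ) :
    ∃ G : ℝ, 0 ≤ G ∧ ∀ z ∈ disc, μ ((‖z‖ : ℝ) : ℂ) * ‖deriv ϕ z * g z‖ ≤ G ∧
      μ ((‖z‖ : ℝ) : ℂ) * ‖deriv g z‖ ≤ G := by
  obtain ⟨K, -, hb⟩ := exists_mixedNorm_le_of_bounded hp hq hφ
  have hpow : ∀ k : ℕ, DifferentiableOn ℂ (fun z : ℂ => z ^ k) disc := fun k => by fun_prop
  have key : ∀ k : ℕ, ∃ G : ℝ, 0 ≤ G ∧ ∀ z (hz : z ∈ disc), μ ((‖z‖ : ℝ) : ℂ) *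
      ‖HolDisc.derivAt 2 hz (genIntOp n ϕ g hϕ hmap hg (HolDisc.mk _ (hpow k)))‖ ≤ G := fun k => by
    have hmem : HolDisc.mk _ (hpow k) ∈ mixedNormSpace p q hp hq φ hφ := by
      refine (hb _ 1 zero_le_one fun z hz => ?_).trans_lt ENNReal.ofReal_lt_top
      rw [HolDisc.mk_apply (hpow k) hz, norm_pow]
      exact pow_le_one₀ (norm_nonneg _) (mem_ball_zero_iff.1 hz).le
    set S : ℝ≥0∞ := ⨆ z ∈ disc, ENNReal.ofReal (μ ((‖z‖ : ℝ) : ℂ)) * ‖deriv (deriv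
      (genIntOp n ϕ g hϕ hmap hg (HolDisc.mk _ (hpow k)) : ℂ → ℂ)) z‖ₑ with hS
    have hlt : S < ∞ := hinto _ hmem
    refine ⟨S.toReal, ENNReal.toReal_nonneg, fun z hz => ?_⟩
    have h1 : ENNReal.ofReal (μ ((‖z‖ : ℝ) : ℂ)) * ‖deriv (deriv
      (genIntOp n ϕ g hϕ hmap hg (HolDisc.mk _ (hpow k)) : ℂ → ℂ)) z‖ₑ ≤ S :=
      le_iSup₂ (f := fun z (_ : z ∈ disc) => ENNReal.ofReal (μ ((‖z‖ : ℝ) : ℂ)) *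
        ‖deriv (deriv (genIntOp n ϕ g hϕ hmap hg (HolDisc.mk _ (hpow k)) : ℂ → ℂ)) z‖ₑ) z hz
    rw [ofReal_mul_enorm (hμ.pos_radial hz).le] at h1
    have h2 := (ENNReal.ofReal_le_iff_le_toReal hlt.ne).1 h1
    rw [HolDisc.derivAt_apply, ← deriv_deriv_eq]
    exact h2
  have hval : ∀ k m : ℕ, ∀ z ∈ disc, iteratedDeriv m (HolDisc.mk _ (hpow k) : ℂ → ℂ) z =
      k.descFactorial m * z ^ (k - m) := fun k m z hz => by
    rw [HolDisc.iteratedDeriv_mk (hpow k) m hz]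
    exact iteratedDeriv_pow k m
  -- For `z ^ n` the derivative of order `n + 1` vanishes, leaving `n! g'`. For `z ^ (n + 1)` the
  -- second derivative is `(n + 1)! (ϕ' g + ϕ g')`, from which `ϕ' g` is recovered using `|ϕ| ≤ 1`.
  obtain ⟨G₀, hG₀, h₀⟩ := key n
  obtain ⟨G₁, hG₁, h₁⟩ := key (n + 1)
  have hfac : ∀ k : ℕ, (1 : ℝ) ≤ k.factorial := fun k => by exact_mod_cast k.factorial_pos
  refine ⟨G₁ + (n + 1).factorial * G₀, by positivity, fun z hz => ?_⟩
  have hw := hmap hz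
  have hμz := hμ.pos_radial hz
  have e₀ := h₀ z hz
  have e₁ := h₁ z hz
  rw [derivAt_two_genIntOp, hval _ _ _ hw, hval _ _ _ hw,
    Nat.descFactorial_of_lt (Nat.lt_succ_self n), Nat.descFactorial_self, Nat.sub_self,
    Nat.cast_zero, zero_mul, zero_mul, zero_add, pow_zero, mul_one, norm_mul,
    Complex.norm_natCast] at e₀
  have hg0 : μ ((‖z‖ : ℝ) : ℂ) * ‖deriv g z‖ ≤ G₀ := by
    refine le_trans ?_ e₀
    gcongr
    exact le_mul_of_one_le_left (norm_nonneg _) (hfac n)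
  have hd : (n + 1).descFactorial n = (n + 1).factorial := by
    have := Nat.factorial_mul_descFactorial (Nat.le_succ n)
    simpa using this
  rw [derivAt_two_genIntOp, hval _ _ _ hw, hval _ _ _ hw, Nat.descFactorial_self, hd,
    Nat.sub_self, Nat.add_sub_cancel_left, pow_zero, mul_one, pow_one] at e₁
  have hw1 : ‖ϕ z‖ ≤ 1 := (mem_ball_zero_iff.1 hw).le
  set N : ℝ := ((n + 1).factorial : ℝ) with hN
  have hN1 : 1 ≤ N := hfac _
  have h3 : N * ‖deriv ϕ z * g z‖ ≤ ‖((n + 1).factorial : ℂ) * (deriv ϕ z * g z) +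
      (n + 1).factorial * ϕ z * deriv g z‖ + N * ‖deriv g z‖ := by
    have h4 := norm_sub_le (((n + 1).factorial : ℂ) * (deriv ϕ z * g z) +
      (n + 1).factorial * ϕ z * deriv g z) ((n + 1).factorial * ϕ z * deriv g z)
    rw [add_sub_cancel_right] at h4
    have h5 : ‖((n + 1).factorial : ℂ) * (deriv ϕ z * g z)‖ = N * ‖deriv ϕ z * g z‖ := by
      rw [norm_mul, Complex.norm_natCast]
    have h6 : ‖((n + 1).factorial : ℂ) * ϕ z * deriv g z‖ ≤ N * ‖deriv g z‖ := by
      rw [norm_mul, norm_mul, Complex.norm_natCast]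
      gcongr
      exact mul_le_of_le_one_right (by positivity) hw1
    linarith
  constructor
  · have h7 : μ ((‖z‖ : ℝ) : ℂ) * ‖deriv ϕ z * g z‖ ≤
        μ ((‖z‖ : ℝ) : ℂ) * (N * ‖deriv ϕ z * g z‖) := by
      gcongr
      exact le_mul_of_one_le_left (norm_nonneg _) hN1
    have h8 := mul_le_mul_of_nonneg_left h3 hμz.le
    have h9 := mul_le_mul_of_nonneg_left hg0 (zero_le_one.trans hN1)
    rw [mul_add] at h8
    linarith [mul_left_comm N (μ ((‖z‖ : ℝ) : ℂ)) ‖deriv g z‖]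
  · have := mul_le_mul_of_nonneg_right hN1 hG₀
    linarith

/-- Growth bounds involve `1 - x`, the boundary quantities `1 - x ^ 2`; since `1 - x ^ 2 ≤ 2 (1 -
x)`, passing between them costs `2 ^ e`. -/
theorem weight_mul_norm_le {φ : ℝ → ℝ} {x m u D C e b : ℝ} (hx0 : 0 ≤ x) (hx1 : x < 1)
    (hφ : 0 < φ x) (he : 0 ≤ e) (hC : 0 ≤ C) (hmu : 0 ≤ m * u)
    (hD : D ≤ C / (φ x * (1 - x) ^ e)) (hb : m * u / (φ x * (1 - x ^ 2) ^ e) ≤ b) :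
    m * (D * u) ≤ C * 2 ^ e * b := by
  have h1 : 0 < 1 - x := by linarith
  have h2 : 0 < 1 - x ^ 2 := by nlinarith
  rw [div_le_iff₀ (by positivity)] at hb
  have hb0 : 0 ≤ b := by
    by_contra hlt
    have : b * (φ x * (1 - x ^ 2) ^ e) < 0 := mul_neg_of_neg_of_pos (not_le.1 hlt) (by positivity)
    linarith
  have h3 : (1 - x ^ 2) ^ e ≤ 2 ^ e * (1 - x) ^ e := by
    rw [← Real.mul_rpow zero_le_two h1.le]
    exact Real.rpow_le_rpow h2.le (by nlinarith) he
  calc m * (D * u) = D * (m * u) := by ring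
    _ ≤ C / (φ x * (1 - x) ^ e) * (b * (φ x * (2 ^ e * (1 - x) ^ e))) := by
      refine mul_le_mul hD (hb.trans (by gcongr)) hmu (by positivity)
    _ = _ := by field_simp

/-- The Zygmund norm of the integral operator applied to `f - f(r ·)`. -/
theorem exists_zygmundNorm_sub_dilation_le {p q : ℝ} (hp : 0 < p) (hq : 0 < q) {φ : ℝ → ℝ}
    (hφ : IsNormal φ) (n : ℕ) :
    ∃ C : ℝ, 0 < C ∧ ∀ (ϕ g : ℂ → ℂ) (hϕ : DifferentiableOn ℂ ϕ disc) (hmap : MapsTo ϕ disc disc)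
      (hg : DifferentiableOn ℂ g disc) (μ : ℂ → ℝ) (_ : IsWeight μ)
      (_ : ∀ f ∈ mixedNormSpace p q hp hq φ hφ, genIntOp n ϕ g hϕ hmap hg f ∈ zygmundSpace μ)
      (b l : ℝ), l < 1 → 0 ≤ b →
      (∀ z ∈ disc, l < ‖ϕ z‖ →
        μ ((‖z‖ : ℝ) : ℂ) * ‖deriv ϕ z * g z‖ /
          (φ ‖ϕ z‖ * (1 - ‖ϕ z‖ ^ 2) ^ (1 / q + n + 1)) ≤ b ∧
        μ ((‖z‖ : ℝ) : ℂ) * ‖deriv g z‖ / (φ ‖ϕ z‖ * (1 - ‖ϕ z‖ ^ 2) ^ (1 / q + n)) ≤ b) →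
      ∃ Q : ℝ, 0 ≤ Q ∧ ∀ (r : ℝ) (hr : r ∈ Icc (0 : ℝ) 1) (f : HolDisc), mixedNorm p q φ f ≤ 1 →
        zygmundNorm μ (genIntOp n ϕ g hϕ hmap hg (f - HolDisc.dilation hr f)) ≤
          ENNReal.ofReal (C * b + Q * (1 - r)) := by
  obtain ⟨C₀, hC₀, hh₀⟩ := exists_norm_iteratedDeriv_sub_dilation_le hp hq hφ n
  obtain ⟨C₁, hC₁, hh₁⟩ := exists_norm_iteratedDeriv_sub_dilation_le hp hq hφ (n + 1)
  refine ⟨C₁ * 2 ^ (1 / q + n + 1) + C₀ * 2 ^ (1 / q + n), by positivity,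
    fun ϕ g hϕ hmap hg μ hμ hinto b l hl hb hbd => ?_⟩
  obtain ⟨G, hG, hGz⟩ := exists_weight_mul_symbol_le hϕ hmap hg hμ hinto
  -- Including `ϕ 0` puts the term `|(C h)'(0)| = |h^{(n)}(ϕ(0)) g(0)|` of the Zygmund norm in the
  -- compact region, where it is `O(1 - r)`.
  set δ : ℝ := max l ‖ϕ 0‖ with hδ
  have hδ0 : 0 ≤ δ := (norm_nonneg _).trans (le_max_right _ _)
  have hδ1 : δ < 1 := max_lt hl (mem_ball_zero_iff.1 (hmap zero_mem_disc))
  obtain ⟨L₀, hL₀, hl₀⟩ := exists_norm_iteratedDeriv_sub_dilation_le_mul hp hq hφ n hδ0 hδ1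
  obtain ⟨L₁, hL₁, hl₁⟩ := exists_norm_iteratedDeriv_sub_dilation_le_mul hp hq hφ (n + 1) hδ0 hδ1
  -- This constant depends on `ϕ`, `g`, `μ` and `l`, which is harmless because it multiplies `1 -
  -- r`; the constant in front of `b` depends on none of them.
  refine ⟨L₀ * ‖g 0‖ + (L₁ * G + L₀ * G), by positivity, fun r hr f hf => ?_⟩
  have hr1 : 0 ≤ 1 - r := by linarith [hr.2]
  set h : HolDisc := f - HolDisc.dilation hr f with hh
  have hderiv : ‖deriv (genIntOp n ϕ g hϕ hmap hg h : ℂ → ℂ) 0‖ₑ ≤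
      ENNReal.ofReal (L₀ * (1 - r) * ‖g 0‖) := by
    rw [deriv_genIntOp hϕ hmap hg h zero_mem_disc, ← ofReal_norm, norm_mul]
    refine ENNReal.ofReal_le_ofReal ?_
    gcongr
    exact hl₀ r hr f hf _ (le_max_right _ _)
  have hsup : (⨆ z ∈ disc, ENNReal.ofReal (μ ((‖z‖ : ℝ) : ℂ)) *
      ‖deriv (deriv (genIntOp n ϕ g hϕ hmap hg h : ℂ → ℂ)) z‖ₑ) ≤ ENNReal.ofReal
      ((C₁ * 2 ^ (1 / q + n + 1) + C₀ * 2 ^ (1 / q + n)) * b +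
        (L₁ * G + L₀ * G) * (1 - r)) := by
    refine iSup₂_le fun z hz => ?_
    have hμz := hμ.pos_radial hz
    have hw := hmap hz
    have hw1 : ‖ϕ z‖ < 1 := mem_ball_zero_iff.1 hw
    have hφw := hφ.2.1 _ ⟨norm_nonneg _, hw1⟩
    rw [ofReal_mul_enorm hμz.le]
    refine ENNReal.ofReal_le_ofReal ?_
    rw [deriv_deriv_eq, ← HolDisc.derivAt_apply 2 hz, derivAt_two_genIntOp hϕ hmap hg]
    have h1 : μ ((‖z‖ : ℝ) : ℂ) * ‖iteratedDeriv (n + 1) (h : ℂ → ℂ) (ϕ z) * (deriv ϕ z * g z) +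
        iteratedDeriv n (h : ℂ → ℂ) (ϕ z) * deriv g z‖ ≤
        μ ((‖z‖ : ℝ) : ℂ) * (‖iteratedDeriv (n + 1) (h : ℂ → ℂ) (ϕ z)‖ * ‖deriv ϕ z * g z‖) +
        μ ((‖z‖ : ℝ) : ℂ) * (‖iteratedDeriv n (h : ℂ → ℂ) (ϕ z)‖ * ‖deriv g z‖) := by
      rw [← mul_add, ← norm_mul, ← norm_mul]
      gcongr
      exact norm_add_le _ _
    refine h1.trans ?_
    obtain ⟨g1, g0⟩ := hGz z hz
    rcases le_or_gt ‖ϕ z‖ δ with hle | hgt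
    · have k1 : μ ((‖z‖ : ℝ) : ℂ) * (‖iteratedDeriv (n + 1) (h : ℂ → ℂ) (ϕ z)‖ *
          ‖deriv ϕ z * g z‖) ≤ L₁ * (1 - r) * G := by
        rw [mul_left_comm]
        exact mul_le_mul (hl₁ r hr f hf _ hle) g1 (by positivity) (by positivity)
      have k0 : μ ((‖z‖ : ℝ) : ℂ) * (‖iteratedDeriv n (h : ℂ → ℂ) (ϕ z)‖ * ‖deriv g z‖) ≤
          L₀ * (1 - r) * G := by
        rw [mul_left_comm]
        exact mul_le_mul (hl₀ r hr f hf _ hle) g0 (by positivity) (by positivity)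
      have k2 : 0 ≤ (C₁ * 2 ^ (1 / q + n + 1) + C₀ * 2 ^ (1 / q + n)) * b := by positivity
      linarith
    · obtain ⟨b1, b0⟩ := hbd z hz ((le_max_left _ _).trans_lt hgt)
      have d1 := hh₁ r hr f hf _ hw
      rw [Nat.cast_succ, ← add_assoc] at d1
      have k1 := weight_mul_norm_le (norm_nonneg _) hw1 hφw (by positivity) hC₁.le
        (by positivity) d1 b1
      have k0 := weight_mul_norm_le (norm_nonneg _) hw1 hφw (by positivity) hC₀.le
        (by positivity) (hh₀ r hr f hf _ hw) b0
      have k2 : 0 ≤ (L₁ * G + L₀ * G) * (1 - r) := by positivity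
      linarith
  unfold zygmundNorm
  rw [genIntOp_apply_zero hϕ hmap hg h, enorm_zero, zero_add]
  refine (add_le_add hderiv hsup).trans ?_
  rw [← ENNReal.ofReal_add (by positivity) (by positivity)]
  exact ENNReal.ofReal_le_ofReal (le_of_eq (by ring))

theorem exists_le_of_limsupToBoundary_lt {ϕ : ℂ → ℂ} {F : ℂ → ℝ} {b : ℝ} (hb : 0 ≤ b)
    (hmap : MapsTo ϕ disc disc) (h : limsupToBoundary ϕ F < ENNReal.ofReal b) :
    ∃ l < 1, ∀ z ∈ disc, l < ‖ϕ z‖ → F z ≤ b := by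
  have h1 := eventually_lt_of_limsup_lt h
  rw [eventually_inf_principal, eventually_comap] at h1
  obtain ⟨l, hl, hsub⟩ := mem_nhdsLT_iff_exists_Ioo_subset.1 h1
  refine ⟨l, hl, fun z hz hlz => ?_⟩
  have h2 : ENNReal.ofReal (F z) < ENNReal.ofReal b :=
    hsub ⟨hlz, mem_ball_zero_iff.1 (hmap hz)⟩ z rfl hz
  exact (ENNReal.ofReal_le_ofReal_iff hb).1 h2.le

/-- The upper estimate of the essential norm. -/
theorem exists_essNorm_le {p q : ℝ} (hp : 0 < p) (hq : 0 < q) {φ : ℝ → ℝ}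
    (hφ : IsNormal φ) (n : ℕ) :
    ∃ C : ℝ, 0 < C ∧ ∀ (ϕ g : ℂ → ℂ) (hϕ : DifferentiableOn ℂ ϕ disc)
      (hmap : MapsTo ϕ disc disc) (hg : DifferentiableOn ℂ g disc) (μ : ℂ → ℝ) (_ : IsWeight μ)
      (hinto : ∀ f ∈ mixedNormSpace p q hp hq φ hφ,
        genIntOp n ϕ g hϕ hmap hg f ∈ zygmundSpace μ),
      IsBoundedOp mixedNormOn zygmundNormOn ((genIntOp n ϕ g hϕ hmap hg).restrict hinto) →
      essNormOf mixedNormOn zygmundNormOn ((genIntOp n ϕ g hϕ hmap hg).restrict hinto) ≤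
        ENNReal.ofReal C * boundaryMax q φ n ϕ g μ := by
  obtain ⟨C, hC, h⟩ := exists_zygmundNorm_sub_dilation_le hp hq hφ n
  refine ⟨C, hC, fun ϕ g hϕ hmap hg μ hμ hinto hT => ?_⟩
  set M := boundaryMax q φ n ϕ g μ with hM
  rcases eq_or_ne M ∞ with htop | htop
  · rw [htop, ENNReal.mul_top (by simpa using hC)]
    exact le_top
  have hbound : ∀ b : ℝ, M < ENNReal.ofReal b →
      essNormOf mixedNormOn zygmundNormOn ((genIntOp n ϕ g hϕ hmap hg).restrict hinto) ≤
        ENNReal.ofReal (C * b) := fun b hb => by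
    have hb0 : 0 ≤ b := (ENNReal.ofReal_pos.1 (bot_le.trans_lt hb)).le
    obtain ⟨l₁, hl₁, h₁⟩ :=
      exists_le_of_limsupToBoundary_lt hb0 hmap ((le_max_left _ _).trans_lt hb)
    obtain ⟨l₂, hl₂, h₂⟩ :=
      exists_le_of_limsupToBoundary_lt hb0 hmap ((le_max_right _ _).trans_lt hb)
    obtain ⟨Q, hQ, hr⟩ := h ϕ g hϕ hmap hg μ hμ hinto b (max l₁ l₂) (max_lt hl₁ hl₂) hb0
      fun z hz hlz => ⟨h₁ z hz ((le_max_left _ _).trans_lt hlz),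
        h₂ z hz ((le_max_right _ _).trans_lt hlz)⟩
    -- Dilation by `r = 1 - 1 / (k + 1)`; letting `k → ∞` removes the term with `Q`, after which `b`
    -- may decrease to `M`.
    have hk : ∀ k : ℕ, essNormOf mixedNormOn zygmundNormOn
        ((genIntOp n ϕ g hϕ hmap hg).restrict hinto) ≤
        ENNReal.ofReal (C * b + Q * (1 / ((k : ℝ) + 1))) := fun k => by
      have hk0 : 0 < 1 / ((k : ℝ) + 1) := by positivity
      have hk1 : 1 / ((k : ℝ) + 1) ≤ 1 := by
        rw [div_le_one (by positivity)]
        linarith [(Nat.cast_nonneg k : (0 : ℝ) ≤ k)]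
      have hmem : 1 - 1 / ((k : ℝ) + 1) ∈ Ico (0 : ℝ) 1 := ⟨by linarith, by linarith⟩
      refine essNormOf_le hT (isCompactOp_dilation hp hq hφ hmem) fun x hx => ?_
      have := hr _ (Ico_subset_Icc_self hmem) (x : HolDisc) hx
      rwa [sub_sub_cancel] at this
    have hlim : Tendsto (fun k : ℕ => ENNReal.ofReal (C * b + Q * (1 / ((k : ℝ) + 1)))) atTop
        (𝓝 (ENNReal.ofReal (C * b))) := by
      refine ENNReal.tendsto_ofReal ?_
      simpa using (tendsto_one_div_add_atTop_nhds_zero_nat.const_mul Q).const_add (C * b)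
    exact ge_of_tendsto' hlim hk
  have hlim : Tendsto (fun k : ℕ => ENNReal.ofReal (C * (M.toReal + 1 / ((k : ℝ) + 1)))) atTop
      (𝓝 (ENNReal.ofReal (C * M.toReal))) := by
    refine ENNReal.tendsto_ofReal ?_
    simpa using (tendsto_one_div_add_atTop_nhds_zero_nat.const_add M.toReal).const_mul C
  have hfin : ENNReal.ofReal (C * M.toReal) = ENNReal.ofReal C * M := by
    rw [ENNReal.ofReal_mul hC.le, ENNReal.ofReal_toReal htop]
  rw [← hfin]
  refine ge_of_tendsto' hlim fun k => hbound _ ?_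
  rw [ENNReal.lt_ofReal_iff_toReal_lt htop]
  exact lt_add_of_pos_right _ (by positivity)

theorem theorem2p4 (p q : ℝ) (hp : 0 < p) (hq : 0 < q) (φ : ℝ → ℝ) (hφ : IsNormal φ) (n : ℕ) :
    ∃ c C : ℝ, 0 < c ∧ 0 < C ∧
      ∀ (ϕ g : ℂ → ℂ) (hϕ : DifferentiableOn ℂ ϕ disc) (hmap : Set.MapsTo ϕ disc disc)
        (hg : DifferentiableOn ℂ g disc) (μ : ℂ → ℝ) (_ : IsWeight μ)
        (hinto : ∀ f ∈ mixedNormSpace p q hp hq φ hφ,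
          genIntOp n ϕ g hϕ hmap hg f ∈ zygmundSpace μ),
        IsBoundedOp mixedNormOn zygmundNormOn ((genIntOp n ϕ g hϕ hmap hg).restrict hinto) →
          ENNReal.ofReal c * boundaryMax q φ n ϕ g μ ≤
              essNormOf mixedNormOn zygmundNormOn ((genIntOp n ϕ g hϕ hmap hg).restrict hinto) ∧
            essNormOf mixedNormOn zygmundNormOn ((genIntOp n ϕ g hϕ hmap hg).restrict hinto) ≤
              ENNReal.ofReal C * boundaryMax q φ n ϕ g μ := by
  -- The pair `(i, j) = (n + 1, n)` isolates the term of `A`, and `(n, n + 1)` that of `B`.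
  obtain ⟨c₁, hc₁, h₁⟩ := exists_mul_limsupToBoundary_le hp hq hφ (Nat.succ_ne_self n)
  obtain ⟨c₀, hc₀, h₀⟩ := exists_mul_limsupToBoundary_le hp hq hφ (Nat.succ_ne_self n).symm
  obtain ⟨C, hC, hup⟩ := exists_essNorm_le hp hq hφ n
  refine ⟨min c₁ c₀, C, lt_min hc₁ hc₀, hC, fun ϕ g hϕ hmap hg μ hμ hinto hT =>
    ⟨?_, hup ϕ g hϕ hmap hg μ hμ hinto hT⟩⟩
  have k₁ := h₁ n ϕ g (fun z => deriv ϕ z * g z) hϕ hmap hg μ hinto fun f z hz hf => by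
    rw [derivAt_two_genIntOp hϕ hmap hg, hf, zero_mul, add_zero]
  have k₀ := h₀ n ϕ g (deriv g) hϕ hmap hg μ hinto fun f z hz hf => by
    rw [derivAt_two_genIntOp hϕ hmap hg, hf, zero_mul, zero_add]
  simp only [Nat.succ_eq_add_one, Nat.cast_succ, ← add_assoc] at k₁
  rw [boundaryMax, mul_max]
  refine max_le (le_trans ?_ k₁) (le_trans ?_ k₀)
  · gcongr
    exact min_le_left _ _
  · gcongr
    exact min_le_right _ _

end
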